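/- **Theorem.** Let $\mathbb K$ be $\mathbb R$ or $\mathbb C$ and consider the following Lie algebras over $\mathbb K$ (brackets of basis vectors that are neither listed nor obtained from the listed ones by skew-symmetry are zero). * $\mathfrak n_1^{\pm}$: let $\mathfrak s^{\pm}$ be the three-dimensional Lie algebra with basis $u,v,w$ and $[u,v]=w$, $[v,w]=\pm u$, $[w,u]=v$. Then $\mathfrak n_1^{\pm}$ is the subalgebra of $\mathfrak s^{\pm}\otimes\mathbb K[t]$ (with bracket $[a\otimes P,b\otimes Q]=[a,b]\otimes PQ$) spanned by $u\otimes t^{2k+1}$, $v\otimes t^{2k+1}$, $w\otimes t^{2k+2}$, $k\ge 0$. * $\mathfrak n_2$: basis $e_1,e_2,e_3,\dots$ and $[e_q,e_l]=d_{q,l}\,e_{q+l}$, where $d_{q,l}$ depends only on the residues of $q$ and $l$ modulo $8$ and is given by the matrix (rows $q$ and columns $l$ numbered $0,1,\dots,7$) $$\begin{pmatrix}0&1&-2&-1&0&1&2&-1\\-1&0&1&1&-3&-2&0&1\\2&-1&0&0&0&1&-1&0\\1&-1&0&0&3&-1&1&-2\\0&3&0&-3&0&3&0&-3\\-1&2&-1&1&-3&0&0&1\\-2&0&1&-1&0&0&0&1\\1&-1&0&2&3&-1&-1&0\end{pmatrix}.$$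 * $\mathfrak n_2^3$: basis $z,e_1,e_2,e_3,\dots$, where $z$ is central, $[e_2,e_3]=z$, and all other brackets of the $e_i$ are as in $\mathfrak n_2$ (in which $[e_2,e_3]=0$). * $\mathfrak m_0$: basis $e_1,e_2,e_3,\dots$ and $[e_1,e_i]=e_{i+1}$ for $i\ge 2$. * $\mathfrak m_0^S$, for a set $S\subset\{3,5,7,\dots\}$ (finite or infinite): basis $e_i$ ($i\ge1$) and $z_r$ ($r\in S$), with $[e_1,e_i]=e_{i+1}$ for $i\ge 2$ and $[e_l,e_{r-l+2}]=(-1)^{l+1}z_r$ for $r\in S$, $2\le l\le\frac{r+1}{2}$. Let $\mathfrak g=\bigoplus_{i=1}^{\infty}\mathfrak g_i$ be an infinite-dimensional Lie algebra over $\mathbb K$, graded by the positive integers ($[\mathfrak g_i,\mathfrak g_j]\subset\mathfrak g_{i+j}$), such that $$[\mathfrak g_1,\mathfrak g_i]=\mathfrak g_{i+1},\qquad \dim\mathfrak g_i+\dim\mathfrak g_{i+1}\le 3\qquad\text{for all } i\ge 1.$$ 1. If $\mathbb K=\mathbb R$, then $\mathfrak g$ is isomorphic, as a Lie algebra, to one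 and only one algebra on the list $\mathfrak n_1^+$, $\mathfrak n_1^-$, $\mathfrak n_2$, $\mathfrak n_2^3$, $\mathfrak m_0$, and $\mathfrak m_0^S$ with $\emptyset\ne S\subset\{3,5,7,\dots\}$. 2. If $\mathbb K=\mathbb C$, then $\mathfrak g$ is isomorphic to one and only one algebra on the list $\mathfrak n_1^+$, $\mathfrak n_2$, $\mathfrak n_2^3$, $\mathfrak m_0$, and $\mathfrak m_0^S$ with $\emptyset\ne S\subset\{3,5,7,\dots\}$; moreover $\mathfrak n_1^+\cong\mathfrak n_1^-$ over $\mathbb C$. -/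

import Mathlib

open scoped TensorProduct Polynomial

noncomputable section

namespace NarrowLie

/-! ### Lie algebras given by a basis and structure constants -/

section StructureConstants

variable {K ι : Type*} [CommRing K]

/-- The bilinear operation on the free module with basis `ι` which takes the pair of basis
vectors `(i, j)` to `c i j`. -/
def bilin {κ : Type*} (c : ι → ι → (κ →₀ K)) : (ι →₀ K) →ₗ[K] (ι →₀ K) →ₗ[K] (κ →₀ K) :=
  Finsupp.linearCombination K fun i => Finsupp.linearCombination K (c i)

@[simp]
theorem bilin_single {κ : Type*} (c : ι → ι → (κ →₀ K)) (i j : ι) (a b : K) :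
    bilin c (Finsupp.single i a) (Finsupp.single j b) = a • b • c i j := by
  simp [bilin, Finsupp.linearCombination_single]

variable (K ι) in
/-- Structure constants of a Lie algebra with basis `ι`: the brackets of the basis vectors,
alternating and satisfying the Jacobi identity. -/
structure LieConstants where
  /-- The bracket of two basis vectors. -/
  c : ι → ι → (ι →₀ K)
  c_self : ∀ i, c i i = 0
  c_skew : ∀ i j, c i j = -c j i
  jacobi : ∀ i j k, bilin c (c i j) (Finsupp.single k 1) + bilin c (c j k) (Finsupp.single i 1)
    + bilin c (c k i) (Finsupp.single j 1) = 0

namespace LieConstants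

variable (s : LieConstants K ι)

/-- The Lie algebra with basis `ι` and the given structure constants. -/
def Algebra (_s : LieConstants K ι) : Type _ := ι →₀ K

instance : AddCommGroup s.Algebra := inferInstanceAs (AddCommGroup (ι →₀ K))

instance : Module K s.Algebra := inferInstanceAs (Module K (ι →₀ K))

/-- The basis vectors. -/
def e (i : ι) : s.Algebra := (Finsupp.single i 1 : ι →₀ K)

/-- The bracket as a bilinear map. -/
def br : (ι →₀ K) →ₗ[K] (ι →₀ K) →ₗ[K] (ι →₀ K) := bilin s.c

theorem br_skew (x y : ι →₀ K) : s.br x y = -s.br y x := by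
  rw [← add_eq_zero_iff_eq_neg]
  induction x using Finsupp.induction_linear with
  | zero => simp
  | add x x' hx hx' =>
    have := congrArg₂ (· + ·) hx hx'
    simp only [map_add, LinearMap.add_apply, add_zero] at this ⊢
    rw [← this]; abel
  | single i a =>
  induction y using Finsupp.induction_linear with
  | zero => simp
  | add x x' hx hx' =>
    have := congrArg₂ (· + ·) hx hx'
    simp only [map_add, LinearMap.add_apply, add_zero] at this ⊢
    rw [← this]; abel
  | single j b =>
    simp only [br, bilin_single, s.c_skew j i, smul_smul, smul_neg, mul_comm b a, add_neg_cancel]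

theorem br_self (x : ι →₀ K) : s.br x x = 0 := by
  induction x using Finsupp.induction_linear with
  | zero => simp
  | add x y hx hy => simp [hx, hy, s.br_skew x y]
  | single i a => simp [br, s.c_self]

theorem br_jacobi (x y z : ι →₀ K) :
    s.br (s.br x y) z + s.br (s.br y z) x + s.br (s.br z x) y = 0 := by
  induction x using Finsupp.induction_linear with
  | zero => simp
  | add x x' hx hx' =>
    have := congrArg₂ (· + ·) hx hx'
    simp only [map_add, LinearMap.add_apply, add_zero] at this ⊢
    rw [← this]; abel
  | single i a =>
  induction y using Finsupp.induction_linear with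
  | zero => simp
  | add x x' hx hx' =>
    have := congrArg₂ (· + ·) hx hx'
    simp only [map_add, LinearMap.add_apply, add_zero] at this ⊢
    rw [← this]; abel
  | single j b =>
  induction z using Finsupp.induction_linear with
  | zero => simp
  | add x x' hx hx' =>
    have := congrArg₂ (· + ·) hx hx'
    simp only [map_add, LinearMap.add_apply, add_zero] at this ⊢
    rw [← this]; abel
  | single k d =>
    have h := s.jacobi i j k
    have e1 : ∀ (l : ι) (t : K), (Finsupp.single l t : ι →₀ K) = t • Finsupp.single l 1 := by simp
    rw [e1 i a, e1 j b, e1 k d]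
    simp only [br, map_smul, LinearMap.smul_apply, bilin_single, one_smul, smul_smul] at h ⊢
    linear_combination (norm := module) (a * b * d) • h

theorem br_leibniz (x y z : ι →₀ K) :
    s.br x (s.br y z) = s.br (s.br x y) z + s.br y (s.br x z) := by
  have h := s.br_jacobi x y z
  have h' : s.br (s.br x z) y = -s.br (s.br z x) y := by
    rw [s.br_skew x z, LinearMap.map_neg₂]
  rw [s.br_skew x (s.br y z), s.br_skew y (s.br x z), h', neg_neg, neg_eq_iff_add_eq_zero, ← h]
  abel

instance : LieRing s.Algebra where
  bracket x y := s.br x y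
  add_lie x y z := by
    change s.br (x + y) z = s.br x z + s.br y z
    exact LinearMap.map_add₂ _ _ _ _
  lie_add x y z := (s.br x).map_add y z
  lie_self x := s.br_self x
  leibniz_lie x y z := s.br_leibniz x y z

instance : LieAlgebra K s.Algebra where
  lie_smul t x y := (s.br x).map_smul t y

theorem lie_e (i j : ι) : (⁅s.e i, s.e j⁆ : s.Algebra) = s.c i j := by
  change bilin s.c (Finsupp.single i 1) (Finsupp.single j 1) = _
  simp

/-- The central extension with basis `ι ⊕ κ`: the new basis vectors `Sum.inr k` are central, and
`ω i j` is added to the bracket of the basis vectors `i` and `j`. The last hypothesis says that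
`ω` is a 2-cocycle. -/
def centralExt {κ : Type*} (ω : ι → ι → (κ →₀ K)) (ω_self : ∀ i, ω i i = 0)
    (ω_skew : ∀ i j, ω i j = -ω j i)
    (cocycle : ∀ i j k, bilin ω (s.c i j) (Finsupp.single k 1)
      + bilin ω (s.c j k) (Finsupp.single i 1) + bilin ω (s.c k i) (Finsupp.single j 1) = 0) :
    LieConstants K (ι ⊕ κ) where
  c
    | .inl i, .inl j => (s.c i j).mapDomain Sum.inl + (ω i j).mapDomain Sum.inr
    | _, _ => 0
  c_self
    | .inl i => by simp [s.c_self, ω_self]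
    | .inr k => rfl
  c_skew
    | .inl i, .inl j => by
      simp only [s.c_skew i j, ω_skew i j]
      rw [← Finsupp.lmapDomain_apply K K, ← Finsupp.lmapDomain_apply K K,
        ← Finsupp.lmapDomain_apply K K, ← Finsupp.lmapDomain_apply K K, map_neg, map_neg]
      abel
    | .inl _, .inr _ | .inr _, .inl _ | .inr _, .inr _ => by simp
  jacobi := by
    set c : ι ⊕ κ → ι ⊕ κ → (ι ⊕ κ →₀ K) := fun
      | .inl i, .inl j => (s.c i j).mapDomain Sum.inl + (ω i j).mapDomain Sum.inr
      | _, _ => 0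
    have key : ∀ (x : ι →₀ K) (k : ι),
        bilin c (x.mapDomain Sum.inl) (Finsupp.single (Sum.inl k) 1)
          = (bilin s.c x (Finsupp.single k 1)).mapDomain Sum.inl
            + (bilin ω x (Finsupp.single k 1)).mapDomain Sum.inr := by
      intro x k
      simp only [← Finsupp.lmapDomain_apply K K]
      induction x using Finsupp.induction_linear with
      | zero => simp
      | add x y hx hy =>
        simp only [map_add, LinearMap.add_apply, hx, hy]
        abel
      | single i a => simp [c]
    have key2 : ∀ (x : κ →₀ K) (k : ι ⊕ κ),
        bilin c (x.mapDomain Sum.inr) (Finsupp.single k 1) = 0 := by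
      intro x k
      simp only [← Finsupp.lmapDomain_apply K K]
      induction x using Finsupp.induction_linear with
      | zero => simp
      | add x y hx hy => simp only [map_add, LinearMap.add_apply, hx, hy, add_zero]
      | single i a => simp [c]
    have key3 : ∀ (x : ι ⊕ κ →₀ K) (k : κ),
        bilin c x (Finsupp.single (Sum.inr k) 1) = 0 := by
      intro x k
      induction x using Finsupp.induction_linear with
      | zero => simp
      | add x y hx hy => simp [hx, hy]
      | single i a => cases i <;> simp [c]
    rintro (i | i) (j | j) (k | k) <;>
      first
      | (simp only [c, map_add, LinearMap.add_apply, key, key2, key3, map_zero,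
          LinearMap.zero_apply, add_zero]; done)
      | skip
    simp only [c, map_add, LinearMap.add_apply, key, key2, add_zero]
    have h1 := congrArg (Finsupp.lmapDomain K K (Sum.inl : ι → ι ⊕ κ)) (s.jacobi i j k)
    have h2 := congrArg (Finsupp.lmapDomain K K (Sum.inr : κ → ι ⊕ κ)) (cocycle i j k)
    simp only [map_add, map_zero, Finsupp.lmapDomain_apply] at h1 h2
    have h := congrArg₂ (· + ·) h1 h2
    simp only [add_zero] at h
    rw [← h]
    abel

end LieConstants

/-- Structure constants `[e_i, e_j] = a i j • e_{i+j}` on the basis `e_1, e_2, e_3, …`. -/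
def widthOne (a : ℕ+ → ℕ+ → K) (a_self : ∀ i, a i i = 0) (a_skew : ∀ i j, a i j = -a j i)
    (jacobi : ∀ i j k, a i j * a (i + j) k + a j k * a (j + k) i + a k i * a (k + i) j = 0) :
    LieConstants K ℕ+ where
  c i j := Finsupp.single (i + j) (a i j)
  c_self i := by simp [a_self]
  c_skew i j := by rw [a_skew i j, add_comm i j, Finsupp.single_neg]
  jacobi i j k := by
    simp only [bilin_single, Finsupp.smul_single, smul_eq_mul, one_mul]
    rw [show j + k + i = i + j + k by ac_rfl, show k + i + j = i + j + k by ac_rfl,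
      ← Finsupp.single_add, ← Finsupp.single_add, jacobi, Finsupp.single_zero]

end StructureConstants

variable (K : Type*) [Field K]

/-! ### The algebra `m_0` and its central extensions `m_0^S` -/

/-- `[e_1, e_j] = e_{j+1}` for `j ≥ 2`, all other brackets of `e_i, e_j` with `i < j` vanish. -/
def m0Coeff (i j : ℕ+) : K :=
  if i = 1 ∧ 2 ≤ j then 1 else if j = 1 ∧ 2 ≤ i then -1 else 0

theorem m0Coeff_eq (i j : ℕ+) :
    m0Coeff K i j = if i = 1 then (if j = 1 then 0 else 1) else (if j = 1 then -1 else 0) := by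
  have h : ∀ n : ℕ+, 2 ≤ n ↔ n ≠ 1 := fun n => by
    rw [← PNat.coe_le_coe, ← PNat.coe_inj.ne, PNat.one_coe, PNat.val_ofNat]
    have := n.pos
    omega
  by_cases hi : i = 1 <;> by_cases hj : j = 1 <;> simp [m0Coeff, h, hi, hj]

theorem m0Coeff_self (i : ℕ+) : m0Coeff K i i = 0 := by
  by_cases hi : i = 1 <;> simp [m0Coeff_eq, hi]

theorem m0Coeff_skew (i j : ℕ+) : m0Coeff K i j = -m0Coeff K j i := by
  by_cases hi : i = 1 <;> by_cases hj : j = 1 <;> simp [m0Coeff_eq, hi, hj]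

theorem add_ne_one (i j : ℕ+) : i + j ≠ 1 := by
  rw [← PNat.coe_inj.ne, PNat.add_coe, PNat.one_coe]
  have := i.pos
  have := j.pos
  omega

theorem m0Coeff_jacobi (i j k : ℕ+) :
    m0Coeff K i j * m0Coeff K (i + j) k + m0Coeff K j k * m0Coeff K (j + k) i
      + m0Coeff K k i * m0Coeff K (k + i) j = 0 := by
  by_cases hi : i = 1 <;> by_cases hj : j = 1 <;> by_cases hk : k = 1 <;>
    simp [m0Coeff_eq, hi, hj, hk, add_ne_one]

/-- Structure constants of `m_0`. -/
def m0 : LieConstants K ℕ+ :=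
  widthOne (m0Coeff K) (m0Coeff_self K) (m0Coeff_skew K) (m0Coeff_jacobi K)

/-- The sets of odd integers `≥ 3`. -/
def OddSet : Type := {S : Set ℕ // ∀ r ∈ S, Odd r ∧ 3 ≤ r}

open Classical in
/-- The cocycle with `(e_l, e_{r-l+2}) ↦ (-1)^(l+1) z_r` for `r ∈ S` and `2 ≤ l ≤ r`. As `r` is
odd, this is skew-symmetric, so it is determined by its values for `2 ≤ l ≤ (r+1)/2`. -/
def m0Cocycle (S : OddSet) (i j : ℕ+) : S.1 →₀ K :=
  if h : 2 ≤ i ∧ 2 ≤ j ∧ (i : ℕ) + j - 2 ∈ S.1 then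
    Finsupp.single ⟨(i : ℕ) + j - 2, h.2.2⟩ ((-1) ^ ((i : ℕ) + 1))
  else 0

theorem m0Cocycle_self (S : OddSet) (i : ℕ+) : m0Cocycle K S i i = 0 := by
  unfold m0Cocycle
  split_ifs with h
  · obtain ⟨⟨m, hm⟩, -⟩ := S.2 _ h.2.2
    omega
  · rfl

theorem m0Cocycle_skew (S : OddSet) (i j : ℕ+) : m0Cocycle K S i j = -m0Cocycle K S j i := by
  unfold m0Cocycle
  by_cases h : 2 ≤ i ∧ 2 ≤ j ∧ (i : ℕ) + j - 2 ∈ S.1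
  · have h' : 2 ≤ j ∧ 2 ≤ i ∧ (j : ℕ) + i - 2 ∈ S.1 := ⟨h.2.1, h.1, by rw [add_comm]; exact h.2.2⟩
    obtain ⟨⟨m, hm⟩, -⟩ := S.2 _ h.2.2
    rw [dif_pos h, dif_pos h', ← Finsupp.single_neg]
    congr 1
    · simp only [add_comm]
    · rcases Nat.even_or_odd (i : ℕ) with hi | hi
      · have hj : Odd (j : ℕ) := by
          rw [Nat.odd_iff]; rw [Nat.even_iff] at hi
          have := PNat.coe_le_coe _ _ |>.2 h.1
          have := PNat.coe_le_coe _ _ |>.2 h.2.1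
          simp only [PNat.val_ofNat] at *
          omega
        simp [pow_succ, hi.neg_one_pow, hj.neg_one_pow]
      · have hj : Even (j : ℕ) := by
          rw [Nat.even_iff]; rw [Nat.odd_iff] at hi
          have := PNat.coe_le_coe _ _ |>.2 h.1
          have := PNat.coe_le_coe _ _ |>.2 h.2.1
          simp only [PNat.val_ofNat] at *
          omega
        simp [pow_succ, hi.neg_one_pow, hj.neg_one_pow]
  · have h' : ¬ (2 ≤ j ∧ 2 ≤ i ∧ (j : ℕ) + i - 2 ∈ S.1) := fun h' =>
      h ⟨h'.2.1, h'.1, by rw [add_comm]; exact h'.2.2⟩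
    rw [dif_neg h, dif_neg h', neg_zero]

/-- Moving one step along an antidiagonal changes the sign, unless the index `1` is involved. -/
theorem m0Cocycle_succ (S : OddSet) (i j : ℕ+) (hi : i ≠ 1) (hj : j ≠ 1) :
    m0Cocycle K S (1 + i) j + m0Cocycle K S i (1 + j) = 0 := by
  have two : ∀ n : ℕ+, n ≠ 1 → 2 ≤ n := fun n h => by
    rw [← PNat.coe_inj.ne, PNat.one_coe] at h
    rw [← PNat.coe_le_coe, PNat.val_ofNat]
    have := n.pos
    omega
  have h1 := two i hi
  have h2 := two j hj
  have h3 := two (1 + i) (add_ne_one 1 i)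
  have h4 := two (1 + j) (add_ne_one 1 j)
  have e : ((1 + i : ℕ+) : ℕ) + j - 2 = (i : ℕ) + (1 + j : ℕ+) - 2 := by
    simp only [PNat.add_coe]; congr 1; ring
  unfold m0Cocycle
  by_cases h : (i : ℕ) + (1 + j : ℕ+) - 2 ∈ S.1
  · have h' : ((1 + i : ℕ+) : ℕ) + j - 2 ∈ S.1 := by rw [e]; exact h
    rw [dif_pos ⟨h3, h2, h'⟩, dif_pos ⟨h1, h4, h⟩]
    have e' : (⟨_, h'⟩ : S.1) = ⟨_, h⟩ := Subtype.ext e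
    rw [e', ← Finsupp.single_add, ← Finsupp.single_zero (⟨_, h⟩ : S.1)]
    congr 1
    rw [PNat.add_coe, PNat.one_coe]
    ring
  · have h' : ((1 + i : ℕ+) : ℕ) + j - 2 ∉ S.1 := by rw [e]; exact h
    rw [dif_neg (fun t => h' t.2.2), dif_neg (fun t => h t.2.2), add_zero]

theorem m0Cocycle_one_right (S : OddSet) (i : ℕ+) : m0Cocycle K S i 1 = 0 :=
  dif_neg fun h => absurd h.2.1 (by decide)

theorem m0Cocycle_cocycle (S : OddSet) (i j k : ℕ+) :
    bilin (m0Cocycle K S) ((m0 K).c i j) (Finsupp.single k 1)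
      + bilin (m0Cocycle K S) ((m0 K).c j k) (Finsupp.single i 1)
      + bilin (m0Cocycle K S) ((m0 K).c k i) (Finsupp.single j 1) = 0 := by
  have key : ∀ i j : ℕ+, i ≠ 1 → j ≠ 1 →
      m0Cocycle K S (1 + i) j - m0Cocycle K S (1 + j) i = 0 := fun i j hi hj => by
    rw [m0Cocycle_skew K S (1 + j) i, sub_neg_eq_add, m0Cocycle_succ K S i j hi hj]
  simp only [m0, widthOne, bilin_single, one_smul, m0Coeff_eq]
  by_cases hi : i = 1 <;> by_cases hj : j = 1 <;> by_cases hk : k = 1 <;>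
    simp only [hi, hj, hk, if_true, if_false, m0Cocycle_one_right, zero_smul, smul_zero, one_smul,
      neg_smul, add_zero, zero_add]
  · rw [add_comm k 1, ← sub_eq_add_neg]
    exact key j k hj hk
  · rw [add_comm i 1, neg_add_eq_sub]
    exact key k i hk hi
  · rw [add_comm j 1, neg_add_eq_sub]
    exact key i j hi hj

/-- Structure constants of `m_0^S`, with basis `e_i` (`i ≥ 1`) and `z_r` (`r ∈ S`). -/
def m0S (S : OddSet) : LieConstants K (ℕ+ ⊕ S.1) :=
  (m0 K).centralExt (m0Cocycle K S) (m0Cocycle_self K S) (m0Cocycle_skew K S)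
    (m0Cocycle_cocycle K S)

/-! ### The algebra `n_2` and its central extension `n_2^3` -/

/-- The structure constants of `n_2`: `[e_q, e_l] = d q l • e_{q+l}`, where `d q l` depends only on
the residues of `q` and `l` modulo `8`; rows and columns are numbered `0, …, 7`. -/
def n2Table : Matrix (Fin 8) (Fin 8) ℤ :=
  !![ 0,  1, -2, -1,  0,  1,  2, -1;
     -1,  0,  1,  1, -3, -2,  0,  1;
      2, -1,  0,  0,  0,  1, -1,  0;
      1, -1,  0,  0,  3, -1,  1, -2;
      0,  3,  0, -3,  0,  3,  0, -3;
     -1,  2, -1,  1, -3,  0,  0,  1;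
     -2,  0,  1, -1,  0,  0,  0,  1;
      1, -1,  0,  2,  3, -1, -1,  0]

theorem n2Table_skew : ∀ q l : Fin 8, n2Table q l + n2Table l q = 0 := by decide

set_option maxRecDepth 100000 in
theorem n2Table_jacobi : ∀ i j k : Fin 8,
    n2Table i j * n2Table (i + j) k + n2Table j k * n2Table (j + k) i
      + n2Table k i * n2Table (k + i) j = 0 := by decide

/-- The residue modulo `8`. -/
def res8 (i : ℕ+) : Fin 8 := Fin.ofNat 8 i

theorem res8_add (i j : ℕ+) : res8 (i + j) = res8 i + res8 j := by
  apply Fin.ext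
  simp [res8, Fin.val_add]

/-- Structure constants of `n_2`. -/
def n2 : LieConstants K ℕ+ :=
  widthOne (fun q l => (n2Table (res8 q) (res8 l) : K))
    (fun q => by
      have : ∀ q : Fin 8, n2Table q q = 0 := by decide
      simp [this])
    (fun q l => by
      rw [← add_eq_zero_iff_eq_neg]
      exact_mod_cast congrArg (Int.cast : ℤ → K) (n2Table_skew (res8 q) (res8 l)))
    (fun i j k => by
      simp only [res8_add]
      exact_mod_cast congrArg (Int.cast : ℤ → K) (n2Table_jacobi (res8 i) (res8 j) (res8 k)))

/-- The cocycle with `(e_2, e_3) ↦ z` and `(e_i, e_j) ↦ 0` for all other `i < j`. -/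
def n2Cocycle (i j : ℕ+) : Unit →₀ K :=
  if i = 2 ∧ j = 3 then Finsupp.single () 1 else if i = 3 ∧ j = 2 then -Finsupp.single () 1 else 0

theorem n2Cocycle_cocycle (i j k : ℕ+) :
    bilin (n2Cocycle K) ((n2 K).c i j) (Finsupp.single k 1)
      + bilin (n2Cocycle K) ((n2 K).c j k) (Finsupp.single i 1)
      + bilin (n2Cocycle K) ((n2 K).c k i) (Finsupp.single j 1) = 0 := by
  simp only [n2, widthOne, bilin_single, one_smul]
  have big : ∀ i j k : ℕ+, (i + j + k : ℕ) ≠ 5 → n2Cocycle K (i + j) k = 0 := fun i j k h => by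
    unfold n2Cocycle
    simp only [← PNat.coe_inj, PNat.add_coe, PNat.val_ofNat]
    rw [if_neg (by omega), if_neg (by omega)]
  by_cases h : (i + j + k : ℕ) = 5
  · have hi := i.pos
    have hj := j.pos
    have hk := k.pos
    have t : (i = 1 ∧ j = 1 ∧ k = 3) ∨ (i = 1 ∧ j = 3 ∧ k = 1) ∨ (i = 3 ∧ j = 1 ∧ k = 1) ∨
        (i = 1 ∧ j = 2 ∧ k = 2) ∨ (i = 2 ∧ j = 1 ∧ k = 2) ∨ (i = 2 ∧ j = 2 ∧ k = 1) := by
      simp only [← PNat.coe_inj, PNat.val_ofNat]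
      omega
    have d11 : n2Table (res8 1) (res8 1) = 0 := by decide
    have d22 : n2Table (res8 2) (res8 2) = 0 := by decide
    have d12 : n2Table (res8 1) (res8 2) = 1 := by decide
    have d21 : n2Table (res8 2) (res8 1) = -1 := by decide
    have c13 : n2Cocycle K (1 + 3) 1 = 0 := by simp only [n2Cocycle]; rfl
    have c31 : n2Cocycle K (3 + 1) 1 = 0 := by simp only [n2Cocycle]; rfl
    have e12 : (1 + 2 : ℕ+) = 2 + 1 := by decide
    rcases t with ⟨rfl, rfl, rfl⟩ | ⟨rfl, rfl, rfl⟩ | ⟨rfl, rfl, rfl⟩ | ⟨rfl, rfl, rfl⟩ |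
        ⟨rfl, rfl, rfl⟩ | ⟨rfl, rfl, rfl⟩ <;>
      simp [d11, d22, d12, d21, c13, c31, e12]
  · rw [big i j k h, big j k i (by omega), big k i j (by omega)]
    simp

/-- Structure constants of `n_2^3`, with basis `e_i` (`i ≥ 1`) and one central vector `z`. -/
def n23 : LieConstants K (ℕ+ ⊕ Unit) :=
  (n2 K).centralExt (n2Cocycle K)
    (fun i => by
      unfold n2Cocycle
      split_ifs with h h
      · exact absurd (h.1.symm.trans h.2) (by decide)
      · exact absurd (h.1.symm.trans h.2) (by decide)
      · rfl)
    (fun i j => by unfold n2Cocycle; split_ifs <;> simp_all)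
    (n2Cocycle_cocycle K)

/-! ### The algebras `n_1^±` -/

variable {K}

/-- The bracket of two coordinate vectors with respect to `u, v, w`, where
`[u, v] = w`, `[v, w] = ε u`, `[w, u] = v`. -/
def cross (ε : K) (x y : Fin 3 → K) : Fin 3 → K :=
  ![ε * (x 1 * y 2 - x 2 * y 1), x 2 * y 0 - x 0 * y 2, x 0 * y 1 - x 1 * y 0]

theorem cross_add_left (ε : K) (x y z : Fin 3 → K) :
    cross ε (x + y) z = cross ε x z + cross ε y z := by
  funext i; fin_cases i <;> simp [cross] <;> ring

theorem cross_add_right (ε : K) (x y z : Fin 3 → K) :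
    cross ε x (y + z) = cross ε x y + cross ε x z := by
  funext i; fin_cases i <;> simp [cross] <;> ring

theorem cross_self (ε : K) (x : Fin 3 → K) : cross ε x x = 0 := by
  funext i; fin_cases i <;> simp [cross, mul_comm]

theorem cross_leibniz (ε : K) (x y z : Fin 3 → K) :
    cross ε x (cross ε y z) = cross ε (cross ε x y) z + cross ε y (cross ε x z) := by
  funext i; fin_cases i <;> simp [cross] <;> ring

theorem cross_smul (ε t : K) (x y : Fin 3 → K) : cross ε x (t • y) = t • cross ε x y := by
  funext i; fin_cases i <;> simp [cross] <;> ring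

/-- The three-dimensional Lie algebra with basis `u, v, w` and
`[u, v] = w`, `[v, w] = ε u`, `[w, u] = v`. Over `ℝ` it is `so(3)` for `ε = 1` and `so(1, 2)` for
`ε = -1`. -/
def UVW (_ε : K) : Type _ := Fin 3 → K

namespace UVW

variable (ε : K)

instance : AddCommGroup (UVW ε) := inferInstanceAs (AddCommGroup (Fin 3 → K))

instance : Module K (UVW ε) := inferInstanceAs (Module K (Fin 3 → K))

instance : LieRing (UVW ε) where
  bracket x y := cross ε x y
  add_lie := cross_add_left ε
  lie_add := cross_add_right ε
  lie_self := cross_self ε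
  leibniz_lie := cross_leibniz ε

instance : LieAlgebra K (UVW ε) where
  lie_smul t x y := cross_smul ε t x y

/-- The first basis vector. -/
def u : UVW ε := (![1, 0, 0] : Fin 3 → K)

/-- The second basis vector. -/
def v : UVW ε := (![0, 1, 0] : Fin 3 → K)

/-- The third basis vector. -/
def w : UVW ε := (![0, 0, 1] : Fin 3 → K)

theorem lie_u_v : ⁅u ε, v ε⁆ = w ε := by
  change cross ε ![1, 0, 0] ![0, 1, 0] = ![0, 0, 1]
  simp [cross]

theorem lie_v_w : ⁅v ε, w ε⁆ = ε • u ε := by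
  change cross ε ![0, 1, 0] ![0, 0, 1] = ε • (![1, 0, 0] : Fin 3 → K)
  funext i; fin_cases i <;> simp [cross]

theorem lie_w_u : ⁅w ε, u ε⁆ = v ε := by
  change cross ε ![0, 0, 1] ![1, 0, 0] = ![0, 1, 0]
  simp [cross]

end UVW

/-- The monomials `u ⊗ t^(2k+1)`, `v ⊗ t^(2k+1)`, `w ⊗ t^(2k+2)`, `k ≥ 0`, in the algebra of
polynomial loops. -/
def n1Monomials (ε : K) : Set (K[X] ⊗[K] UVW ε) :=
  {x | ∃ k : ℕ, x = (Polynomial.X ^ (2 * k + 1) : K[X]) ⊗ₜ[K] UVW.u ε ∨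
    x = (Polynomial.X ^ (2 * k + 1) : K[X]) ⊗ₜ[K] UVW.v ε ∨
    x = (Polynomial.X ^ (2 * k + 2) : K[X]) ⊗ₜ[K] UVW.w ε}

theorem lie_mem_n1Monomials (ε : K) {x y : K[X] ⊗[K] UVW ε} (hx : x ∈ n1Monomials ε)
    (hy : y ∈ n1Monomials ε) : ⁅x, y⁆ ∈ Submodule.span K (n1Monomials ε) := by
  have vu : ⁅UVW.v ε, UVW.u ε⁆ = -UVW.w ε := by rw [← lie_skew, UVW.lie_u_v]
  have wv : ⁅UVW.w ε, UVW.v ε⁆ = -(ε • UVW.u ε) := by rw [← lie_skew, UVW.lie_v_w]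
  have uw : ⁅UVW.u ε, UVW.w ε⁆ = -UVW.v ε := by rw [← lie_skew, UVW.lie_w_u]
  have hu : ∀ n k : ℕ, n = 2 * k + 1 → (Polynomial.X ^ n : K[X]) ⊗ₜ[K] UVW.u ε ∈
      Submodule.span K (n1Monomials ε) := fun n k h =>
    Submodule.subset_span ⟨k, Or.inl (by rw [h])⟩
  have hv : ∀ n k : ℕ, n = 2 * k + 1 → (Polynomial.X ^ n : K[X]) ⊗ₜ[K] UVW.v ε ∈
      Submodule.span K (n1Monomials ε) := fun n k h =>
    Submodule.subset_span ⟨k, Or.inr (Or.inl (by rw [h]))⟩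
  have hw : ∀ n k : ℕ, n = 2 * k + 2 → (Polynomial.X ^ n : K[X]) ⊗ₜ[K] UVW.w ε ∈
      Submodule.span K (n1Monomials ε) := fun n k h =>
    Submodule.subset_span ⟨k, Or.inr (Or.inr (by rw [h]))⟩
  obtain ⟨k, rfl | rfl | rfl⟩ := hx <;> obtain ⟨l, rfl | rfl | rfl⟩ := hy <;>
    simp only [LieAlgebra.ExtendScalars.bracket_tmul, lie_self, UVW.lie_u_v, UVW.lie_v_w,
      UVW.lie_w_u, vu, wv, uw, TensorProduct.tmul_zero, TensorProduct.tmul_neg,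
      TensorProduct.tmul_smul, ← pow_add, neg_mem_iff]
  · exact zero_mem _
  · exact hw _ (k + l) (by ring)
  · exact hv _ (k + l + 1) (by ring)
  · exact hw _ (k + l) (by ring)
  · exact zero_mem _
  · exact Submodule.smul_mem _ _ (hu _ (k + l + 1) (by ring))
  · exact hv _ (k + l + 1) (by ring)
  · exact Submodule.smul_mem _ _ (hu _ (k + l + 1) (by ring))
  · exact zero_mem _

/-- The span of a set whose pairwise brackets lie in the span is a Lie subalgebra. -/
def spanSubalgebra {L : Type*} [LieRing L] [LieAlgebra K L] (s : Set L)
    (hs : ∀ x ∈ s, ∀ y ∈ s, ⁅x, y⁆ ∈ Submodule.span K s) : LieSubalgebra K L where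
  __ := Submodule.span K s
  lie_mem' {x y} hx hy := by
    change x ∈ Submodule.span K s at hx
    change y ∈ Submodule.span K s at hy
    change ⁅x, y⁆ ∈ Submodule.span K s
    induction hx using Submodule.span_induction with
    | zero => rw [zero_lie]; exact zero_mem _
    | add a b _ _ ha hb => rw [add_lie]; exact add_mem ha hb
    | smul t a _ ha => rw [smul_lie]; exact Submodule.smul_mem _ _ ha
    | mem a ha =>
    induction hy using Submodule.span_induction with
    | zero => rw [lie_zero]; exact zero_mem _
    | add c b _ _ hc hb => rw [lie_add]; exact add_mem hc hb
    | smul t c _ hc => rw [lie_smul]; exact Submodule.smul_mem _ _ hc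
    | mem b hb => exact hs a ha b hb

/-- The algebra `n_1^+` (`ε = 1`) or `n_1^-` (`ε = -1`): the subalgebra of the algebra of polynomial
loops that is spanned by the above monomials. -/
def n1 (ε : K) : LieSubalgebra K (K[X] ⊗[K] UVW ε) :=
  spanSubalgebra (n1Monomials ε) fun _ hx _ hy => lie_mem_n1Monomials ε hx hy

/-! ### The list and the condition -/

/-- The names on the list: `n_1^+`, `n_1^-`, `n_2`, `n_2^3`, `m_0`, and `m_0^S` for the nonempty
sets `S` of odd integers `≥ 3` (`m_0^∅` is `m_0`). -/
inductive Name : Type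
  | n1Plus
  | n1Minus
  | n2
  | n23
  | m0
  | m0S (S : OddSet) (hS : S.1.Nonempty)

variable (K) in
/-- The Lie algebra `g` is isomorphic to the Lie algebra over `K` of the given name. -/
def IsoTo (g : Type*) [LieRing g] [LieAlgebra K g] : Name → Prop
  | .n1Plus => Nonempty (g ≃ₗ⁅K⁆ NarrowLie.n1 (1 : K))
  | .n1Minus => Nonempty (g ≃ₗ⁅K⁆ NarrowLie.n1 (-1 : K))
  | .n2 => Nonempty (g ≃ₗ⁅K⁆ (NarrowLie.n2 K).Algebra)
  | .n23 => Nonempty (g ≃ₗ⁅K⁆ (NarrowLie.n23 K).Algebra)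
  | .m0 => Nonempty (g ≃ₗ⁅K⁆ (NarrowLie.m0 K).Algebra)
  | .m0S S _ => Nonempty (g ≃ₗ⁅K⁆ (NarrowLie.m0S K S).Algebra)

/-- For a Lie algebra graded by the `𝒜 i`: the grading is positive, `[g_1, g_i] = g_{i+1}` and
`dim g_i + dim g_{i+1} ≤ 3` for all `i ≥ 1`. -/
structure IsNarrow {g : Type*} [LieRing g] [LieAlgebra K g] (𝒜 : ℕ → Submodule K g) : Prop where
  zero : 𝒜 0 = ⊥
  lie_eq : ∀ i, 1 ≤ i → Submodule.span K {z | ∃ x ∈ 𝒜 1, ∃ y ∈ 𝒜 i, ⁅x, y⁆ = z} = 𝒜 (i + 1)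
  rank_le : ∀ i, 1 ≤ i → Module.rank K (𝒜 i) + Module.rank K (𝒜 (i + 1)) ≤ 3

end NarrowLie

end

/-!
The degree one component is spanned by two vectors `a`, `b`. By the dimension condition in degrees
three and four the quadratic map `x ↦ ⁅x, ⁅x, ⁅a, b⁆⁆⁆` can be diagonalized, so that
`⁅a, ⁅b, ⁅a, b⁆⁆⁆ = 0` and `⁅b, ⁅b, ⁅a, b⁆⁆⁆ = ε • ⁅a, ⁅a, ⁅a, b⁆⁆⁆`. If `ε ≠ 0`, these relations
determine the algebra, which is `n_1^±` as soon as `ε` is `±1` up to squares. If `ε = 0`, consider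
the chain `(ad a)^n b`. Either all brackets `⁅b, (ad a)^n b⁆` are central, and the algebra is `m_0`
or `m_0^S`, where `S` records the nonzero ones. Or there is a first one that is not; then, after
a change of `a`, the chain stops at `(ad a)^5 b = 0`, the algebra has period eight, and it is `n_2`
or `n_2^3` depending on whether `⁅b, ⁅a, b⁆⁆` vanishes.

The algebras are told apart by isomorphism invariants: whether the second derived algebra is
central, whether `⁅x, ⁅⁅x, y⁆, ⁅x, z⁆⁆⁆ = 0` holds identically, whether the center is zero, and at
which steps of the lower central series central elements occur; over an ordered field, nilpotency
of elements of the form `ad x` tells `n_1^+` from `n_1^-`.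
-/

noncomputable section

namespace NarrowLie

section Generation

variable {R L M ι : Type*} [CommRing R] [LieRing L] [LieAlgebra R L] [LieRing M] [LieAlgebra R M]
variable {s : Set L}

theorem lie_eq_zero_of_lieSpan_eq_top (hs : LieSubalgebra.lieSpan R L s = ⊤) {z : L}
    (hz : ∀ x ∈ s, ⁅x, z⁆ = 0) (x : L) : ⁅x, z⁆ = 0 := by
  have hx : x ∈ LieSubalgebra.lieSpan R L s := hs ▸ LieSubalgebra.mem_top x
  induction hx using LieSubalgebra.lieSpan_induction with
  | mem x hx => exact hz x hx
  | zero => exact zero_lie z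
  | add x y _ _ hx hy => rw [add_lie, hx, hy, add_zero]
  | smul t x _ hx => rw [smul_lie, hx, smul_zero]
  | lie x y _ _ hx hy => rw [lie_lie, hx, hy, lie_zero, lie_zero, sub_zero]

theorem map_lie_of_lieSpan_eq_top (hs : LieSubalgebra.lieSpan R L s = ⊤) (φ : L →ₗ[R] M)
    (h : ∀ x ∈ s, ∀ y, φ ⁅x, y⁆ = ⁅φ x, φ y⁆) (x y : L) : φ ⁅x, y⁆ = ⁅φ x, φ y⁆ := by
  have hx : x ∈ LieSubalgebra.lieSpan R L s := hs ▸ LieSubalgebra.mem_top x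
  induction hx using LieSubalgebra.lieSpan_induction generalizing y with
  | mem x hx => exact h x hx y
  | zero => simp only [zero_lie, map_zero]
  | add u v _ _ hu hv => simp only [add_lie, map_add, hu, hv]
  | smul t u _ hu => simp only [smul_lie, map_smul, hu]
  | lie u v _ _ hu hv => simp only [lie_lie, map_sub, hu, hv]

theorem lieSpan_eq_top_of_basis (B : Module.Basis ι R L)
    (h : ∀ i, B i ∈ LieSubalgebra.lieSpan R L s) : LieSubalgebra.lieSpan R L s = ⊤ := by
  rw [← LieSubalgebra.toSubmodule_inj, LieSubalgebra.top_toSubmodule, eq_top_iff, ← B.span_eq,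
    Submodule.span_le]
  rintro _ ⟨i, rfl⟩
  exact h i

end Generation

section Frame

variable {K : Type*} [Field K] {g : Type*} [LieRing g] [LieAlgebra K g]
variable {𝒜 : ℕ → Submodule K g} {a b : g}

/-- A pair of vectors spanning the degree one part of a narrow Lie algebra, none of whose parts of
positive degree vanishes. -/
structure IsFrame (𝒜 : ℕ → Submodule K g) (a b : g) : Prop where
  narrow : IsNarrow 𝒜
  ne_bot : ∀ n, 1 ≤ n → 𝒜 n ≠ ⊥
  span_eq : 𝒜 1 = Submodule.span K {a, b}

namespace IsFrame

theorem left_mem (F : IsFrame 𝒜 a b) : a ∈ 𝒜 1 :=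
  F.span_eq ▸ Submodule.subset_span (by simp)

theorem right_mem (F : IsFrame 𝒜 a b) : b ∈ 𝒜 1 :=
  F.span_eq ▸ Submodule.subset_span (by simp)

theorem swap (F : IsFrame 𝒜 a b) : IsFrame 𝒜 b a :=
  { F with span_eq := Set.pair_comm a b ▸ F.span_eq }

theorem add_smul_left (F : IsFrame 𝒜 a b) (t : K) : IsFrame 𝒜 (a + t • b) b where
  __ := F
  span_eq := by
    refine F.span_eq.trans (le_antisymm ?_ ?_) <;> rw [Submodule.span_le] <;>
      rintro x (rfl | rfl) <;> rw [SetLike.mem_coe, Submodule.mem_span_pair]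
    exacts [⟨1, -t, by module⟩, ⟨0, 1, by module⟩, ⟨1, t, by module⟩, ⟨0, 1, by module⟩]

theorem lie_left_mem [SetLike.GradedBracket 𝒜] (F : IsFrame 𝒜 a b) {n : ℕ} {x : g}
    (hx : x ∈ 𝒜 n) : ⁅a, x⁆ ∈ 𝒜 (n + 1) :=
  add_comm 1 n ▸ SetLike.GradedBracket.bracket_mem F.left_mem hx

theorem lie_right_mem [SetLike.GradedBracket 𝒜] (F : IsFrame 𝒜 a b) {n : ℕ} {x : g}
    (hx : x ∈ 𝒜 n) : ⁅b, x⁆ ∈ 𝒜 (n + 1) :=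
  F.swap.lie_left_mem hx

theorem succ_le (F : IsFrame 𝒜 a b) {n : ℕ} (hn : 1 ≤ n) {s : Set g} {M : Submodule K g}
    (hs : 𝒜 n ≤ Submodule.span K s) (h : ∀ x ∈ s, ⁅a, x⁆ ∈ M ∧ ⁅b, x⁆ ∈ M) : 𝒜 (n + 1) ≤ M := by
  have ha : 𝒜 n ≤ M.comap (LieAlgebra.ad K g a) :=
    hs.trans (Submodule.span_le.2 fun x hx => (h x hx).1)
  have hb : 𝒜 n ≤ M.comap (LieAlgebra.ad K g b) :=
    hs.trans (Submodule.span_le.2 fun x hx => (h x hx).2)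
  rw [← F.narrow.lie_eq n hn, Submodule.span_le]
  rintro _ ⟨x, hx, y, hy, rfl⟩
  rw [F.span_eq, Submodule.mem_span_pair] at hx
  obtain ⟨p, q, rfl⟩ := hx
  rw [add_lie, smul_lie, smul_lie]
  exact add_mem (M.smul_mem _ (ha hy)) (M.smul_mem _ (hb hy))

theorem not_le_span_singleton (F : IsFrame 𝒜 a b) {n : ℕ} (hn : 1 ≤ n) {x : g} (ha : ⁅a, x⁆ = 0)
    (hb : ⁅b, x⁆ = 0) : ¬ 𝒜 n ≤ Submodule.span K {x} := fun h =>
  F.ne_bot (n + 1) (by omega) <| le_bot_iff.1 <| F.succ_le hn h <| by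
    rintro _ rfl
    simp [ha, hb]

theorem lieSpan_eq_top [DirectSum.Decomposition 𝒜] (F : IsFrame 𝒜 a b) :
    LieSubalgebra.lieSpan K g {a, b} = ⊤ := by
  set H := LieSubalgebra.lieSpan K g {a, b}
  have h1 : 𝒜 1 ≤ H.toSubmodule :=
    F.span_eq ▸ Submodule.span_le.2 LieSubalgebra.subset_lieSpan
  have h : ∀ n, 𝒜 n ≤ H.toSubmodule := by
    intro n
    induction n with
    | zero => exact F.narrow.zero ▸ bot_le
    | succ n ih =>
      rcases Nat.eq_zero_or_pos n with rfl | hn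
      · exact h1
      · rw [← F.narrow.lie_eq n hn, Submodule.span_le]
        rintro _ ⟨x, hx, y, hy, rfl⟩
        exact H.lie_mem (h1 hx) (ih hy)
  rw [← LieSubalgebra.toSubmodule_eq_top, eq_top_iff,
    ← (DirectSum.Decomposition.isInternal 𝒜).submodule_iSup_eq_top]
  exact iSup_le h

theorem lie_eq_zero [DirectSum.Decomposition 𝒜] (F : IsFrame 𝒜 a b) {z : g} (ha : ⁅a, z⁆ = 0)
    (hb : ⁅b, z⁆ = 0) (x : g) : ⁅x, z⁆ = 0 :=
  lie_eq_zero_of_lieSpan_eq_top F.lieSpan_eq_top (by rintro _ (rfl | rfl) <;> assumption) x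

end IsFrame

theorem two_le_rank_of_linearIndependent {M : Submodule K g} {p q : g} (hp : p ∈ M) (hq : q ∈ M)
    (h : LinearIndependent K ![p, q]) : 2 ≤ Module.rank K M := by
  have h' : LinearIndependent K ![(⟨p, hp⟩ : M), ⟨q, hq⟩] := by
    rw [LinearIndependent.pair_iff] at h ⊢
    exact fun s t hst => h s t (congrArg Subtype.val hst)
  simpa using h'.cardinal_lift_le_rank

theorem IsNarrow.not_linearIndependent_succ (h : IsNarrow 𝒜) {n : ℕ} (hn : 1 ≤ n) {p q r s : g}
    (hp : p ∈ 𝒜 n) (hq : q ∈ 𝒜 n) (hr : r ∈ 𝒜 (n + 1)) (hs : s ∈ 𝒜 (n + 1))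
    (hpq : LinearIndependent K ![p, q]) : ¬ LinearIndependent K ![r, s] := fun hrs => by
  have h4 := (add_le_add (two_le_rank_of_linearIndependent hp hq hpq)
    (two_le_rank_of_linearIndependent hr hs hrs)).trans (h.rank_le n hn)
  norm_num at h4

theorem exists_smul_eq_of_not_linearIndependent {x y : g} (hx : x ≠ 0)
    (h : ¬ LinearIndependent K ![x, y]) : ∃ t : K, t • x = y := by
  simpa [LinearIndependent.pair_iff' hx] using h

theorem finiteDimensional_of_decomposition [DirectSum.Decomposition 𝒜]
    [∀ n, FiniteDimensional K (𝒜 n)] {N : ℕ} (h : ∀ n, N ≤ n → 𝒜 n = ⊥) :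
    FiniteDimensional K g := by
  have top : (⨆ i : Fin N, 𝒜 i) = ⊤ := by
    rw [eq_top_iff, ← (DirectSum.Decomposition.isInternal 𝒜).submodule_iSup_eq_top]
    refine iSup_le fun i => ?_
    by_cases hi : i < N
    · exact le_iSup (fun i : Fin N => 𝒜 i) ⟨i, hi⟩
    · exact h i (not_lt.1 hi) ▸ bot_le
  have : FiniteDimensional K (⨆ i : Fin N, 𝒜 i : Submodule K g) := Submodule.finite_iSup _
  rw [top] at this
  exact Module.finite_def.2 (Module.Finite.iff_fg.1 this)

namespace IsNarrow

theorem finiteDimensional (h : IsNarrow 𝒜) (n : ℕ) : FiniteDimensional K (𝒜 n) := by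
  rcases Nat.eq_zero_or_pos n with rfl | hn
  · rw [h.zero]; infer_instance
  · refine Module.rank_lt_aleph0_iff.1 ((le_self_add.trans (h.rank_le n hn)).trans_lt ?_)
    exact_mod_cast Cardinal.natCast_lt_aleph0 (n := 3)

theorem succ_eq_bot (h : IsNarrow 𝒜) {n : ℕ} (hn : 1 ≤ n) (h0 : 𝒜 n = ⊥) : 𝒜 (n + 1) = ⊥ := by
  rw [← h.lie_eq n hn, h0, Submodule.span_eq_bot]
  rintro _ ⟨x, -, y, hy, rfl⟩
  rw [(Submodule.mem_bot K).1 hy, lie_zero]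

theorem ne_bot [DirectSum.Decomposition 𝒜] (h : IsNarrow 𝒜) (hinf : ¬ FiniteDimensional K g)
    (n : ℕ) (hn : 1 ≤ n) : 𝒜 n ≠ ⊥ := fun h0 => by
  have := h.finiteDimensional
  refine hinf (finiteDimensional_of_decomposition (𝒜 := 𝒜) (N := n) fun m hm => ?_)
  induction m, hm using Nat.le_induction with
  | base => exact h0
  | succ m hm ih => exact h.succ_eq_bot (hn.trans hm) ih

theorem two_eq_bot_of_isPrincipal (h : IsNarrow 𝒜) (h1 : (𝒜 1).IsPrincipal) : 𝒜 2 = ⊥ := by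
  obtain ⟨v, hv⟩ := h1
  rw [← h.lie_eq 1 le_rfl, Submodule.span_eq_bot]
  rintro _ ⟨x, hx, y, hy, rfl⟩
  rw [hv] at hx hy
  obtain ⟨s, rfl⟩ := Submodule.mem_span_singleton.1 hx
  obtain ⟨t, rfl⟩ := Submodule.mem_span_singleton.1 hy
  rw [smul_lie, lie_smul, lie_self, smul_zero, smul_zero]

theorem finrank_one_eq_two (h : IsNarrow 𝒜) (h2 : 𝒜 2 ≠ ⊥) : Module.finrank K (𝒜 1) = 2 := by
  have := h.finiteDimensional
  have le : Module.finrank K (𝒜 1) + Module.finrank K (𝒜 2) ≤ 3 := by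
    have := h.rank_le 1 le_rfl
    rw [← Module.finrank_eq_rank, ← Module.finrank_eq_rank] at this
    exact_mod_cast this
  have pos : Module.finrank K (𝒜 2) ≠ 0 := fun h0 => h2 (Submodule.finrank_eq_zero.1 h0)
  have two_le : ¬ Module.finrank K (𝒜 1) ≤ 1 := fun h1 =>
    h2 (h.two_eq_bot_of_isPrincipal ((𝒜 1).finrank_le_one_iff_isPrincipal.1 h1))
  omega

theorem exists_isFrame [DirectSum.Decomposition 𝒜] (h : IsNarrow 𝒜)
    (hinf : ¬ FiniteDimensional K g) : ∃ a b, IsFrame 𝒜 a b := by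
  have := h.finiteDimensional
  have hne := h.ne_bot hinf
  let B := Module.finBasisOfFinrankEq K (𝒜 1) (h.finrank_one_eq_two (hne 2 one_le_two))
  refine ⟨B 0, B 1, h, hne, ?_⟩
  have hB := congrArg (Submodule.map (𝒜 1).subtype) B.span_eq
  rw [Submodule.map_span, Submodule.map_top, Submodule.range_subtype, ← Set.range_comp] at hB
  refine hB.symm.trans (congrArg _ ?_)
  ext x
  simp [Fin.exists_fin_two, eq_comm]

end IsNarrow

end Frame

section Diagonal

variable {K : Type*} [Field K] {g : Type*} [LieRing g] [LieAlgebra K g]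
variable {𝒜 : ℕ → Submodule K g} {a b : g}

theorem lie_lie_lie_comm (a b : g) : ⁅b, ⁅a, ⁅a, b⁆⁆⁆ = ⁅a, ⁅b, ⁅a, b⁆⁆⁆ := by
  have h := lie_lie a b ⁅a, b⁆
  rw [lie_self] at h
  exact (sub_eq_zero.1 h.symm).symm

namespace IsFrame

theorem two_le_span (F : IsFrame 𝒜 a b) : 𝒜 2 ≤ Submodule.span K {⁅a, b⁆} := by
  refine F.succ_le le_rfl F.span_eq.le ?_
  have h : ⁅a, b⁆ ∈ Submodule.span K {⁅a, b⁆} := Submodule.mem_span_singleton_self _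
  rintro x (hx | hx) <;> rw [hx, lie_self]
  · rw [← lie_skew b]
    exact ⟨zero_mem _, neg_mem h⟩
  · exact ⟨h, zero_mem _⟩

theorem three_le_span (F : IsFrame 𝒜 a b) :
    𝒜 3 ≤ Submodule.span K {⁅a, ⁅a, b⁆⁆, ⁅b, ⁅a, b⁆⁆} := by
  refine F.succ_le one_le_two F.two_le_span ?_
  rintro x rfl
  exact ⟨Submodule.subset_span (by simp), Submodule.subset_span (by simp)⟩

theorem four_le_span (F : IsFrame 𝒜 a b) : 𝒜 4 ≤ Submodule.span K
    {⁅a, ⁅a, ⁅a, b⁆⁆⁆, ⁅a, ⁅b, ⁅a, b⁆⁆⁆, ⁅b, ⁅b, ⁅a, b⁆⁆⁆} := by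
  refine F.succ_le (by norm_num) F.three_le_span ?_
  rintro x (rfl | rfl)
  · rw [lie_lie_lie_comm]
    exact ⟨Submodule.subset_span (by simp), Submodule.subset_span (by simp)⟩
  · exact ⟨Submodule.subset_span (by simp), Submodule.subset_span (by simp)⟩

/-- If the quadratic map `x ↦ [x, [x, [a, b]]]` vanished on the degree one part, so would its
polarization, and with it the part of degree four. -/
theorem exists_lie_lie_lie_ne_zero [CharZero K] (F : IsFrame 𝒜 a b) :
    ∃ a b : g, IsFrame 𝒜 a b ∧ ⁅a, ⁅a, ⁅a, b⁆⁆⁆ ≠ 0 := by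
  by_contra! h
  have haa := h a b F
  have hbb : ⁅b, ⁅b, ⁅a, b⁆⁆⁆ = 0 := by
    have := h b a F.swap
    rwa [← lie_skew b a, lie_neg, lie_neg, neg_eq_zero] at this
  have hab : ⁅a, ⁅b, ⁅a, b⁆⁆⁆ = 0 := by
    have := h _ b (F.add_smul_left 1)
    simp only [one_smul, add_lie, lie_self, add_zero, lie_add, haa, hbb, lie_lie_lie_comm a b,
      zero_add] at this
    rw [← two_smul K] at this
    exact (smul_eq_zero.1 this).resolve_left two_ne_zero
  have h4 := F.four_le_span
  rw [haa, hab, hbb, Set.pair_eq_singleton, Set.pair_eq_singleton, Submodule.span_zero_singleton]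
    at h4
  exact F.ne_bot 4 (by norm_num) (le_bot_iff.1 h4)

theorem exists_orthogonal [SetLike.GradedBracket 𝒜] (F : IsFrame 𝒜 a b)
    (ha : ⁅a, ⁅a, ⁅a, b⁆⁆⁆ ≠ 0) : ∃ s ε : K, ⁅a, ⁅b + s • a, ⁅a, b⁆⁆⁆ = 0 ∧
      ⁅b + s • a, ⁅b + s • a, ⁅a, b⁆⁆⁆ = ε • ⁅a, ⁅a, ⁅a, b⁆⁆⁆ := by
  have h2 : ⁅a, b⁆ ∈ 𝒜 2 := F.lie_left_mem F.right_mem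
  by_cases hi : LinearIndependent K ![⁅a, ⁅a, b⁆⁆, ⁅b, ⁅a, b⁆⁆]
  · have h4 : ∀ x ∈ 𝒜 4, ∃ t : K, t • ⁅a, ⁅a, ⁅a, b⁆⁆⁆ = x := fun x hx =>
      exists_smul_eq_of_not_linearIndependent ha <|
        F.narrow.not_linearIndependent_succ (by norm_num) (F.lie_left_mem h2) (F.lie_right_mem h2)
          (F.lie_left_mem (F.lie_left_mem h2)) hx hi
    obtain ⟨β, hβ⟩ := h4 _ (F.lie_left_mem (F.lie_right_mem h2))
    have F' := F.swap.add_smul_left (-β)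
    obtain ⟨ε, hε⟩ := h4 _ (F'.lie_left_mem (F'.lie_left_mem h2))
    refine ⟨-β, ε, ?_, hε.symm⟩
    rw [add_lie, smul_lie, lie_add, lie_smul, ← hβ, neg_smul, add_neg_cancel]
  · have haab : ⁅a, ⁅a, b⁆⁆ ≠ 0 := fun h => ha (by rw [h, lie_zero])
    obtain ⟨l, hl⟩ := exists_smul_eq_of_not_linearIndependent haab hi
    have : ⁅b + (-l) • a, ⁅a, b⁆⁆ = 0 := by
      rw [add_lie, smul_lie, ← hl, neg_smul, add_neg_cancel]
    exact ⟨-l, 0, by rw [this, lie_zero], by rw [this, lie_zero, zero_smul]⟩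

theorem exists_diagonal [CharZero K] [SetLike.GradedBracket 𝒜] (F : IsFrame 𝒜 a b) :
    ∃ (a b : g) (ε : K), IsFrame 𝒜 a b ∧ ⁅a, ⁅b, ⁅a, b⁆⁆⁆ = 0 ∧
      ⁅b, ⁅b, ⁅a, b⁆⁆⁆ = ε • ⁅a, ⁅a, ⁅a, b⁆⁆⁆ := by
  obtain ⟨a, b, F, ha⟩ := F.exists_lie_lie_lie_ne_zero
  obtain ⟨s, ε, hab, hbb⟩ := F.exists_orthogonal ha
  have hlie : ⁅a, b + s • a⁆ = ⁅a, b⁆ := by simp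
  exact ⟨a, b + s • a, ε, (F.swap.add_smul_left s).swap, by rwa [hlie], by rwa [hlie]⟩

end IsFrame

end Diagonal

section Chain

variable {R L : Type*} [CommRing R] [LieRing L] [LieAlgebra R L] {a b : L}

/-- The iterated brackets `[a, [a, …, [a, b]]]` with `n` letters `a`. -/
def chain (a b : L) : ℕ → L
  | 0 => b
  | n + 1 => ⁅a, chain a b n⁆

theorem chain_zero (a b : L) : chain a b 0 = b := rfl

theorem chain_succ (a b : L) (n : ℕ) : chain a b (n + 1) = ⁅a, chain a b n⁆ := rfl

theorem lie_chain_succ {N : ℕ} {C D : ℕ → L}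
    (hC : ∀ i j, i + j = N → ⁅chain a b i, chain a b j⁆ = (-1 : R) ^ i • C i)
    (h0 : ⁅b, chain a b (N + 1)⁆ = D 0) (hD : ∀ i, D (i + 1) = D i - ⁅a, C i⁆) (i j : ℕ)
    (hij : i + j = N + 1) : ⁅chain a b i, chain a b j⁆ = (-1 : R) ^ i • D i := by
  induction i generalizing j with
  | zero => rw [← Nat.zero_add j, hij, chain_zero, h0, pow_zero, one_smul]
  | succ i ih =>
    rw [chain_succ, lie_lie, ← chain_succ a b j, ih (j + 1) (by omega), hC i j (by omega), hD,
      lie_smul, pow_succ]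
    module

theorem eq_zero_of_lie_chain_self {i : ℕ} {x : L}
    (h : ⁅chain a b i, chain a b i⁆ = (-1 : R) ^ i • x) : x = 0 :=
  (isUnit_one.neg.pow i).smul_eq_zero.1 (h.symm.trans (lie_self _))

/-- The elements `[b, (ad a)^m b]` with `m ≤ n` commute with `a` and `b`, so that they are central
if `a` and `b` generate the Lie algebra. -/
def CentralUpTo (a b : L) (n : ℕ) : Prop :=
  ∀ m ≤ n, ⁅a, ⁅b, chain a b m⁆⁆ = 0 ∧ ⁅b, ⁅b, chain a b m⁆⁆ = 0

namespace CentralUpTo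

variable {n m : ℕ}

theorem succ (h : CentralUpTo a b n) (ha : ⁅a, ⁅b, chain a b (n + 1)⁆⁆ = 0)
    (hb : ⁅b, ⁅b, chain a b (n + 1)⁆⁆ = 0) : CentralUpTo a b (n + 1) := fun i hi => by
  obtain hi | rfl := Nat.le_succ_iff.1 hi
  exacts [h i hi, ⟨ha, hb⟩]

variable (R) in
theorem lie_chain (h : CentralUpTo a b n) {N : ℕ} (hN : N ≤ n + 1) (i j : ℕ) (hij : i + j = N) :
    ⁅chain a b i, chain a b j⁆ = (-1 : R) ^ i • ⁅b, chain a b N⁆ := by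
  induction N generalizing i j with
  | zero =>
    obtain ⟨rfl, rfl⟩ : i = 0 ∧ j = 0 := by omega
    rw [pow_zero, one_smul, chain_zero]
  | succ N ih =>
    exact lie_chain_succ (C := fun _ => ⁅b, chain a b N⁆) (D := fun _ => ⁅b, chain a b (N + 1)⁆)
      (ih (by omega)) rfl (fun _ => by rw [(h N (by omega)).1, sub_zero]) i j hij

theorem lie_chain_even (h : CentralUpTo a b n) {i : ℕ} (hi : 2 * i ≤ n + 1) :
    ⁅b, chain a b (2 * i)⁆ = 0 :=
  eq_zero_of_lie_chain_self (h.lie_chain ℤ hi i i (by ring))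

theorem succ_odd (h : CentralUpTo a b (2 * m + 1)) : CentralUpTo a b (2 * m + 2) := by
  have h0 : ⁅b, chain a b (2 * m + 2)⁆ = 0 := h.lie_chain_even (i := m + 1) (by omega)
  exact h.succ (by rw [h0, lie_zero]) (by rw [h0, lie_zero])

theorem lie_chain_add_four (h : CentralUpTo a b (2 * m + 2)) (i j : ℕ)
    (hij : i + j = 2 * m + 4) : ⁅chain a b i, chain a b j⁆ =
      (-1 : R) ^ i • ((m : R) + 2 - i) • ⁅a, ⁅b, chain a b (2 * m + 3)⁆⁆ := by
  set y := ⁅a, ⁅b, chain a b (2 * m + 3)⁆⁆ with hy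
  have key := lie_chain_succ (R := R) (D := fun i => ⁅b, chain a b (2 * m + 4)⁆ - (i : R) • y)
    (h.lie_chain R le_rfl) (by simp) (fun i => by push_cast; rw [← hy]; module)
  have h0 := sub_eq_zero.1 (eq_zero_of_lie_chain_self (key (m + 2) (m + 2) (by ring)))
  rw [key i j hij, h0]
  push_cast
  module

theorem lie_chain_even_add_four (h : CentralUpTo a b (2 * m + 2)) :
    ⁅b, chain a b (2 * m + 4)⁆ = ((m : R) + 2) • ⁅a, ⁅b, chain a b (2 * m + 3)⁆⁆ := by
  simpa [chain_zero] using h.lie_chain_add_four (R := R) 0 (2 * m + 4) (by ring)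

theorem chain_add_smul (h : CentralUpTo a b n) (t : R) {i : ℕ} (hi : i ≤ n + 1) :
    chain (a + t • b) b (i + 1) = chain a b (i + 1) + t • ⁅b, chain a b i⁆ := by
  induction i with
  | zero => simp [chain_succ, chain_zero]
  | succ i ih =>
    rw [chain_succ, ih (by omega), chain_succ a b (i + 1)]
    simp only [lie_add, add_lie, smul_lie, lie_smul, h i (by omega), smul_zero, add_zero]

theorem lie_chain_add_smul (h : CentralUpTo a b n) (h' : ⁅b, ⁅b, chain a b (n + 1)⁆⁆ = 0) (t : R)
    {i : ℕ} (hi : i ≤ n + 2) : ⁅b, chain (a + t • b) b i⁆ = ⁅b, chain a b i⁆ := by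
  rcases i with _ | i
  · rfl
  · have hbb : ⁅b, ⁅b, chain a b i⁆⁆ = 0 := by
      obtain hi | rfl : i ≤ n ∨ i = n + 1 := by omega
      exacts [(h i hi).2, h']
    rw [h.chain_add_smul t (by omega), lie_add, lie_smul, hbb, smul_zero, add_zero]

theorem add_smul (h : CentralUpTo a b n) (h' : ⁅b, ⁅b, chain a b (n + 1)⁆⁆ = 0) (t : R) :
    CentralUpTo (a + t • b) b n := fun i hi => by
  rw [h.lie_chain_add_smul h' t (by omega), add_lie, smul_lie, (h i hi).1, (h i hi).2, smul_zero,
    add_zero]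
  exact ⟨rfl, rfl⟩

end CentralUpTo

end Chain

section ChainOfFrame

variable {K : Type*} [Field K] {g : Type*} [LieRing g] [LieAlgebra K g]
variable {𝒜 : ℕ → Submodule K g} {a b : g} {m : ℕ}

namespace IsFrame

theorem chain_mem [SetLike.GradedBracket 𝒜] (F : IsFrame 𝒜 a b) (n : ℕ) :
    chain a b n ∈ 𝒜 (n + 1) := by
  induction n with
  | zero => exact F.right_mem
  | succ n ih => exact F.lie_left_mem ih

theorem le_span_chain (F : IsFrame 𝒜 a b) {n : ℕ} (h : CentralUpTo a b n) {i : ℕ}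
    (hi : i ≤ n + 1) : 𝒜 (i + 2) ≤ Submodule.span K {chain a b (i + 1), ⁅b, chain a b i⁆} := by
  induction i with
  | zero => exact F.two_le_span.trans (Submodule.span_mono (by simp [chain_succ, chain_zero]))
  | succ i ih =>
    refine F.succ_le (by omega) (ih (by omega)) ?_
    rintro x (hx | hx) <;> rw [hx]
    · exact ⟨Submodule.subset_span (by simp [chain_succ]), Submodule.subset_span (by simp)⟩
    · rw [(h i (by omega)).1, (h i (by omega)).2]
      exact ⟨zero_mem _, zero_mem _⟩

theorem lie_lie_chain_odd [DirectSum.Decomposition 𝒜] (F : IsFrame 𝒜 a b)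
    (h : CentralUpTo a b (2 * m + 2)) : ⁅b, ⁅b, chain a b (2 * m + 3)⁆⁆ = 0 := by
  have central : ∀ i ≤ 2 * m + 2, ∀ x : g, ⁅x, ⁅b, chain a b i⁆⁆ = 0 := fun i hi =>
    F.lie_eq_zero (h i hi).1 (h i hi).2
  have h0 : ⁅b, ⁅chain a b 1, chain a b (2 * m + 2)⁆⁆ = 0 := by
    rw [leibniz_lie, central _ le_rfl, ← lie_skew, central 1 (by omega), neg_zero, add_zero]
  rw [h.lie_chain ℤ le_rfl 1 (2 * m + 2) (by ring), lie_smul] at h0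
  exact (isUnit_one.neg.pow 1).smul_eq_zero.1 h0

theorem exists_smul_eq_chain [SetLike.GradedBracket 𝒜] (F : IsFrame 𝒜 a b)
    (hy : ⁅a, ⁅b, chain a b (2 * m + 3)⁆⁆ ≠ 0) :
    ∃ t : K, t • ⁅a, ⁅b, chain a b (2 * m + 3)⁆⁆ = chain a b (2 * m + 5) := by
  refine exists_smul_eq_of_not_linearIndependent hy fun hi => ?_
  have hz : ⁅b, chain a b (2 * m + 3)⁆ ∈ 𝒜 (2 * m + 5) := F.lie_right_mem (F.chain_mem _)
  refine F.narrow.not_linearIndependent_succ (by omega) hz (F.chain_mem (2 * m + 4))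
    (F.lie_left_mem hz) (F.chain_mem (2 * m + 5)) ?_ hi
  rw [LinearIndependent.pair_iff] at hi ⊢
  refine fun s t hst => hi s t ?_
  simpa only [lie_add, lie_smul, lie_zero, ← chain_succ] using congrArg (fun x => ⁅a, x⁆) hst

/-- Replacing `a` by `a + t • b` changes the chain by multiples of the bracket
`[a, [b, (ad a)^(2m+3) b]]`, and `t` can be chosen so that the chain stops. -/
theorem exists_chain_eq_zero [CharZero K] [GradedLieAlgebra 𝒜] (F : IsFrame 𝒜 a b)
    (h : CentralUpTo a b (2 * m + 2)) (hy : ⁅a, ⁅b, chain a b (2 * m + 3)⁆⁆ ≠ 0) :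
    ∃ a : g, IsFrame 𝒜 a b ∧ CentralUpTo a b (2 * m + 2) ∧ chain a b (2 * m + 5) = 0 := by
  obtain ⟨μ, hμ⟩ := F.exists_smul_eq_chain hy
  have hbz := F.lie_lie_chain_odd h
  set t : K := -(μ / (m + 3)) with ht
  refine ⟨a + t • b, F.add_smul_left t, h.add_smul hbz t, ?_⟩
  have hm : (m : K) + 3 ≠ 0 := by exact_mod_cast Nat.succ_ne_zero (m + 2)
  have hμt : μ + t * (m + 2) + t = 0 := by rw [ht]; field_simp; ring
  rw [chain_succ, h.chain_add_smul t le_rfl]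
  simp only [lie_add, add_lie, smul_lie, lie_smul, hbz, ← chain_succ a b, ← hμ,
    h.lie_chain_even_add_four (R := K)]
  linear_combination (norm := module) hμt • ⁅a, ⁅b, chain a b (2 * m + 3)⁆⁆

end IsFrame

section ChainStops

theorem CentralUpTo.lie_chain_add_five [CharZero K] (h : CentralUpTo a b (2 * m + 2))
    (h5 : chain a b (2 * m + 5) = 0) (i j : ℕ) (hij : i + j = 2 * m + 5) :
    ⁅chain a b i, chain a b j⁆ = (-1 : K) ^ i •
      (-(i * (2 * m + 5 - i) / 2 : K)) • ⁅a, ⁅a, ⁅b, chain a b (2 * m + 3)⁆⁆⁆ :=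
  lie_chain_succ (R := K)
    (D := fun i => (-(i * (2 * m + 5 - i) / 2 : K)) • ⁅a, ⁅a, ⁅b, chain a b (2 * m + 3)⁆⁆⁆)
    h.lie_chain_add_four (by simp [h5]) (fun i => by rw [lie_smul]; push_cast; module) i j hij

variable (K) in
theorem CentralUpTo.lie_lie_lie_lie_eq_zero [CharZero K] (h : CentralUpTo a b (2 * m + 2))
    (h5 : chain a b (2 * m + 5) = 0) : ⁅a, ⁅a, ⁅a, ⁅b, chain a b (2 * m + 3)⁆⁆⁆⁆ = 0 := by
  have h6 := lie_chain_succ (R := K) (D := fun i => (i * (i - 1) * (3 * m + 8 - i) / 6 : K) •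
      ⁅a, ⁅a, ⁅a, ⁅b, chain a b (2 * m + 3)⁆⁆⁆⁆) (h.lie_chain_add_five h5)
    (by simp [chain_succ a b (2 * m + 5), h5])
    (fun i => by rw [lie_smul, ← sub_smul]; congr 1; push_cast; field_simp; ring)
    (m + 3) (m + 3) (by ring)
  refine (smul_eq_zero.1 (eq_zero_of_lie_chain_self h6)).resolve_left ?_
  have hcoeff : (((m + 3 : ℕ) : K) * ((m + 3 : ℕ) - 1) * (3 * m + 8 - (m + 3 : ℕ)) / 6)
      = (((m + 3) * (m + 2) * (2 * m + 5) : ℕ) : K) / 6 := by push_cast; ring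
  rw [hcoeff]
  exact div_ne_zero (Nat.cast_ne_zero.2 (by positivity)) (by norm_num)

variable (K) in
theorem CentralUpTo.lie_right_lie_eq_zero [CharZero K] (h : CentralUpTo a b (2 * m + 2))
    (hm : m ≠ 0) : ⁅b, ⁅a, ⁅b, chain a b (2 * m + 3)⁆⁆⁆ = 0 := by
  have hb : ⁅b, ⁅chain a b 2, chain a b (2 * m + 2)⁆⁆ = 0 := by
    have h2 : ⁅b, chain a b 2⁆ = 0 := h.lie_chain_even (i := 1) (by omega)
    have h2m : ⁅b, chain a b (2 * m + 2)⁆ = 0 := h.lie_chain_even (i := m + 1) (by omega)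
    rw [leibniz_lie, h2, h2m, lie_zero, zero_lie, zero_add]
  rw [h.lie_chain_add_four (R := K) 2 (2 * m + 2) (by ring), lie_smul, lie_smul, smul_smul] at hb
  refine (smul_eq_zero.1 hb).resolve_left ?_
  simpa using hm

namespace IsFrame

theorem lie_right_lie_lie_eq_zero [CharZero K] [DirectSum.Decomposition 𝒜] (F : IsFrame 𝒜 a b)
    (h : CentralUpTo a b (2 * m + 2)) (h5 : chain a b (2 * m + 5) = 0) (hm : m ≠ 0) :
    ⁅b, ⁅a, ⁅a, ⁅b, chain a b (2 * m + 3)⁆⁆⁆⁆ = 0 := by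
  have h2 : ⁅b, chain a b 2⁆ = 0 := h.lie_chain_even (i := 1) (by omega)
  have hbz := F.lie_lie_chain_odd h
  have hby := h.lie_right_lie_eq_zero K hm
  set z := ⁅b, chain a b (2 * m + 3)⁆
  have h2z : ⁅b, ⁅chain a b 2, chain a b (2 * m + 3)⁆⁆ = ⁅chain a b 2, z⁆ := by
    rw [leibniz_lie, h2, zero_lie, zero_add]
  have h2z' : ⁅chain a b 2, z⁆ = ⁅b, ⁅a, ⁅a, z⁆⁆⁆ := by
    simp only [chain_succ, chain_zero, lie_lie, hbz, hby, lie_zero, lie_sub]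
    abel
  rw [h.lie_chain_add_five (K := K) h5 2 (2 * m + 3) (by ring), h2z', lie_smul, lie_smul] at h2z
  have hzero : (2 * (m + 2) : K) • ⁅b, ⁅a, ⁅a, z⁆⁆⁆ = 0 := by
    rw [← sub_eq_zero] at h2z
    rw [← neg_eq_zero, ← h2z]
    push_cast
    module
  refine (smul_eq_zero.1 hzero).resolve_left ?_
  exact_mod_cast (by positivity : 2 * (m + 2) ≠ 0)

theorem six_le_span (F : IsFrame 𝒜 a b) (h : CentralUpTo a b (2 * m + 2))
    (hbz : ⁅b, ⁅b, chain a b (2 * m + 3)⁆⁆ = 0) (h5 : chain a b (2 * m + 5) = 0) :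
    𝒜 (2 * m + 6) ≤ Submodule.span K {⁅a, ⁅b, chain a b (2 * m + 3)⁆⁆} := by
  refine F.succ_le (by omega) (F.le_span_chain h le_rfl) ?_
  have hy := Submodule.mem_span_singleton_self (R := K) ⁅a, ⁅b, chain a b (2 * m + 3)⁆⁆
  rintro x (hx | hx) <;> rw [hx]
  · rw [← chain_succ, h5, h.lie_chain_even_add_four (R := K)]
    exact ⟨zero_mem _, Submodule.smul_mem _ _ hy⟩
  · exact ⟨hy, hbz ▸ zero_mem _⟩

theorem eq_zero_of_chain_eq_zero [CharZero K] [DirectSum.Decomposition 𝒜] (F : IsFrame 𝒜 a b)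
    (h : CentralUpTo a b (2 * m + 2)) (h5 : chain a b (2 * m + 5) = 0) : m = 0 := by
  by_contra hm
  refine F.not_le_span_singleton (n := 2 * m + 7) (by omega) (h.lie_lie_lie_lie_eq_zero K h5)
    (F.lie_right_lie_lie_eq_zero h h5 hm) ?_
  refine F.succ_le (by omega) (F.six_le_span h (F.lie_lie_chain_odd h) h5) ?_
  rintro x rfl
  exact ⟨Submodule.mem_span_singleton_self _, h.lie_right_lie_eq_zero K hm ▸ zero_mem _⟩

end IsFrame

end ChainStops

namespace IsFrame

theorem centralUpTo_odd [DirectSum.Decomposition 𝒜] (F : IsFrame 𝒜 a b) (h1 : CentralUpTo a b 1)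
    (h : ∀ k < m, ⁅a, ⁅b, chain a b (2 * k + 3)⁆⁆ = 0) : CentralUpTo a b (2 * m + 1) := by
  induction m with
  | zero => exact h1
  | succ m ih =>
    have h2 := (ih fun k hk => h k (by omega)).succ_odd
    exact h2.succ (h m (by omega)) (F.lie_lie_chain_odd h2)

theorem centralUpTo_or [CharZero K] [GradedLieAlgebra 𝒜] (F : IsFrame 𝒜 a b)
    (h1 : CentralUpTo a b 1) : (∀ n, CentralUpTo a b n) ∨
      ∃ a : g, IsFrame 𝒜 a b ∧ CentralUpTo a b 2 ∧ chain a b 5 = 0 := by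
  classical
  by_cases h : ∀ m, ⁅a, ⁅b, chain a b (2 * m + 3)⁆⁆ = 0
  · exact .inl fun n i hi => F.centralUpTo_odd h1 (m := n) (fun k _ => h k) i (by omega)
  · push Not at h
    have h2 := (F.centralUpTo_odd h1 fun k hk => not_not.1 (Nat.find_min h hk)).succ_odd
    obtain ⟨a', F', h2', h5⟩ := F.exists_chain_eq_zero h2 (Nat.find_spec h)
    have hm := F'.eq_zero_of_chain_eq_zero h2' h5
    rw [hm] at h2' h5
    exact .inr ⟨a', F', h2', h5⟩

end IsFrame

end ChainOfFrame

section Blocks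

section Relations

variable {L : Type*} [LieRing L] {a b : L}

theorem cubic_relation {x : L} (h : ⁅⁅b, ⁅b, a⁆⁆, x⁆ = 0) :
    ⁅b, ⁅b, ⁅a, x⁆⁆⁆ - 2 • ⁅b, ⁅a, ⁅b, x⁆⁆⁆ + ⁅a, ⁅b, ⁅b, x⁆⁆⁆ = 0 := by
  rw [← h]
  simp only [lie_lie, lie_sub]
  abel

theorem quintic_relation {x : L} (h : ⁅⁅a, ⁅a, ⁅a, ⁅a, ⁅a, b⁆⁆⁆⁆⁆, x⁆ = 0) :
    ⁅a, ⁅a, ⁅a, ⁅a, ⁅a, ⁅b, x⁆⁆⁆⁆⁆⁆ - 5 • ⁅a, ⁅a, ⁅a, ⁅a, ⁅b, ⁅a, x⁆⁆⁆⁆⁆⁆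
      + 10 • ⁅a, ⁅a, ⁅a, ⁅b, ⁅a, ⁅a, x⁆⁆⁆⁆⁆⁆ - 10 • ⁅a, ⁅a, ⁅b, ⁅a, ⁅a, ⁅a, x⁆⁆⁆⁆⁆⁆
      + 5 • ⁅a, ⁅b, ⁅a, ⁅a, ⁅a, ⁅a, x⁆⁆⁆⁆⁆⁆ - ⁅b, ⁅a, ⁅a, ⁅a, ⁅a, ⁅a, x⁆⁆⁆⁆⁆⁆ = 0 := by
  rw [← h]
  simp only [lie_lie, lie_sub]
  abel

end Relations

variable {K : Type*} [Field K] {g : Type*} [LieRing g] [LieAlgebra K g]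
variable {𝒜 : ℕ → Submodule K g} {a b p q x : g} {d : ℕ}

variable (K) in
/-- The brackets of `a` and `b` with eight consecutive basis vectors of `n_2`, except for the
relation `[b, e 5] = -e 7`. The value of `[b, e 2]` is left open: it vanishes in `n_2` and is the
central element `z` in `n_2^3`. -/
structure IsPreBlock (a b : g) (e : Fin 8 → g) : Prop where
  a0 : ⁅a, e 0⁆ = 0
  a1 : ⁅a, e 1⁆ = e 2
  a2 : ⁅a, e 2⁆ = e 3
  a3 : ⁅a, e 3⁆ = (-3 : K) • e 4
  a4 : ⁅a, e 4⁆ = (-2 : K) • e 5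
  a5 : ⁅a, e 5⁆ = 0
  a6 : ⁅a, e 6⁆ = e 7
  b0 : ⁅b, e 0⁆ = -e 2
  b1 : ⁅b, e 1⁆ = 0
  ab2 : ⁅a, ⁅b, e 2⁆⁆ = 0
  bb2 : ⁅b, ⁅b, e 2⁆⁆ = 0
  b3 : ⁅b, e 3⁆ = 0
  b4 : ⁅b, e 4⁆ = e 6
  b6 : ⁅b, e 6⁆ = 0

variable (K) in
/-- The brackets of `a` and `b` with eight consecutive basis vectors of `n_2`. -/
structure IsBlock (a b : g) (e : Fin 8 → g) : Prop extends IsPreBlock K a b e where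
  b5 : ⁅b, e 5⁆ = -e 7

variable (K) in
/-- The vectors obtained from `p, q` in the way in which eight consecutive basis vectors of `n_2`
are obtained from the first two of them. -/
def block (a b p q : g) : Fin 8 → g :=
  let e4 := (-3 : K)⁻¹ • ⁅a, ⁅a, ⁅a, q⁆⁆⁆
  ![p, q, ⁅a, q⁆, ⁅a, ⁅a, q⁆⁆, e4, (-2 : K)⁻¹ • ⁅a, e4⁆, ⁅b, e4⁆, ⁅a, ⁅b, e4⁆⁆]

/-- The degrees of the vectors of a block, relative to the degree of the first one. -/
def blockOffset : Fin 8 → ℕ := ![0, 0, 1, 2, 3, 4, 4, 5]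

theorem IsFrame.block_mem [SetLike.GradedBracket 𝒜] (F : IsFrame 𝒜 a b) (hp : p ∈ 𝒜 d)
    (hq : q ∈ 𝒜 d) (i : Fin 8) : block K a b p q i ∈ 𝒜 (d + blockOffset i) := by
  have m2 := F.lie_left_mem hq
  have m3 := F.lie_left_mem m2
  have m4 := Submodule.smul_mem _ (-3 : K)⁻¹ (F.lie_left_mem m3)
  have m6 := F.lie_right_mem m4
  fin_cases i
  exacts [hp, hq, m2, m3, m4, Submodule.smul_mem _ _ (F.lie_left_mem m4), m6, F.lie_left_mem m6]

section Span

variable {e : Fin 8 → g}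

namespace IsPreBlock

theorem one_le_span (h : IsPreBlock K a b e) (F : IsFrame 𝒜 a b) (hd : 1 ≤ d)
    (hs : 𝒜 d ≤ Submodule.span K {e 0, e 1}) : 𝒜 (d + 1) ≤ Submodule.span K {e 2} := by
  have mem := Submodule.mem_span_singleton_self (R := K) (e 2)
  refine F.succ_le hd hs ?_
  rintro x (hx | hx) <;> rw [hx]
  · rw [h.a0, h.b0]
    exact ⟨zero_mem _, neg_mem mem⟩
  · rw [h.a1, h.b1]
    exact ⟨mem, zero_mem _⟩

theorem three_le_span (h : IsPreBlock K a b e) (F : IsFrame 𝒜 a b) (hd : 1 ≤ d)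
    (hs : 𝒜 d ≤ Submodule.span K {e 0, e 1}) : 𝒜 (d + 3) ≤ Submodule.span K {e 4} := by
  have h2 : 𝒜 (d + 2) ≤ Submodule.span K {e 3, ⁅b, e 2⁆} := by
    refine F.succ_le (by omega) (h.one_le_span F hd hs) ?_
    rintro x rfl
    rw [h.a2]
    exact ⟨Submodule.subset_span (by simp), Submodule.subset_span (by simp)⟩
  refine F.succ_le (by omega) h2 ?_
  rintro x (hx | hx) <;> rw [hx]
  · rw [h.a3, h.b3]
    exact ⟨Submodule.smul_mem _ _ (Submodule.mem_span_singleton_self _), zero_mem _⟩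
  · rw [h.ab2, h.bb2]
    exact ⟨zero_mem _, zero_mem _⟩

theorem four_le_span (h : IsPreBlock K a b e) (F : IsFrame 𝒜 a b) (hd : 1 ≤ d)
    (hs : 𝒜 d ≤ Submodule.span K {e 0, e 1}) : 𝒜 (d + 4) ≤ Submodule.span K {e 5, e 6} := by
  refine F.succ_le (by omega) (h.three_le_span F hd hs) ?_
  rintro x rfl
  rw [h.a4, h.b4]
  exact ⟨Submodule.smul_mem _ _ (Submodule.subset_span (by simp)),
    Submodule.subset_span (by simp)⟩

theorem five_le_span (h : IsPreBlock K a b e) (F : IsFrame 𝒜 a b) (hd : 1 ≤ d)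
    (hs : 𝒜 d ≤ Submodule.span K {e 0, e 1}) :
    𝒜 (d + 5) ≤ Submodule.span K {e 7, ⁅b, e 5⁆} := by
  refine F.succ_le (by omega) (h.four_le_span F hd hs) ?_
  rintro x (hx | hx) <;> rw [hx]
  · rw [h.a5]
    exact ⟨zero_mem _, Submodule.subset_span (by simp)⟩
  · rw [h.a6, h.b6]
    exact ⟨Submodule.subset_span (by simp), zero_mem _⟩

end IsPreBlock

theorem IsBlock.five_le_span (h : IsBlock K a b e) (F : IsFrame 𝒜 a b) (hd : 1 ≤ d)
    (hs : 𝒜 d ≤ Submodule.span K {e 0, e 1}) : 𝒜 (d + 5) ≤ Submodule.span K {e 7} := by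
  refine (h.toIsPreBlock.five_le_span F hd hs).trans (Submodule.span_le.2 ?_)
  have mem := Submodule.mem_span_singleton_self (R := K) (e 7)
  rintro x (hx | hx) <;> rw [hx]
  exacts [mem, h.b5 ▸ neg_mem mem]

end Span

theorem IsFrame.eq_zero_of_lie_eq_zero (F : IsFrame 𝒜 a b) {n : ℕ} (hn : 1 ≤ n) {p q x z : g}
    (hp : p ∈ 𝒜 n) (hq : q ∈ 𝒜 n) (hx : x ∈ 𝒜 (n + 1)) (hz : z ∈ 𝒜 (n + 1))
    (ha : ⁅a, z⁆ = 0) (hb : ⁅b, z⁆ = 0) (hs : 𝒜 (n + 1) ≤ Submodule.span K {x, z})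
    (h : LinearIndependent K ![z, x] → LinearIndependent K ![p, q]) : z = 0 := by
  by_contra hz0
  by_cases hi : LinearIndependent K ![z, x]
  · exact F.narrow.not_linearIndependent_succ hn hp hq hz hx (h hi) hi
  · obtain ⟨t, rfl⟩ := exists_smul_eq_of_not_linearIndependent hz0 hi
    refine F.not_le_span_singleton (by omega) ha hb (hs.trans (Submodule.span_le.2 ?_))
    have mem := Submodule.mem_span_singleton_self (R := K) z
    rintro y (rfl | rfl)
    exacts [Submodule.smul_mem _ _ mem, mem]

theorem linearIndependent_of_lie (h5 : ⁅a, p⁆ = 0) (h6 : ⁅b, q⁆ = 0)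
    (h : LinearIndependent K ![⁅a, q⁆ + ⁅b, p⁆, ⁅a, q⁆]) : LinearIndependent K ![p, q] := by
  rw [LinearIndependent.pair_iff] at h ⊢
  intro s t hst
  have ht : t • ⁅a, q⁆ = 0 := by simpa [h5] using congrArg (fun x => ⁅a, x⁆) hst
  have hs : s • ⁅b, p⁆ = 0 := by simpa [h6] using congrArg (fun x => ⁅b, x⁆) hst
  obtain ⟨rfl, hts⟩ := h s (t - s) (by linear_combination (norm := module) ht + hs)
  exact ⟨rfl, by simpa using hts⟩

variable (K) in
/-- The relations between `a`, `b` and the last vector of a block. -/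
structure IsBlockEnd (a b x : g) : Prop where
  aa : ⁅a, ⁅a, x⁆⁆ = 0
  bb : ⁅b, ⁅b, x⁆⁆ = 0
  ab : ⁅a, ⁅b, x⁆⁆ = (2 : K) • ⁅b, ⁅a, x⁆⁆

variable (K) in
/-- The eight vectors after a block ending in `x`. -/
def nextBlock (a b x : g) : Fin 8 → g :=
  block K a b (-⁅a, x⁆) ((2 : K)⁻¹ • ⁅b, x⁆)

theorem lie_left_eq_neg_nextBlock (a b x : g) : ⁅a, x⁆ = -nextBlock K a b x 0 := (neg_neg _).symm

namespace IsBlockEnd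

theorem lie_left_zero (h : IsBlockEnd K a b x) : ⁅a, nextBlock K a b x 0⁆ = 0 := by
  change ⁅a, -⁅a, x⁆⁆ = 0
  rw [lie_neg, h.aa, neg_zero]

theorem lie_right_one (h : IsBlockEnd K a b x) : ⁅b, nextBlock K a b x 1⁆ = 0 := by
  change ⁅b, (2 : K)⁻¹ • ⁅b, x⁆⁆ = 0
  rw [lie_smul, h.bb, smul_zero]

end IsBlockEnd

variable (K) in
/-- The images of the basis vectors of `n_2`, in blocks of eight. -/
def blocks (a b : g) : ℕ → Fin 8 → g
  | 0 => block K a b a b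
  | m + 1 => nextBlock K a b (blocks a b m 7)

theorem lie_left_blocks_seven (a b : g) (m : ℕ) :
    ⁅a, blocks K a b m 7⁆ = -blocks K a b (m + 1) 0 := (neg_neg _).symm

namespace IsFrame

theorem blocks_mem [SetLike.GradedBracket 𝒜] (F : IsFrame 𝒜 a b) (m : ℕ) (i : Fin 8) :
    blocks K a b m i ∈ 𝒜 (6 * m + 1 + blockOffset i) := by
  induction m generalizing i with
  | zero => exact F.block_mem F.left_mem F.right_mem i
  | succ m ih =>
    exact F.block_mem (d := 6 * m + 1 + 5 + 1) (neg_mem (F.lie_left_mem (ih 7)))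
      (Submodule.smul_mem _ _ (F.lie_right_mem (ih 7))) i

theorem lie_cubic_eq_zero [DirectSum.Decomposition 𝒜] (F : IsFrame 𝒜 a b)
    (h : CentralUpTo a b 2) (x : g) : ⁅⁅b, ⁅b, a⁆⁆, x⁆ = 0 := by
  rw [← lie_skew b a, lie_neg, neg_lie, ← lie_skew, neg_neg]
  exact F.lie_eq_zero (h 1 one_le_two).1 (h 1 one_le_two).2 x

end IsFrame

variable [CharZero K]

theorem lie_left_block_three (a b p q : g) :
    ⁅a, block K a b p q 3⁆ = (-3 : K) • block K a b p q 4 :=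
  (smul_inv_smul₀ (by norm_num) _).symm

theorem lie_left_block_four (a b p q : g) :
    ⁅a, block K a b p q 4⁆ = (-2 : K) • block K a b p q 5 :=
  (smul_inv_smul₀ (by norm_num) _).symm

theorem lie_right_eq_smul_nextBlock (a b x : g) : ⁅b, x⁆ = (2 : K) • nextBlock K a b x 1 :=
  (smul_inv_smul₀ two_ne_zero _).symm

theorem IsBlock.isBlockEnd {e : Fin 8 → g} (h : IsBlock K a b e)
    (hc : ∀ x : g, ⁅⁅b, ⁅b, a⁆⁆, x⁆ = 0) (hq : ∀ x : g, ⁅⁅a, ⁅a, ⁅a, ⁅a, ⁅a, b⁆⁆⁆⁆⁆, x⁆ = 0) :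
    IsBlockEnd K a b (e 7) where
  aa := by
    have h2 := quintic_relation (hq (e 2))
    simp only [h.a2, h.a3, h.a4, h.a5, h.b3, h.b4, h.b5, h.a6, h.ab2, lie_smul, lie_neg,
      lie_zero] at h2
    refine (smul_eq_zero_iff_right (r := (30 : K)) (by norm_num)).1 ?_
    linear_combination (norm := module) h2
  bb := by
    have h6 := cubic_relation (hc (e 6))
    simpa only [h.a6, h.b6, lie_zero, smul_zero, sub_zero, add_zero] using h6
  ab := by
    have h5 := cubic_relation (hc (e 5))
    simp only [h.a5, h.b5, lie_neg, lie_zero] at h5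
    linear_combination (norm := module) -h5

namespace IsBlockEnd

theorem lie_right_zero (h : IsBlockEnd K a b x) :
    ⁅b, nextBlock K a b x 0⁆ = -nextBlock K a b x 2 := by
  change ⁅b, -⁅a, x⁆⁆ = -⁅a, (2 : K)⁻¹ • ⁅b, x⁆⁆
  rw [lie_neg, lie_smul, h.ab, inv_smul_smul₀ two_ne_zero]

theorem lie_right_two (h : IsBlockEnd K a b x) (hc : ⁅⁅b, ⁅b, a⁆⁆, x⁆ = 0) :
    ⁅b, nextBlock K a b x 2⁆ = 0 := by
  have a1 : ⁅a, nextBlock K a b x 1⁆ = nextBlock K a b x 2 := rfl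
  have hx := cubic_relation hc
  simp only [lie_left_eq_neg_nextBlock (K := K) a b x, lie_right_eq_smul_nextBlock (K := K) a b x,
    a1, h.lie_right_zero, h.lie_right_one, lie_smul, lie_neg, lie_zero] at hx
  refine (smul_eq_zero_iff_right (r := (-3 : K)) (by norm_num)).1 ?_
  linear_combination (norm := module) hx

theorem isPreBlock (h : IsBlockEnd K a b x) (hc : ∀ x : g, ⁅⁅b, ⁅b, a⁆⁆, x⁆ = 0)
    (hq : ∀ x : g, ⁅⁅a, ⁅a, ⁅a, ⁅a, ⁅a, b⁆⁆⁆⁆⁆, x⁆ = 0) : IsPreBlock K a b (nextBlock K a b x) := by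
  set f := nextBlock K a b x
  have xa : ⁅a, x⁆ = -f 0 := lie_left_eq_neg_nextBlock a b x
  have xb : ⁅b, x⁆ = (2 : K) • f 1 := lie_right_eq_smul_nextBlock a b x
  have a0 : ⁅a, f 0⁆ = 0 := h.lie_left_zero
  have a1 : ⁅a, f 1⁆ = f 2 := rfl
  have a2 : ⁅a, f 2⁆ = f 3 := rfl
  have a3 : ⁅a, f 3⁆ = (-3 : K) • f 4 := lie_left_block_three ..
  have a4 : ⁅a, f 4⁆ = (-2 : K) • f 5 := lie_left_block_four ..
  have b0 : ⁅b, f 0⁆ = -f 2 := h.lie_right_zero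
  have b4 : ⁅b, f 4⁆ = f 6 := rfl
  have b2 : ⁅b, f 2⁆ = 0 := h.lie_right_two (hc x)
  have b3 : ⁅b, f 3⁆ = 0 := by
    have h0 := cubic_relation (hc (f 0))
    simp only [a0, b0, a2, b2, lie_neg, lie_zero] at h0
    refine (smul_eq_zero_iff_right (r := (2 : K)) two_ne_zero).1 ?_
    linear_combination (norm := module) h0
  have a5 : ⁅a, f 5⁆ = 0 := by
    have hx := quintic_relation (hq x)
    simp only [xa, xb, a0, a1, a2, a3, a4, b0, lie_smul, lie_neg, lie_zero] at hx
    refine (smul_eq_zero_iff_right (r := (-18 : K)) (by norm_num)).1 ?_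
    linear_combination (norm := module) hx
  have b6 : ⁅b, f 6⁆ = 0 := by
    have h3 := cubic_relation (hc (f 3))
    simp only [a3, b3, b4, lie_smul, lie_zero] at h3
    refine (smul_eq_zero_iff_right (r := (-3 : K)) (by norm_num)).1 ?_
    linear_combination (norm := module) h3
  exact ⟨a0, a1, a2, a3, a4, a5, rfl, b0, h.lie_right_one,
    by rw [b2, lie_zero], by rw [b2, lie_zero], b3, b4, b6⟩

end IsBlockEnd

/-- The defect `[a, e 6] + [b, e 5]` is annihilated by `a` and `b`, so that the dimension bound
forces it to vanish. -/
theorem IsPreBlock.isBlock [SetLike.GradedBracket 𝒜] {e : Fin 8 → g} (h : IsPreBlock K a b e)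
    (F : IsFrame 𝒜 a b) (hb2 : ⁅b, e 2⁆ = 0) (hc : ⁅⁅b, ⁅b, a⁆⁆, e 4⁆ = 0)
    (hq : ⁅⁅a, ⁅a, ⁅a, ⁅a, ⁅a, b⁆⁆⁆⁆⁆, e 1⁆ = 0) (hd : 1 ≤ d)
    (mem : ∀ i, e i ∈ 𝒜 (d + blockOffset i)) (hs : 𝒜 d ≤ Submodule.span K {e 0, e 1}) :
    IsBlock K a b e where
  __ := h
  b5 := by
    suffices hz : e 7 + ⁅b, e 5⁆ = 0 from (neg_eq_of_add_eq_zero_right hz).symm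
    refine F.eq_zero_of_lie_eq_zero (n := d + 4) (by omega) (mem 5) (mem 6) (mem 7)
      (add_mem (mem 7) (F.lie_right_mem (mem 5))) ?_ ?_ ?_ ?_
    · have h1 := quintic_relation hq
      simp only [h.a1, h.a2, h.a3, h.a4, h.a5, h.b1, hb2, h.b3, h.b4, h.a6, lie_smul,
        lie_zero] at h1
      refine (smul_eq_zero_iff_right (r := (30 : K)) (by norm_num)).1 ?_
      linear_combination (norm := (rw [lie_add]; module)) h1
    · have h4 := cubic_relation hc
      simp only [h.a4, h.b4, h.a6, h.b6, lie_smul, lie_zero] at h4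
      refine (smul_eq_zero_iff_right (r := (-2 : K)) (by norm_num)).1 ?_
      linear_combination (norm := (rw [lie_add]; module)) h4
    · refine (h.five_le_span F hd hs).trans (Submodule.span_le.2 ?_)
      rintro y (rfl | rfl)
      · exact Submodule.subset_span (by simp)
      · exact Submodule.mem_span_pair.2 ⟨-1, 1, by module⟩
    · rw [← h.a6]
      exact linearIndependent_of_lie h.a5 h.b6

theorem IsFrame.nextBlock_span (F : IsFrame 𝒜 a b) (hd : 1 ≤ d)
    (hs : 𝒜 d ≤ Submodule.span K {x}) :
    𝒜 (d + 1) ≤ Submodule.span K {nextBlock K a b x 0, nextBlock K a b x 1} := by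
  refine F.succ_le hd hs ?_
  rintro y rfl
  rw [lie_left_eq_neg_nextBlock (K := K) a b y, lie_right_eq_smul_nextBlock (K := K) a b y]
  exact ⟨neg_mem (Submodule.subset_span (by simp)),
    Submodule.smul_mem _ _ (Submodule.subset_span (by simp))⟩

theorem IsFrame.isBlock_first [DirectSum.Decomposition 𝒜] (F : IsFrame 𝒜 a b)
    (h : CentralUpTo a b 2) (h5 : chain a b 5 = 0) : IsBlock K a b (block K a b a b) where
  a0 := lie_self a
  a1 := rfl
  a2 := rfl
  a3 := lie_left_block_three ..
  a4 := lie_left_block_four ..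
  a5 := by
    change ⁅a, (-2 : K)⁻¹ • ⁅a, (-3 : K)⁻¹ • chain a b 3⁆⁆ = 0
    rw [lie_smul, lie_smul, lie_smul, ← chain_succ, ← chain_succ, h5, smul_zero, smul_zero]
  a6 := rfl
  b0 := (lie_skew b a).symm
  b1 := lie_self b
  ab2 := (h 1 one_le_two).1
  bb2 := (h 1 one_le_two).2
  b3 := h.lie_chain_even (i := 1) (by norm_num)
  b4 := rfl
  b5 := by
    change ⁅b, (-2 : K)⁻¹ • ⁅a, (-3 : K)⁻¹ • chain a b 3⁆⁆ = -⁅a, ⁅b, (-3 : K)⁻¹ • chain a b 3⁆⁆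
    have h4 : ⁅b, chain a b 4⁆ = _ := h.lie_chain_even_add_four (R := K) (m := 0)
    simp only [lie_smul, ← chain_succ, h4]
    push_cast
    module
  b6 := by
    change ⁅b, ⁅b, (-3 : K)⁻¹ • chain a b 3⁆⁆ = 0
    rw [lie_smul, lie_smul, F.lie_lie_chain_odd (m := 0) h, smul_zero]

theorem lie_right_blocks_seven (a b : g) (m : ℕ) :
    ⁅b, blocks K a b m 7⁆ = (2 : K) • blocks K a b (m + 1) 1 :=
  (smul_inv_smul₀ two_ne_zero _).symm

namespace IsFrame

theorem isBlock_blocks_and_span [GradedLieAlgebra 𝒜] (F : IsFrame 𝒜 a b)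
    (h : CentralUpTo a b 2) (h5 : chain a b 5 = 0) (m : ℕ) : IsBlock K a b (blocks K a b m) ∧
      𝒜 (6 * m + 1) ≤ Submodule.span K {blocks K a b m 0, blocks K a b m 1} := by
  induction m with
  | zero => exact ⟨F.isBlock_first h h5, F.span_eq.le⟩
  | succ m ih =>
    obtain ⟨hB, hs⟩ := ih
    have hc := F.lie_cubic_eq_zero h
    have hq : ∀ x : g, ⁅⁅a, ⁅a, ⁅a, ⁅a, ⁅a, b⁆⁆⁆⁆⁆, x⁆ = 0 := fun x => by
      rw [show ⁅a, ⁅a, ⁅a, ⁅a, ⁅a, b⁆⁆⁆⁆⁆ = 0 from h5, zero_lie]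
    have hE := hB.isBlockEnd hc hq
    have hs' := F.nextBlock_span (by omega) (hB.five_le_span F (by omega) hs)
    exact ⟨(hE.isPreBlock hc hq).isBlock F (hE.lie_right_two (hc _)) (hc _) (hq _) (by omega)
      (F.blocks_mem (m + 1)) hs', hs'⟩

theorem lie_blocks_succ_two [GradedLieAlgebra 𝒜] (F : IsFrame 𝒜 a b) (h : CentralUpTo a b 2)
    (h5 : chain a b 5 = 0) (m : ℕ) : ⁅b, blocks K a b (m + 1) 2⁆ = 0 := by
  have hc := F.lie_cubic_eq_zero h
  have hE := (F.isBlock_blocks_and_span h h5 m).1.isBlockEnd hc fun x => by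
    rw [show ⁅a, ⁅a, ⁅a, ⁅a, ⁅a, b⁆⁆⁆⁆⁆ = 0 from h5, zero_lie]
  exact hE.lie_right_two (hc _)

theorem blocks_ne_zero [GradedLieAlgebra 𝒜] (F : IsFrame 𝒜 a b) (h : CentralUpTo a b 2)
    (h5 : chain a b 5 = 0) (m : ℕ) (r : Fin 8) : blocks K a b m r ≠ 0 := by
  obtain ⟨hB, hs⟩ := F.isBlock_blocks_and_span h h5 m
  have ne {n : ℕ} {x : g} (hn : 1 ≤ n) (hs : 𝒜 n ≤ Submodule.span K {x}) : x ≠ 0 := by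
    rintro rfl
    exact F.ne_bot n hn (le_bot_iff.1 (by simpa using hs))
  have h2 := ne (by omega) (hB.one_le_span F (by omega) hs)
  have h4 := ne (by omega) (hB.three_le_span F (by omega) hs)
  have h7 := ne (by omega) (hB.five_le_span F (by omega) hs)
  fin_cases r
  · exact fun h0 => h2 (by simpa [show blocks K a b m 0 = 0 from h0] using hB.b0.symm)
  · exact fun h0 => h2 (by simpa [show blocks K a b m 1 = 0 from h0] using hB.a1.symm)
  · exact h2
  · exact fun h0 => h4 (by simpa [show blocks K a b m 3 = 0 from h0] using hB.a3.symm)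
  · exact h4
  · exact fun h0 => h7 (by simpa [show blocks K a b m 5 = 0 from h0] using hB.b5.symm)
  · exact fun h0 => h7 (by simpa [show blocks K a b m 6 = 0 from h0] using hB.a6.symm)
  · exact h7

end IsFrame

end Blocks

section Loops

variable {K : Type*} [Field K] {g : Type*} [LieRing g] [LieAlgebra K g]
variable {𝒜 : ℕ → Submodule K g} {a b x : g} {e : Fin 3 → g} {ε : K} {n k : ℕ}

/-- The brackets of `a = u ⊗ t` and `b = v ⊗ t` with the three vectors `u ⊗ t^(2k+1)`,
`v ⊗ t^(2k+1)`, `w ⊗ t^(2k+2)` of `n_1^±`, except for those with the last vector. -/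
structure IsLoop (a b : g) (e : Fin 3 → g) : Prop where
  a0 : ⁅a, e 0⁆ = 0
  a1 : ⁅a, e 1⁆ = e 2
  b0 : ⁅b, e 0⁆ = -e 2
  b1 : ⁅b, e 1⁆ = 0

/-- The degrees of the vectors `u ⊗ t^(2k+1)`, `v ⊗ t^(2k+1)`, `w ⊗ t^(2k+2)`, relative to the
degree of the first one. -/
def loopOffset : Fin 3 → ℕ := ![0, 0, 1]

/-- The three vectors after `x = w ⊗ t^(2k+2)`. -/
def nextLoop (ε : K) (a b x : g) : Fin 3 → g := ![ε⁻¹ • ⁅b, x⁆, -⁅a, x⁆, ⁅a, -⁅a, x⁆⁆]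

/-- The images of the monomials `u ⊗ t^(2k+1)`, `v ⊗ t^(2k+1)`, `w ⊗ t^(2k+2)`. -/
def loops (ε : K) (a b : g) : ℕ → Fin 3 → g
  | 0 => ![a, b, ⁅a, b⁆]
  | k + 1 => nextLoop ε a b (loops ε a b k 2)

theorem lie_left_eq_neg_nextLoop (ε : K) (a b x : g) : ⁅a, x⁆ = -nextLoop ε a b x 1 :=
  (neg_neg _).symm

theorem lie_right_eq_smul_nextLoop (hε : ε ≠ 0) (a b x : g) :
    ⁅b, x⁆ = ε • nextLoop ε a b x 0 := (smul_inv_smul₀ hε _).symm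

theorem IsLoop.succ_le_span (h : IsLoop a b e) (F : IsFrame 𝒜 a b) (hn : 1 ≤ n)
    (hs : 𝒜 n ≤ Submodule.span K {e 0, e 1}) : 𝒜 (n + 1) ≤ Submodule.span K {e 2} := by
  have mem := Submodule.mem_span_singleton_self (R := K) (e 2)
  refine F.succ_le hn hs ?_
  rintro x (hx | hx) <;> rw [hx]
  · rw [h.a0, h.b0]
    exact ⟨zero_mem _, neg_mem mem⟩
  · rw [h.a1, h.b1]
    exact ⟨mem, zero_mem _⟩

namespace IsFrame

theorem nextLoop_mem [SetLike.GradedBracket 𝒜] (F : IsFrame 𝒜 a b) (hx : x ∈ 𝒜 n) (i : Fin 3) :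
    nextLoop ε a b x i ∈ 𝒜 (n + 1 + loopOffset i) := by
  have m1 := neg_mem (F.lie_left_mem hx)
  fin_cases i
  exacts [Submodule.smul_mem _ _ (F.lie_right_mem hx), m1, F.lie_left_mem m1]

theorem loops_mem [SetLike.GradedBracket 𝒜] (F : IsFrame 𝒜 a b) (k : ℕ) (i : Fin 3) :
    loops ε a b k i ∈ 𝒜 (2 * k + 1 + loopOffset i) := by
  induction k generalizing i with
  | zero =>
    fin_cases i
    exacts [F.left_mem, F.right_mem, F.lie_left_mem F.right_mem]
  | succ k ih => exact F.nextLoop_mem (ih 2) i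

theorem nextLoop_span (F : IsFrame 𝒜 a b) (hε : ε ≠ 0) (hn : 1 ≤ n)
    (hs : 𝒜 n ≤ Submodule.span K {x}) :
    𝒜 (n + 1) ≤ Submodule.span K {nextLoop ε a b x 0, nextLoop ε a b x 1} := by
  refine F.succ_le hn hs ?_
  rintro y rfl
  rw [lie_left_eq_neg_nextLoop ε a b y, lie_right_eq_smul_nextLoop hε a b y]
  exact ⟨neg_mem (Submodule.subset_span (by simp)),
    Submodule.smul_mem _ _ (Submodule.subset_span (by simp))⟩

end IsFrame

theorem isLoop_loops_zero (ε : K) (a b : g) : IsLoop a b (loops ε a b 0) :=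
  ⟨lie_self a, rfl, (lie_skew b a).symm, lie_self b⟩

theorem isLoop_loops_one (hε : ε ≠ 0) (hab : ⁅a, ⁅b, ⁅a, b⁆⁆⁆ = 0)
    (hbb : ⁅b, ⁅b, ⁅a, b⁆⁆⁆ = ε • ⁅a, ⁅a, ⁅a, b⁆⁆⁆) : IsLoop a b (loops ε a b 1) where
  a0 := by
    change ⁅a, ε⁻¹ • ⁅b, ⁅a, b⁆⁆⁆ = 0
    rw [lie_smul, hab, smul_zero]
  a1 := rfl
  b0 := by
    change ⁅b, ε⁻¹ • ⁅b, ⁅a, b⁆⁆⁆ = -⁅a, -⁅a, ⁅a, b⁆⁆⁆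
    rw [lie_smul, hbb, inv_smul_smul₀ hε, lie_neg, neg_neg]
  b1 := by
    change ⁅b, -⁅a, ⁅a, b⁆⁆⁆ = 0
    rw [lie_neg, lie_lie_lie_comm, hab, neg_zero]

namespace IsLoop

theorem lie_right_nextLoop_zero (he : IsLoop a b (nextLoop ε a b x)) (hε : ε ≠ 0)
    (hab : ⁅a, ⁅b, ⁅a, b⁆⁆⁆ = 0) :
    ⁅b, nextLoop ε a b (nextLoop ε a b x 2) 0⁆ = -nextLoop ε a b (nextLoop ε a b x 2) 2 := by
  set e := nextLoop ε a b x
  have xa : ⁅a, x⁆ = -e 1 := lie_left_eq_neg_nextLoop ε a b x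
  have xb : ⁅b, x⁆ = ε • e 0 := lie_right_eq_smul_nextLoop hε a b x
  have ea := lie_left_eq_neg_nextLoop ε a b (e 2)
  have eb := lie_right_eq_smul_nextLoop hε a b (e 2)
  set f := nextLoop ε a b (e 2)
  have fa : ⁅a, f 1⁆ = f 2 := rfl
  have hx : ⁅⁅a, ⁅b, ⁅a, b⁆⁆⁆, x⁆ = 0 := by rw [hab, zero_lie]
  simp only [lie_lie, lie_sub, xa, xb, he.a0, he.a1, he.b0, he.b1, ea, eb, fa, lie_neg, lie_smul,
    lie_zero] at hx
  refine eq_neg_of_add_eq_zero_left ((smul_eq_zero_iff_right hε).1 ?_)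
  linear_combination (norm := module) -hx

variable [CharZero K]

theorem lie_right_nextLoop_one (he : IsLoop a b (nextLoop ε a b x)) (hε : ε ≠ 0)
    (hbb : ⁅b, ⁅b, ⁅a, b⁆⁆⁆ = ε • ⁅a, ⁅a, ⁅a, b⁆⁆⁆) :
    ⁅b, nextLoop ε a b (nextLoop ε a b x 2) 1⁆
      = ε • ⁅a, nextLoop ε a b (nextLoop ε a b x 2) 0⁆ := by
  set e := nextLoop ε a b x
  have xa : ⁅a, x⁆ = -e 1 := lie_left_eq_neg_nextLoop ε a b x
  have xb : ⁅b, x⁆ = ε • e 0 := lie_right_eq_smul_nextLoop hε a b x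
  have ea := lie_left_eq_neg_nextLoop ε a b (e 2)
  have eb := lie_right_eq_smul_nextLoop hε a b (e 2)
  set f := nextLoop ε a b (e 2)
  have hx : ⁅⁅b, ⁅b, ⁅a, b⁆⁆⁆, x⁆ - ε • ⁅⁅a, ⁅a, ⁅a, b⁆⁆⁆, x⁆ = 0 := by
    rw [hbb, smul_lie, sub_self]
  simp only [lie_lie, lie_sub, xa, xb, he.a0, he.a1, he.b0, he.b1, ea, eb, lie_neg, lie_smul,
    lie_zero] at hx
  refine sub_eq_zero.1 ((smul_eq_zero_iff_right (r := -2 * ε) (by simpa using hε)).1 ?_)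
  linear_combination (norm := module) hx

theorem lie_left_lie_left_nextLoop_zero (he : IsLoop a b e) (hε : ε ≠ 0)
    (hab : ⁅a, ⁅b, ⁅a, b⁆⁆⁆ = 0)
    (b1 : ⁅b, nextLoop ε a b (e 2) 1⁆ = ε • ⁅a, nextLoop ε a b (e 2) 0⁆) :
    ⁅a, ⁅a, nextLoop ε a b (e 2) 0⁆⁆ = 0 := by
  have ea := lie_left_eq_neg_nextLoop ε a b (e 2)
  have eb := lie_right_eq_smul_nextLoop hε a b (e 2)
  have hx : ⁅⁅a, ⁅b, ⁅a, b⁆⁆⁆, e 0⁆ = 0 := by rw [hab, zero_lie]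
  simp only [lie_lie, lie_sub, he.a0, he.b0, ea, eb, b1, lie_neg, lie_smul, lie_zero] at hx
  refine (smul_eq_zero_iff_right (r := 3 * ε) (by simpa using hε)).1 ?_
  linear_combination (norm := module) hx

theorem lie_right_lie_left_nextLoop_zero (he : IsLoop a b e) (hε : ε ≠ 0)
    (hab : ⁅a, ⁅b, ⁅a, b⁆⁆⁆ = 0)
    (b0 : ⁅b, nextLoop ε a b (e 2) 0⁆ = -nextLoop ε a b (e 2) 2)
    (b1 : ⁅b, nextLoop ε a b (e 2) 1⁆ = ε • ⁅a, nextLoop ε a b (e 2) 0⁆) :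
    ⁅b, ⁅a, nextLoop ε a b (e 2) 0⁆⁆ = 0 := by
  have ea := lie_left_eq_neg_nextLoop ε a b (e 2)
  have eb := lie_right_eq_smul_nextLoop hε a b (e 2)
  have hx : ⁅⁅a, ⁅b, ⁅a, b⁆⁆⁆, e 1⁆ = 0 := by rw [hab, zero_lie]
  simp only [lie_lie, lie_sub, he.a1, he.b1, ea, eb, b0, b1, lie_neg, lie_smul, lie_zero] at hx
  refine (smul_eq_zero_iff_right (r := -3 * ε) (by simpa using hε)).1 ?_
  linear_combination (norm := module) hx

theorem isLoop_nextLoop [SetLike.GradedBracket 𝒜] (he : IsLoop a b (nextLoop ε a b x))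
    (F : IsFrame 𝒜 a b) (hε : ε ≠ 0) (hab : ⁅a, ⁅b, ⁅a, b⁆⁆⁆ = 0)
    (hbb : ⁅b, ⁅b, ⁅a, b⁆⁆⁆ = ε • ⁅a, ⁅a, ⁅a, b⁆⁆⁆) (hn : 1 ≤ n)
    (mem : nextLoop ε a b x 2 ∈ 𝒜 n)
    (hs : 𝒜 n ≤ Submodule.span K {nextLoop ε a b x 2}) :
    IsLoop a b (nextLoop ε a b (nextLoop ε a b x 2)) := by
  have b0 := he.lie_right_nextLoop_zero hε hab
  have b1 := he.lie_right_nextLoop_one hε hbb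
  have aa := he.lie_left_lie_left_nextLoop_zero hε hab b1
  have ba := he.lie_right_lie_left_nextLoop_zero hε hab b0 b1
  have mem' := F.nextLoop_mem (ε := ε) mem
  have hs' := F.nextLoop_span hε hn hs
  set f := nextLoop ε a b (nextLoop ε a b x 2)
  have a1 : ⁅a, f 1⁆ = f 2 := rfl
  have a0 : ⁅a, f 0⁆ = 0 := by
    refine F.eq_zero_of_lie_eq_zero (n := n + 1) (by omega) (mem' 0) (mem' 1) (mem' 2)
      (F.lie_left_mem (mem' 0)) aa ba (F.succ_le (by omega) hs' ?_) ?_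
    · rintro y (rfl | rfl)
      · rw [b0]
        exact ⟨Submodule.subset_span (by simp), neg_mem (Submodule.subset_span (by simp))⟩
      · rw [a1, b1]
        exact ⟨Submodule.subset_span (by simp),
          Submodule.smul_mem _ _ (Submodule.subset_span (by simp))⟩
    · simp only [LinearIndependent.pair_iff]
      intro hi s t hst
      exact hi s t (by simpa [a1] using congrArg (fun y => ⁅a, y⁆) hst)
  exact ⟨a0, a1, b0, by rw [b1, a0, smul_zero]⟩

end IsLoop

variable [CharZero K]

namespace IsFrame

theorem isLoop_loops_and_span [SetLike.GradedBracket 𝒜] (F : IsFrame 𝒜 a b) (hε : ε ≠ 0)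
    (hab : ⁅a, ⁅b, ⁅a, b⁆⁆⁆ = 0) (hbb : ⁅b, ⁅b, ⁅a, b⁆⁆⁆ = ε • ⁅a, ⁅a, ⁅a, b⁆⁆⁆) (k : ℕ) :
    (IsLoop a b (loops ε a b k) ∧ 𝒜 (2 * k + 2) ≤ Submodule.span K {loops ε a b k 2}) ∧
      IsLoop a b (loops ε a b (k + 1)) ∧
        𝒜 (2 * k + 4) ≤ Submodule.span K {loops ε a b (k + 1) 2} := by
  have span_succ {k : ℕ} (h : IsLoop a b (loops ε a b (k + 1)))
      (hs : 𝒜 (2 * k + 2) ≤ Submodule.span K {loops ε a b k 2}) :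
      𝒜 (2 * k + 4) ≤ Submodule.span K {loops ε a b (k + 1) 2} :=
    h.succ_le_span F (by omega) (F.nextLoop_span hε (by omega) hs)
  induction k with
  | zero =>
    have h0 := isLoop_loops_zero ε a b
    have h1 := isLoop_loops_one hε hab hbb
    have hs := h0.succ_le_span F le_rfl F.span_eq.le
    exact ⟨⟨h0, hs⟩, h1, span_succ h1 hs⟩
  | succ k ih =>
    obtain ⟨-, h, hs⟩ := ih
    have h' := h.isLoop_nextLoop F hε hab hbb (by omega) (F.loops_mem (k + 1) 2) hs
    exact ⟨⟨h, hs⟩, h', span_succ (k := k + 1) h' hs⟩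

theorem isLoop_loops [SetLike.GradedBracket 𝒜] (F : IsFrame 𝒜 a b) (hε : ε ≠ 0)
    (hab : ⁅a, ⁅b, ⁅a, b⁆⁆⁆ = 0) (hbb : ⁅b, ⁅b, ⁅a, b⁆⁆⁆ = ε • ⁅a, ⁅a, ⁅a, b⁆⁆⁆) (k : ℕ) :
    IsLoop a b (loops ε a b k) :=
  (F.isLoop_loops_and_span hε hab hbb k).1.1

end IsFrame

end Loops

section Iso

variable {K : Type*} [Field K] {g : Type*} [LieRing g] [LieAlgebra K g]
variable {𝒜 : ℕ → Submodule K g} {ι : Type*}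

theorem linearIndependent_of_homogeneous [DirectSum.Decomposition 𝒜] {E : ι → g} {deg : ι → ℕ}
    (hE : ∀ i, E i ∈ 𝒜 (deg i))
    (h : ∀ i, ∃ p : Submodule K g, E i ∉ p ∧ ∀ k, k ≠ i → deg k = deg i → E k ∈ p) :
    LinearIndependent K E := by
  classical
  rw [linearIndependent_iff']
  intro s l hl i hi
  obtain ⟨p, hp, hk⟩ := h i
  let f : g →ₗ[K] g ⧸ p := p.mkQ ∘ₗ (𝒜 (deg i)).subtype ∘ₗ DirectSum.component K ℕ _ (deg i) ∘ₗ
    (DirectSum.decomposeLinearEquiv 𝒜).toLinearMap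
  have hf (x : g) : f x = p.mkQ (DirectSum.decompose 𝒜 x (deg i)) := rfl
  have hfi : f (E i) ≠ 0 := by
    rwa [hf, DirectSum.decompose_of_mem_same 𝒜 (hE i), Submodule.mkQ_apply, Ne,
      Submodule.Quotient.mk_eq_zero]
  have hfk (k : ι) (hki : k ≠ i) : f (E k) = 0 := by
    rw [hf]
    by_cases hd : deg k = deg i
    · rw [← hd, DirectSum.decompose_of_mem_same 𝒜 (hE k), Submodule.mkQ_apply,
        Submodule.Quotient.mk_eq_zero]
      exact hk k hki hd
    · rw [DirectSum.decompose_of_mem_ne 𝒜 (hE k) hd, map_zero]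
  have hsum := congrArg f hl
  rw [map_sum, map_zero, Finset.sum_eq_single_of_mem i hi fun k _ hki => by
    rw [map_smul, hfk k hki, smul_zero], map_smul] at hsum
  exact (smul_eq_zero.1 hsum).resolve_right hfi

variable {L : Type*} [LieRing L] [LieAlgebra K L]

theorem nonempty_lieEquiv_of_lieSpan_eq_top (B : Module.Basis ι K L) {E : ι → g}
    (hE : LinearIndependent K E) {p q : ι} {x y : g} (hp : E p = x) (hq : E q = y)
    (hB : LieSubalgebra.lieSpan K L {B p, B q} = ⊤) (hg : LieSubalgebra.lieSpan K g {x, y} = ⊤)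
    (hx : ∀ i, B.constr K E ⁅B p, B i⁆ = ⁅x, E i⁆) (hy : ∀ i, B.constr K E ⁅B q, B i⁆ = ⁅y, E i⁆) :
    Nonempty (g ≃ₗ⁅K⁆ L) := by
  subst hp hq
  set φ : L →ₗ[K] g := B.constr K E
  have hφB (i : ι) : φ (B i) = E i := B.constr_basis K E i
  have map_lie_of_basis (j : ι) (h : ∀ i, φ ⁅B j, B i⁆ = ⁅E j, E i⁆) (y : L) :
      φ ⁅B j, y⁆ = ⁅φ (B j), φ y⁆ :=
    LinearMap.congr_fun (B.ext fun i => by simpa [hφB] using h i :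
      φ ∘ₗ LieAlgebra.ad K L (B j) = LieAlgebra.ad K g (φ (B j)) ∘ₗ φ) y
  let f : L →ₗ⁅K⁆ g :=
    { φ with
      map_lie' := fun {x y} => map_lie_of_lieSpan_eq_top hB φ (by
        rintro x (rfl | rfl)
        exacts [map_lie_of_basis p hx, map_lie_of_basis q hy]) x y }
  have inj : Function.Injective f := by
    refine (injective_iff_map_eq_zero f).2 fun x hx => ?_
    have hx : B.constr K E x = 0 := hx
    rw [B.constr_apply] at hx
    exact (map_eq_zero_iff _ B.repr.injective).1 (linearIndependent_iff.1 hE _ hx)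
  have surj : f.range = ⊤ := by
    rw [eq_top_iff, ← hg, LieSubalgebra.lieSpan_le]
    rintro x (rfl | rfl)
    exacts [⟨B p, hφB p⟩, ⟨B q, hφB q⟩]
  exact ⟨(LieEquiv.ofBijective f ⟨inj, (LieHom.range_eq_top f).1 surj⟩).symm⟩

namespace LieConstants

/-- The vector with given coordinates in a Lie algebra given by structure constants. -/
def of (s : LieConstants K ι) : (ι →₀ K) ≃ₗ[K] s.Algebra :=
  LinearEquiv.refl K (ι →₀ K)

theorem of_single (s : LieConstants K ι) (i : ι) (t : K) :
    s.of (Finsupp.single i t) = t • s.e i := by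
  change s.of (Finsupp.single i t) = t • s.of (Finsupp.single i 1)
  rw [← map_smul, Finsupp.smul_single_one]

theorem lie_e_eq_of (s : LieConstants K ι) (i j : ι) : ⁅s.e i, s.e j⁆ = s.of (s.c i j) :=
  s.lie_e i j

/-- The basis of a Lie algebra given by structure constants. -/
def basis (s : LieConstants K ι) : Module.Basis ι K s.Algebra :=
  Module.Basis.ofRepr s.of.symm

theorem basis_apply (s : LieConstants K ι) (i : ι) : s.basis i = s.e i := rfl

theorem constr_lie (s : LieConstants K ι) (E : ι → g) (i j : ι) :
    s.basis.constr K E ⁅s.basis i, s.basis j⁆ = Finsupp.linearCombination K E (s.c i j) := by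
  rw [s.basis_apply, s.basis_apply, s.lie_e_eq_of, Module.Basis.constr_apply]
  rfl

end LieConstants

end Iso

section FiliformModel

section SuccPNat

theorem exists_eq_succPNat (n : ℕ+) : ∃ k : ℕ, n = k.succPNat :=
  ⟨n.natPred, n.succPNat_natPred.symm⟩

theorem one_eq_succPNat : (1 : ℕ+) = Nat.succPNat 0 := rfl

theorem two_eq_succPNat : (2 : ℕ+) = Nat.succPNat 1 := rfl

theorem succPNat_add (m n : ℕ) : m.succPNat + n.succPNat = (m + n + 1).succPNat :=
  PNat.eq (by simp only [PNat.add_coe, Nat.succPNat_coe]; omega)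

theorem succPNat_eq_one_iff (n : ℕ) : n.succPNat = 1 ↔ n = 0 := by
  rw [one_eq_succPNat, Nat.succPNat_inj]

end SuccPNat

section Algebras

variable (K : Type*) [Field K]

theorem m0_c_one (n : ℕ) : (m0 K).c 1 (n + 1).succPNat = Finsupp.single (n + 2).succPNat 1 := by
  simp only [m0, widthOne, m0Coeff_eq, if_true, succPNat_eq_one_iff]
  rw [one_eq_succPNat, succPNat_add, if_neg (by omega), show 0 + (n + 1) + 1 = n + 2 by omega]

theorem m0_c_two_one : (m0 K).c 2 1 = Finsupp.single (Nat.succPNat 2) (-1) := by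
  simp only [m0, widthOne, m0Coeff_eq]
  rfl

theorem m0_c_two (n : ℕ) : (m0 K).c 2 (n + 1).succPNat = 0 := by
  simp only [m0, widthOne, m0Coeff_eq, succPNat_eq_one_iff]
  rw [if_neg (by decide), if_neg (by omega), Finsupp.single_zero]

theorem m0_lieSpan_eq_top :
    LieSubalgebra.lieSpan K (m0 K).Algebra {(m0 K).basis 1, (m0 K).basis 2} = ⊤ := by
  set H := LieSubalgebra.lieSpan K (m0 K).Algebra {(m0 K).basis 1, (m0 K).basis 2}
  have h1 : (m0 K).e 1 ∈ H := LieSubalgebra.subset_lieSpan (by simp [LieConstants.basis_apply])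
  have h2 (k : ℕ) : (m0 K).e (k + 1).succPNat ∈ H := by
    induction k with
    | zero => exact LieSubalgebra.subset_lieSpan (Or.inr rfl)
    | succ k ih =>
      have := H.lie_mem h1 ih
      rwa [LieConstants.lie_e_eq_of, m0_c_one, LieConstants.of_single, one_smul] at this
  refine lieSpan_eq_top_of_basis (m0 K).basis fun n => ?_
  obtain ⟨_ | k, rfl⟩ := exists_eq_succPNat n
  exacts [h1, h2 k]

variable (S : OddSet)

theorem m0S_c_inl (i j : ℕ+) : (m0S K S).c (.inl i) (.inl j) =
    ((m0 K).c i j).mapDomain Sum.inl + (m0Cocycle K S i j).mapDomain Sum.inr := rfl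

theorem m0S_c_inr (i : ℕ+ ⊕ S.1) (r : S.1) : (m0S K S).c i (.inr r) = 0 := by
  cases i <;> rfl

theorem m0Cocycle_one_left (i : ℕ+) : m0Cocycle K S 1 i = 0 := by
  rw [m0Cocycle_skew, m0Cocycle_one_right, neg_zero]

theorem m0Cocycle_two {n : ℕ} (h : n + 2 ∈ S.1) :
    m0Cocycle K S 2 (n + 1).succPNat = Finsupp.single ⟨n + 2, h⟩ (-1) := by
  have h' : ((2 : ℕ+) : ℕ) + (n + 1).succPNat - 2 = n + 2 := by simp
  have hm : ((2 : ℕ+) : ℕ) + (n + 1).succPNat - 2 ∈ S.1 := h'.symm ▸ h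
  have h2 : 2 ≤ (n + 1).succPNat := by
    rw [two_eq_succPNat, Nat.succPNat_le_succPNat]
    omega
  refine (dif_pos ⟨le_rfl, h2, hm⟩).trans ?_
  rw [show (⟨_, hm⟩ : S.1) = ⟨n + 2, h⟩ from Subtype.ext h']
  simp [pow_succ]

theorem m0Cocycle_two_of_notMem {n : ℕ} (h : n + 2 ∉ S.1) :
    m0Cocycle K S 2 (n + 1).succPNat = 0 := by
  have h' : ((2 : ℕ+) : ℕ) + (n + 1).succPNat - 2 = n + 2 := by simp
  exact dif_neg fun h0 => h (h' ▸ h0.2.2)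

theorem m0S_lie_one (n : ℕ) :
    ⁅(m0S K S).e (.inl 1), (m0S K S).e (.inl (n + 1).succPNat)⁆ =
      (m0S K S).e (.inl (n + 2).succPNat) := by
  rw [LieConstants.lie_e_eq_of, m0S_c_inl, m0_c_one, m0Cocycle_one_left, Finsupp.mapDomain_single,
    Finsupp.mapDomain_zero, add_zero, LieConstants.of_single, one_smul]

theorem m0S_lie_two {n : ℕ} (h : n + 2 ∈ S.1) :
    ⁅(m0S K S).e (.inl 2), (m0S K S).e (.inl (n + 1).succPNat)⁆ =
      -(m0S K S).e (.inr ⟨n + 2, h⟩) := by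
  rw [LieConstants.lie_e_eq_of, m0S_c_inl, m0_c_two, m0Cocycle_two K S h, Finsupp.mapDomain_single,
    Finsupp.mapDomain_zero, zero_add, LieConstants.of_single, neg_smul, one_smul]

theorem m0S_lieSpan_eq_top : LieSubalgebra.lieSpan K (m0S K S).Algebra
    {(m0S K S).basis (.inl 1), (m0S K S).basis (.inl 2)} = ⊤ := by
  set H := LieSubalgebra.lieSpan K (m0S K S).Algebra
    {(m0S K S).basis (.inl 1), (m0S K S).basis (.inl 2)}
  have h1 : (m0S K S).e (.inl 1) ∈ H := LieSubalgebra.subset_lieSpan (Or.inl rfl)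
  have h2 : (m0S K S).e (.inl 2) ∈ H := LieSubalgebra.subset_lieSpan (Or.inr rfl)
  have hl (k : ℕ) : (m0S K S).e (.inl (k + 1).succPNat) ∈ H := by
    induction k with
    | zero => exact h2
    | succ k ih => exact m0S_lie_one K S k ▸ H.lie_mem h1 ih
  refine lieSpan_eq_top_of_basis (m0S K S).basis ?_
  rintro (n | ⟨r, hr⟩)
  · obtain ⟨_ | k, rfl⟩ := exists_eq_succPNat n
    exacts [h1, hl k]
  · obtain ⟨k, rfl⟩ : ∃ k, r = k + 2 := ⟨r - 2, by have := (S.2 r hr).2; omega⟩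
    exact neg_mem_iff.1 (m0S_lie_two K S hr ▸ H.lie_mem h2 (hl k))

end Algebras

variable {K : Type*} [Field K] {g : Type*} [LieRing g] [LieAlgebra K g]
variable {𝒜 : ℕ → Submodule K g} {a b : g} {T : Set ℕ}

/-- The degrees `r` of the nonzero vectors `[b, (ad a)^(r-2) b]`; if all of these vectors are
central, then this is the set `S` for which the Lie algebra is `m_0^S`. -/
def centralDegrees (a b : g) : Set ℕ := {r | 3 ≤ r ∧ ⁅b, chain a b (r - 2)⁆ ≠ 0}

theorem odd_of_mem_centralDegrees (h : ∀ n, CentralUpTo a b n) (r : ℕ)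
    (hr : r ∈ centralDegrees a b) : Odd r ∧ 3 ≤ r := by
  refine ⟨Nat.not_even_iff_odd.1 ?_, hr.1⟩
  rintro ⟨k, rfl⟩
  refine hr.2 ?_
  rw [show k + k - 2 = 2 * (k - 1) by omega]
  exact (h (2 * (k - 1))).lie_chain_even (by omega)

/-- The images of the basis vectors of `m_0^S`. -/
def filVec (a b : g) (T : Set ℕ) : ℕ+ ⊕ T → g
  | .inl n => Nat.casesOn n.natPred a (chain a b)
  | .inr r => -⁅b, chain a b (r - 2)⁆

/-- The degrees of the basis vectors of `m_0^S`: both `e_1` and `e_2` have degree one. -/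
def filDegree (T : Set ℕ) : ℕ+ ⊕ T → ℕ
  | .inl n => max 1 n.natPred
  | .inr r => r

theorem filVec_one (a b : g) (T : Set ℕ) : filVec a b T (.inl (Nat.succPNat 0)) = a := rfl

theorem filVec_succ (a b : g) (T : Set ℕ) (n : ℕ) :
    filVec a b T (.inl (Nat.succPNat (n + 1))) = chain a b n := rfl

theorem filVec_inr (a b : g) (T : Set ℕ) (r : T) :
    filVec a b T (.inr r) = -⁅b, chain a b (r - 2)⁆ := rfl

theorem filDegree_inl (T : Set ℕ) (n : ℕ) : filDegree T (.inl n.succPNat) = max 1 n := rfl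

theorem filDegree_inr (T : Set ℕ) (r : T) : filDegree T (.inr r) = r := rfl

theorem lie_right_filVec_eq_zero (hT : T ⊆ centralDegrees a b) {i : ℕ+ ⊕ T}
    (hi : i ≠ .inl (Nat.succPNat 0)) (hd : filDegree T i = 1) : ⁅b, filVec a b T i⁆ = 0 := by
  rcases i with m | ⟨r, hr⟩
  · obtain ⟨_ | l, rfl⟩ := exists_eq_succPNat m
    · exact absurd rfl hi
    · obtain rfl : l = 0 := by rw [filDegree_inl] at hd; omega
      exact lie_self b
  · have h3 := (hT hr).1
    have hd : r = 1 := hd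
    omega

theorem lie_left_filVec_eq_zero (h : ∀ n, CentralUpTo a b n) {i : ℕ+ ⊕ T} {k : ℕ}
    (hi : i ≠ .inl (Nat.succPNat (k + 1))) (hd : filDegree T i = k + 1) :
    ⁅a, filVec a b T i⁆ = 0 := by
  rcases i with m | r
  · obtain ⟨_ | l, rfl⟩ := exists_eq_succPNat m
    · exact lie_self a
    · obtain rfl : l = k := by rw [filDegree_inl] at hd; omega
      exact absurd rfl hi
  · rw [filVec_inr, lie_neg, (h _ _ le_rfl).1, neg_zero]

theorem filVec_mem_span {i : ℕ+ ⊕ T} {r : T} (hr : 3 ≤ (r : ℕ)) (hi : i ≠ .inr r)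
    (hd : filDegree T i = r) : filVec a b T i ∈ Submodule.span K {chain a b (r - 1)} := by
  rcases i with m | s
  · obtain ⟨_ | l, rfl⟩ := exists_eq_succPNat m
    all_goals rw [filDegree_inl] at hd
    · omega
    · rw [filVec_succ, show l = r - 1 by omega]
      exact Submodule.mem_span_singleton_self _
  · exact absurd (congrArg _ (Subtype.ext hd)) hi

namespace IsFrame

theorem chain_ne_zero (F : IsFrame 𝒜 a b) (h : ∀ n, CentralUpTo a b n) (n : ℕ) :
    chain a b n ≠ 0 := by
  intro h0
  have h1 : chain a b (n + 1) = 0 := by rw [chain_succ, h0, lie_zero]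
  refine F.not_le_span_singleton (n := n + 2) (by omega) (h n n le_rfl).1 (h n n le_rfl).2 ?_
  refine (F.le_span_chain (h n) (i := n) (by omega)).trans ?_
  rw [h1, Submodule.span_insert_zero]

theorem lie_chain_notMem_span (F : IsFrame 𝒜 a b) (h : ∀ n, CentralUpTo a b n) {n : ℕ}
    (hn : ⁅b, chain a b n⁆ ≠ 0) : ⁅b, chain a b n⁆ ∉ Submodule.span K {chain a b (n + 1)} := by
  intro hmem
  obtain ⟨t, ht⟩ := Submodule.mem_span_singleton.1 hmem
  have ht0 : t ≠ 0 := by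
    rintro rfl
    exact hn (by rw [← ht, zero_smul])
  have ha := (h n n le_rfl).1
  rw [← ht, lie_smul, ← chain_succ] at ha
  exact F.chain_ne_zero h _ ((smul_eq_zero_iff_right ht0).1 ha)

theorem filVec_mem [SetLike.GradedBracket 𝒜] (F : IsFrame 𝒜 a b) (hT : T ⊆ centralDegrees a b)
    (i : ℕ+ ⊕ T) : filVec a b T i ∈ 𝒜 (filDegree T i) := by
  rcases i with n | ⟨r, hr⟩
  · obtain ⟨_ | k, rfl⟩ := exists_eq_succPNat n
    · exact F.left_mem
    · rw [filDegree_inl, filVec_succ, max_eq_right (by omega)]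
      exact F.chain_mem k
  · have h3 := (hT hr).1
    have hmem := neg_mem (F.lie_right_mem (F.chain_mem (r - 2)))
    rwa [show r - 2 + 1 + 1 = r by omega] at hmem

theorem linearIndependent_filVec [GradedLieAlgebra 𝒜] (F : IsFrame 𝒜 a b)
    (h : ∀ n, CentralUpTo a b n) (hT : T ⊆ centralDegrees a b) :
    LinearIndependent K (filVec a b T) := by
  refine linearIndependent_of_homogeneous (F.filVec_mem hT) ?_
  rintro (n | r)
  · obtain ⟨_ | k, rfl⟩ := exists_eq_succPNat n
    · refine ⟨(LieAlgebra.ad K g b).ker, ?_, fun i hi hd => lie_right_filVec_eq_zero hT hi hd⟩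
      rw [LinearMap.mem_ker, filVec_one, LieAlgebra.ad_apply, ← lie_skew, neg_eq_zero]
      exact F.chain_ne_zero h 1
    · refine ⟨(LieAlgebra.ad K g a).ker, F.chain_ne_zero h (k + 1), fun i hi hd =>
        lie_left_filVec_eq_zero h hi (hd.trans ?_)⟩
      rw [filDegree_inl, max_eq_right (by omega)]
  · obtain ⟨h3, hr⟩ := hT r.2
    refine ⟨Submodule.span K {chain a b (r - 1)}, ?_, fun i hi hd => filVec_mem_span h3 hi hd⟩
    rw [filVec_inr, neg_mem_iff, show (r : ℕ) - 1 = r - 2 + 1 by omega]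
    exact F.lie_chain_notMem_span h hr

theorem nonempty_lieEquiv_m0 [GradedLieAlgebra 𝒜] (F : IsFrame 𝒜 a b)
    (h : ∀ n, CentralUpTo a b n) (hS : ¬ (centralDegrees a b).Nonempty) :
    Nonempty (g ≃ₗ⁅K⁆ (m0 K).Algebra) := by
  have hz (n : ℕ) : ⁅b, chain a b n⁆ = 0 := by
    rcases n with _ | n
    · exact lie_self b
    · by_contra h0
      exact hS ⟨n + 3, by omega, h0⟩
  refine nonempty_lieEquiv_of_lieSpan_eq_top (m0 K).basis (E := filVec a b ∅ ∘ Sum.inl) (p := 1)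
    (q := 2) (x := a) (y := b)
    ((F.linearIndependent_filVec h (Set.empty_subset _)).comp _ Sum.inl_injective) rfl rfl
    (m0_lieSpan_eq_top K) F.lieSpan_eq_top ?_ ?_
  · intro n
    rw [LieConstants.constr_lie, Function.comp_apply]
    obtain ⟨_ | k, rfl⟩ := exists_eq_succPNat n
    · rw [filVec_one, lie_self, ← one_eq_succPNat, (m0 K).c_self, map_zero]
    · rw [m0_c_one, Finsupp.linearCombination_single, one_smul, filVec_succ, Function.comp_apply,
        filVec_succ, chain_succ]
  · intro n
    rw [LieConstants.constr_lie, Function.comp_apply]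
    obtain ⟨_ | k, rfl⟩ := exists_eq_succPNat n
    · rw [← one_eq_succPNat, m0_c_two_one, Finsupp.linearCombination_single, neg_smul, one_smul,
        one_eq_succPNat, filVec_one, Function.comp_apply, filVec_succ, ← lie_skew]
      rfl
    · rw [m0_c_two, map_zero, filVec_succ, hz]

end IsFrame

section CentralOddSet

variable {S : OddSet}

theorem constr_m0S_lie_one (h : ∀ n, CentralUpTo a b n) (i : ℕ+ ⊕ S.1) :
    (m0S K S).basis.constr K (filVec a b S.1) ⁅(m0S K S).basis (.inl 1), (m0S K S).basis i⁆ =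
      ⁅a, filVec a b S.1 i⁆ := by
  rw [LieConstants.constr_lie]
  rcases i with n | r
  · rw [m0S_c_inl, m0Cocycle_one_left, Finsupp.mapDomain_zero, add_zero]
    obtain ⟨_ | k, rfl⟩ := exists_eq_succPNat n
    · rw [filVec_one, lie_self, ← one_eq_succPNat, (m0 K).c_self, Finsupp.mapDomain_zero, map_zero]
    · rw [m0_c_one, Finsupp.mapDomain_single, Finsupp.linearCombination_single, one_smul,
        filVec_succ, filVec_succ, chain_succ]
  · rw [m0S_c_inr, map_zero, filVec_inr, lie_neg, (h _ _ le_rfl).1, neg_zero]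

theorem constr_m0S_lie_two (h : ∀ n, CentralUpTo a b n) (hS : S.1 = centralDegrees a b)
    (i : ℕ+ ⊕ S.1) :
    (m0S K S).basis.constr K (filVec a b S.1) ⁅(m0S K S).basis (.inl 2), (m0S K S).basis i⁆ =
      ⁅b, filVec a b S.1 i⁆ := by
  rw [LieConstants.constr_lie]
  rcases i with n | r
  · rw [m0S_c_inl]
    obtain ⟨_ | k, rfl⟩ := exists_eq_succPNat n
    · rw [← one_eq_succPNat, m0Cocycle_one_right, Finsupp.mapDomain_zero, add_zero, m0_c_two_one,
        Finsupp.mapDomain_single, Finsupp.linearCombination_single, one_eq_succPNat, filVec_one,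
        filVec_succ, neg_smul, one_smul, ← lie_skew]
      rfl
    · rw [m0_c_two, Finsupp.mapDomain_zero, zero_add, filVec_succ]
      by_cases hk : k + 2 ∈ S.1
      · rw [m0Cocycle_two K S hk, Finsupp.mapDomain_single, Finsupp.linearCombination_single,
          neg_smul, one_smul, filVec_inr, neg_neg]
        rfl
      · rw [m0Cocycle_two_of_notMem K S hk, Finsupp.mapDomain_zero, map_zero]
        rcases k with _ | k
        · exact (lie_self b).symm
        · by_contra h0
          exact hk (hS ▸ ⟨by omega, fun h1 => h0 h1.symm⟩)
  · rw [m0S_c_inr, map_zero, filVec_inr, lie_neg, (h _ _ le_rfl).2, neg_zero]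

end CentralOddSet

theorem IsFrame.exists_lieEquiv_m0S [GradedLieAlgebra 𝒜] (F : IsFrame 𝒜 a b)
    (h : ∀ n, CentralUpTo a b n) :
    ∃ S : OddSet, S.1 = centralDegrees a b ∧ Nonempty (g ≃ₗ⁅K⁆ (m0S K S).Algebra) :=
  let S : OddSet := ⟨centralDegrees a b, odd_of_mem_centralDegrees h⟩
  ⟨S, rfl, nonempty_lieEquiv_of_lieSpan_eq_top (m0S K S).basis (E := filVec a b S.1)
    (p := .inl 1) (q := .inl 2) (F.linearIndependent_filVec h subset_rfl) rfl rfl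
    (m0S_lieSpan_eq_top K S) F.lieSpan_eq_top (constr_m0S_lie_one h) (constr_m0S_lie_two h rfl)⟩

end FiliformModel

section TwistedModel

section Coefficients

variable (K : Type*) [Field K]

/-- The coefficient of `e_{k+2}` in `[e_1, e_{k+1}]` in `n_2`. -/
def n2Left (k : ℕ) : K := (n2Table (res8 1) (res8 k.succPNat) : K)

/-- The coefficient of `e_{k+3}` in `[e_2, e_{k+1}]` in `n_2`. -/
def n2Right (k : ℕ) : K := (n2Table (res8 2) (res8 k.succPNat) : K)

theorem res8_succPNat (m : ℕ) (r : Fin 8) : res8 (8 * m + r : ℕ).succPNat = r + 1 := by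
  refine Fin.ext ?_
  simp only [res8, Fin.ofNat, Nat.succPNat_coe, Fin.val_add, Fin.val_one]
  omega

theorem n2Left_eq (m : ℕ) (r : Fin 8) :
    n2Left K (8 * m + r) = ((![0, 1, 1, -3, -2, 0, 1, -1] r : ℤ) : K) := by
  rw [n2Left, res8_succPNat]
  congr 1
  decide +revert

theorem n2Right_eq (m : ℕ) (r : Fin 8) :
    n2Right K (8 * m + r) = ((![-1, 0, 0, 0, 1, -1, 0, 2] r : ℤ) : K) := by
  rw [n2Right, res8_succPNat]
  congr 1
  decide +revert

theorem n2Right_two : n2Right K 2 = 0 := (n2Right_eq K 0 2).trans Int.cast_zero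

theorem exists_eq_eight_mul_add (k : ℕ) : ∃ (m : ℕ) (r : Fin 8), k = 8 * m + r :=
  ⟨k / 8, ⟨k % 8, Nat.mod_lt _ (by norm_num)⟩, (Nat.div_add_mod k 8).symm⟩

variable [CharZero K]

theorem n2Left_eq_zero_iff (k : ℕ) : n2Left K k = 0 ↔ k % 8 = 0 ∨ k % 8 = 5 := by
  obtain ⟨m, r, rfl⟩ := exists_eq_eight_mul_add k
  rw [n2Left_eq, Int.cast_eq_zero, Nat.mul_add_mod, Nat.mod_eq_of_lt r.2]
  decide +revert

theorem n2Right_eq_zero_iff (k : ℕ) :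
    n2Right K k = 0 ↔ k % 8 = 1 ∨ k % 8 = 2 ∨ k % 8 = 3 ∨ k % 8 = 6 := by
  obtain ⟨m, r, rfl⟩ := exists_eq_eight_mul_add k
  rw [n2Right_eq, Int.cast_eq_zero, Nat.mul_add_mod, Nat.mod_eq_of_lt r.2]
  decide +revert

end Coefficients

section Algebras

variable (K : Type*) [Field K]

theorem mem_lieSubalgebra_of_n2_relations [CharZero K] {L : Type*} [LieRing L] [LieAlgebra K L]
    {v : ℕ → L} (hl : ∀ k, ⁅v 0, v k⁆ = n2Left K k • v (k + 1))
    (hr : ∀ k, k ≠ 2 → ⁅v 1, v k⁆ = n2Right K k • v (k + 2)) {H : LieSubalgebra K L}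
    (h0 : v 0 ∈ H) (h1 : v 1 ∈ H) (k : ℕ) : v k ∈ H := by
  induction k using Nat.twoStepInduction with
  | zero => exact h0
  | one => exact h1
  | more k ihk ihk' =>
    by_cases hc : n2Left K (k + 1) = 0
    · rw [n2Left_eq_zero_iff] at hc
      have hc' : n2Right K k ≠ 0 := by
        rw [Ne, n2Right_eq_zero_iff]
        omega
      exact (H.smul_mem_iff hc').1 (hr k (by omega) ▸ H.lie_mem h1 ihk)
    · exact (H.smul_mem_iff hc).1 (hl (k + 1) ▸ H.lie_mem h0 ihk')

theorem n2_c_one (k : ℕ) :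
    (n2 K).c 1 k.succPNat = Finsupp.single (k + 1).succPNat (n2Left K k) := by
  simp only [n2, widthOne, n2Left]
  rw [one_eq_succPNat, succPNat_add, show 0 + k + 1 = k + 1 by omega]

theorem n2_c_two (k : ℕ) :
    (n2 K).c 2 k.succPNat = Finsupp.single (k + 2).succPNat (n2Right K k) := by
  simp only [n2, widthOne, n2Right]
  rw [two_eq_succPNat, succPNat_add, show 1 + k + 1 = k + 2 by omega]

theorem n2_lieSpan_eq_top [CharZero K] :
    LieSubalgebra.lieSpan K (n2 K).Algebra {(n2 K).basis 1, (n2 K).basis 2} = ⊤ := by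
  refine lieSpan_eq_top_of_basis (n2 K).basis fun n => ?_
  obtain ⟨k, rfl⟩ := exists_eq_succPNat n
  refine mem_lieSubalgebra_of_n2_relations K (v := fun k => (n2 K).e k.succPNat) (fun k => ?_)
    (fun k _ => ?_) (LieSubalgebra.subset_lieSpan (Or.inl rfl))
    (LieSubalgebra.subset_lieSpan (Or.inr rfl)) k
  · rw [← one_eq_succPNat, LieConstants.lie_e_eq_of, n2_c_one, LieConstants.of_single]
  · rw [← two_eq_succPNat, LieConstants.lie_e_eq_of, n2_c_two, LieConstants.of_single]

theorem n23_c_inl (i j : ℕ+) : (n23 K).c (.inl i) (.inl j) =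
    ((n2 K).c i j).mapDomain Sum.inl + (n2Cocycle K i j).mapDomain Sum.inr := rfl

theorem n23_c_inr (i : ℕ+ ⊕ Unit) (t : Unit) : (n23 K).c i (.inr t) = 0 := by
  cases i <;> rfl

theorem n2Cocycle_one (i : ℕ+) : n2Cocycle K 1 i = 0 := by
  rw [n2Cocycle, if_neg fun h => absurd h.1 (by decide), if_neg fun h => absurd h.1 (by decide)]

theorem n2Cocycle_two {k : ℕ} (hk : k ≠ 2) : n2Cocycle K 2 k.succPNat = 0 := by
  rw [n2Cocycle, if_neg, if_neg fun h => absurd h.1 (by decide)]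
  rintro ⟨-, h⟩
  exact hk (Nat.succPNat_inj.1 (h.trans (show (3 : ℕ+) = Nat.succPNat 2 from rfl)))

theorem n23_c_one (k : ℕ) : (n23 K).c (.inl 1) (.inl k.succPNat) =
    Finsupp.single (.inl (k + 1).succPNat) (n2Left K k) := by
  rw [n23_c_inl, n2_c_one, n2Cocycle_one, Finsupp.mapDomain_single, Finsupp.mapDomain_zero,
    add_zero]

theorem n23_c_two {k : ℕ} (hk : k ≠ 2) : (n23 K).c (.inl 2) (.inl k.succPNat) =
    Finsupp.single (.inl (k + 2).succPNat) (n2Right K k) := by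
  rw [n23_c_inl, n2_c_two, n2Cocycle_two K hk, Finsupp.mapDomain_single, Finsupp.mapDomain_zero,
    add_zero]

theorem n23_c_two_three : (n23 K).c (.inl 2) (.inl (Nat.succPNat 2)) =
    Finsupp.single (.inr ()) 1 := by
  have h : n2Cocycle K 2 (Nat.succPNat 2) = Finsupp.single () 1 := if_pos ⟨rfl, rfl⟩
  rw [n23_c_inl, n2_c_two, h, n2Right_two, Finsupp.single_zero, Finsupp.mapDomain_single,
    Finsupp.mapDomain_zero, zero_add]

theorem n23_lieSpan_eq_top [CharZero K] : LieSubalgebra.lieSpan K (n23 K).Algebra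
    {(n23 K).basis (.inl 1), (n23 K).basis (.inl 2)} = ⊤ := by
  set H := LieSubalgebra.lieSpan K (n23 K).Algebra
    {(n23 K).basis (.inl 1), (n23 K).basis (.inl 2)}
  have h1 : (n23 K).e (.inl 1) ∈ H := LieSubalgebra.subset_lieSpan (Or.inl rfl)
  have h2 : (n23 K).e (.inl 2) ∈ H := LieSubalgebra.subset_lieSpan (Or.inr rfl)
  have hl (k : ℕ) : (n23 K).e (.inl k.succPNat) ∈ H := by
    refine mem_lieSubalgebra_of_n2_relations K (v := fun k => (n23 K).e (.inl k.succPNat))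
      (fun k => ?_) (fun k hk => ?_) h1 h2 k
    · rw [← one_eq_succPNat, LieConstants.lie_e_eq_of, n23_c_one, LieConstants.of_single]
    · rw [← two_eq_succPNat, LieConstants.lie_e_eq_of, n23_c_two K hk, LieConstants.of_single]
  refine lieSpan_eq_top_of_basis (n23 K).basis ?_
  rintro (n | _)
  · obtain ⟨k, rfl⟩ := exists_eq_succPNat n
    exact hl k
  · have hz := H.lie_mem h2 (hl 2)
    rwa [LieConstants.lie_e_eq_of, n23_c_two_three, LieConstants.of_single, one_smul] at hz

end Algebras

section BlockDegree

/-- The degrees of the basis vectors `e_1, e_2, …` of `n_2`, numbered from zero. -/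
def blockDegree (k : ℕ) : ℕ := 6 * (k / 8) + 1 + blockOffset (Fin.ofNat 8 k)

theorem div_and_ofNat_eight_mul_add (m : ℕ) (r : Fin 8) :
    (8 * m + (r : ℕ)) / 8 = m ∧ Fin.ofNat 8 (8 * m + r) = r :=
  ⟨by omega, Fin.ext (by simp only [Fin.ofNat]; omega)⟩

theorem blockDegree_eq (m : ℕ) (r : Fin 8) :
    blockDegree (8 * m + r) = 6 * m + 1 + blockOffset r := by
  rw [blockDegree, (div_and_ofNat_eight_mul_add m r).1, (div_and_ofNat_eight_mul_add m r).2]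

theorem mod_eight_of_blockDegree_eq {k l : ℕ} (hkl : k ≠ l)
    (h : blockDegree k = blockDegree l) :
    l % 8 = 0 ∧ k % 8 = 1 ∨ l % 8 = 1 ∧ k % 8 = 0 ∨ l % 8 = 5 ∧ k % 8 = 6 ∨
      l % 8 = 6 ∧ k % 8 = 5 := by
  obtain ⟨m, r, rfl⟩ := exists_eq_eight_mul_add k
  obtain ⟨n, s, rfl⟩ := exists_eq_eight_mul_add l
  have le_five (r : Fin 8) : blockOffset r ≤ 5 := by decide +revert
  have := le_five r
  have := le_five s
  rw [blockDegree_eq, blockDegree_eq] at h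
  obtain rfl : m = n := by omega
  have hrs : r ≠ s := fun h => hkl (by rw [h])
  have hoff : blockOffset r = blockOffset s := by omega
  rw [Nat.mul_add_mod, Nat.mul_add_mod, Nat.mod_eq_of_lt r.2, Nat.mod_eq_of_lt s.2]
  clear * - hrs hoff
  decide +revert

end BlockDegree

variable {K : Type*} [Field K] {g : Type*} [LieRing g] [LieAlgebra K g]
variable {𝒜 : ℕ → Submodule K g} {a b : g}

variable (K) in
/-- The images of the basis vectors `e_1, e_2, …` of `n_2`, numbered from zero. -/
def blockSeq (a b : g) (k : ℕ) : g := blocks K a b (k / 8) (Fin.ofNat 8 k)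

theorem blockSeq_eq (a b : g) (m : ℕ) (r : Fin 8) :
    blockSeq K a b (8 * m + r) = blocks K a b m r := by
  rw [blockSeq, (div_and_ofNat_eight_mul_add m r).1, (div_and_ofNat_eight_mul_add m r).2]

variable (K) in
/-- The images of the basis vectors of `n_2` (for empty `T`) and of `n_2^3` (for `T` with one
element, which stands for the central vector `z`). -/
def twistVec (a b : g) (T : Type) : ℕ+ ⊕ T → g
  | .inl n => blockSeq K a b n.natPred
  | .inr _ => ⁅b, ⁅a, b⁆⁆

/-- The degrees of the vectors `twistVec`. -/
def twistDegree (T : Type) : ℕ+ ⊕ T → ℕ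
  | .inl n => blockDegree n.natPred
  | .inr _ => 3

theorem twistVec_inl (a b : g) (T : Type) (k : ℕ) :
    twistVec K a b T (.inl k.succPNat) = blockSeq K a b k := rfl

namespace IsFrame

theorem twistVec_mem [SetLike.GradedBracket 𝒜] (F : IsFrame 𝒜 a b) {T : Type} (i : ℕ+ ⊕ T) :
    twistVec K a b T i ∈ 𝒜 (twistDegree T i) := by
  rcases i with n | _
  · exact F.blocks_mem _ _
  · exact F.lie_right_mem (F.lie_left_mem F.right_mem)

variable [CharZero K] [GradedLieAlgebra 𝒜]

theorem lie_left_blockSeq (F : IsFrame 𝒜 a b) (h : CentralUpTo a b 2) (h5 : chain a b 5 = 0)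
    (k : ℕ) : ⁅a, blockSeq K a b k⁆ = n2Left K k • blockSeq K a b (k + 1) := by
  obtain ⟨m, r, rfl⟩ := exists_eq_eight_mul_add k
  have hB := (F.isBlock_blocks_and_span h h5 m).1
  have seq (s : Fin 8) : blockSeq K a b (8 * m + s) = blocks K a b m s := blockSeq_eq a b m s
  have seq_next : blockSeq K a b (8 * m + 8) = blocks K a b (m + 1) 0 := blockSeq_eq a b (m + 1) 0
  rw [seq, n2Left_eq]
  fin_cases r
  · simpa using hB.a0
  · simpa [← seq] using hB.a1
  · simpa [← seq] using hB.a2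
  · simpa [← seq] using hB.a3
  · simpa [← seq] using hB.a4
  · simpa using hB.a5
  · simpa [← seq] using hB.a6
  · simpa [seq_next] using lie_left_blocks_seven (K := K) a b m

theorem lie_right_blockSeq (F : IsFrame 𝒜 a b) (h : CentralUpTo a b 2) (h5 : chain a b 5 = 0)
    {k : ℕ} (hk : k ≠ 2) : ⁅b, blockSeq K a b k⁆ = n2Right K k • blockSeq K a b (k + 2) := by
  obtain ⟨m, r, rfl⟩ := exists_eq_eight_mul_add k
  have hB := (F.isBlock_blocks_and_span h h5 m).1
  have seq (s : Fin 8) : blockSeq K a b (8 * m + s) = blocks K a b m s := blockSeq_eq a b m s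
  have seq_next : blockSeq K a b (8 * m + 9) = blocks K a b (m + 1) 1 := blockSeq_eq a b (m + 1) 1
  rw [seq, n2Right_eq]
  fin_cases r
  · simpa [← seq] using hB.b0
  · simpa using hB.b1
  · obtain ⟨m, rfl⟩ : ∃ l, m = l + 1 := ⟨m - 1, by simp at hk; omega⟩
    simpa using F.lie_blocks_succ_two h h5 m
  · simpa using hB.b3
  · simpa [← seq] using hB.b4
  · simpa [← seq] using hB.b5
  · simpa using hB.b6
  · simpa [seq_next] using lie_right_blocks_seven (K := K) a b m

theorem blockSeq_ne_zero (F : IsFrame 𝒜 a b) (h : CentralUpTo a b 2) (h5 : chain a b 5 = 0)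
    (k : ℕ) : blockSeq K a b k ≠ 0 :=
  F.blocks_ne_zero h h5 _ _

theorem lie_left_blockSeq_eq_zero_iff (F : IsFrame 𝒜 a b) (h : CentralUpTo a b 2)
    (h5 : chain a b 5 = 0) (k : ℕ) : ⁅a, blockSeq K a b k⁆ = 0 ↔ k % 8 = 0 ∨ k % 8 = 5 := by
  rw [F.lie_left_blockSeq h h5, smul_eq_zero_iff_left (F.blockSeq_ne_zero h h5 _),
    n2Left_eq_zero_iff]

theorem lie_right_blockSeq_eq_zero_iff (F : IsFrame 𝒜 a b) (h : CentralUpTo a b 2)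
    (h5 : chain a b 5 = 0) {k : ℕ} (hk : k ≠ 2) :
    ⁅b, blockSeq K a b k⁆ = 0 ↔ k % 8 = 1 ∨ k % 8 = 2 ∨ k % 8 = 3 ∨ k % 8 = 6 := by
  rw [F.lie_right_blockSeq h h5 hk, smul_eq_zero_iff_left (F.blockSeq_ne_zero h h5 _),
    n2Right_eq_zero_iff]

theorem lie_lie_notMem_span (F : IsFrame 𝒜 a b) (h : CentralUpTo a b 2) (h5 : chain a b 5 = 0)
    (hz : ⁅b, ⁅a, b⁆⁆ ≠ 0) : ⁅b, ⁅a, b⁆⁆ ∉ Submodule.span K {blockSeq K a b 3} := by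
  intro hmem
  obtain ⟨t, ht⟩ := Submodule.mem_span_singleton.1 hmem
  have ht0 : t ≠ 0 := by
    rintro rfl
    exact hz (by rw [← ht, zero_smul])
  have ha : ⁅a, ⁅b, ⁅a, b⁆⁆⁆ = 0 := (h 1 one_le_two).1
  rw [← ht, lie_smul, smul_eq_zero_iff_right ht0, F.lie_left_blockSeq_eq_zero_iff h h5] at ha
  omega

section Separation

variable {T : Type} {i : ℕ+ ⊕ T} {k : ℕ}

theorem lie_right_twistVec_eq_zero (F : IsFrame 𝒜 a b) (h : CentralUpTo a b 2)
    (h5 : chain a b 5 = 0) (hk : k % 8 = 0 ∨ k % 8 = 5) (hi : i ≠ .inl k.succPNat)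
    (hd : twistDegree T i = blockDegree k) : ⁅b, twistVec K a b T i⁆ = 0 := by
  rcases i with n | t
  · obtain ⟨l, rfl⟩ := exists_eq_succPNat n
    have := mod_eight_of_blockDegree_eq (k := l) (fun hlk => hi (by rw [hlk])) hd
    rw [twistVec_inl, F.lie_right_blockSeq_eq_zero_iff h h5 (by omega)]
    omega
  · exact (h 1 one_le_two).2

theorem lie_left_twistVec_eq_zero (F : IsFrame 𝒜 a b) (h : CentralUpTo a b 2)
    (h5 : chain a b 5 = 0) (hk : ¬ (k % 8 = 0 ∨ k % 8 = 5)) (hi : i ≠ .inl k.succPNat)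
    (hd : twistDegree T i = blockDegree k) : ⁅a, twistVec K a b T i⁆ = 0 := by
  rcases i with n | t
  · obtain ⟨l, rfl⟩ := exists_eq_succPNat n
    have := mod_eight_of_blockDegree_eq (k := l) (fun hlk => hi (by rw [hlk])) hd
    rw [twistVec_inl, F.lie_left_blockSeq_eq_zero_iff h h5]
    omega
  · exact (h 1 one_le_two).1

end Separation

theorem linearIndependent_twistVec (F : IsFrame 𝒜 a b) (h : CentralUpTo a b 2)
    (h5 : chain a b 5 = 0) {T : Type} [Subsingleton T] (hT : T → ⁅b, ⁅a, b⁆⁆ ≠ 0) :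
    LinearIndependent K (twistVec K a b T) := by
  refine linearIndependent_of_homogeneous F.twistVec_mem ?_
  rintro (n | t)
  · obtain ⟨k, rfl⟩ := exists_eq_succPNat n
    by_cases hk : k % 8 = 0 ∨ k % 8 = 5
    · refine ⟨(LieAlgebra.ad K g b).ker, ?_,
        fun i hi hd => F.lie_right_twistVec_eq_zero h h5 hk hi hd⟩
      rw [twistVec_inl, LinearMap.mem_ker, LieAlgebra.ad_apply,
        F.lie_right_blockSeq_eq_zero_iff h h5 (by omega)]
      omega
    · refine ⟨(LieAlgebra.ad K g a).ker, ?_,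
        fun i hi hd => F.lie_left_twistVec_eq_zero h h5 hk hi hd⟩
      rwa [twistVec_inl, LinearMap.mem_ker, LieAlgebra.ad_apply,
        F.lie_left_blockSeq_eq_zero_iff h h5]
  · refine ⟨Submodule.span K {blockSeq K a b 3}, F.lie_lie_notMem_span h h5 (hT t), ?_⟩
    rintro (n | t') hn hd
    · obtain ⟨l, rfl⟩ := exists_eq_succPNat n
      obtain rfl : l = 3 := by
        by_contra hl
        have := mod_eight_of_blockDegree_eq (l := 3) hl hd
        omega
      exact Submodule.mem_span_singleton_self _
    · exact absurd (congrArg Sum.inr (Subsingleton.elim t' t)) hn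

theorem nonempty_lieEquiv_n2 (F : IsFrame 𝒜 a b) (h : CentralUpTo a b 2)
    (h5 : chain a b 5 = 0) (hz : ⁅b, ⁅a, b⁆⁆ = 0) : Nonempty (g ≃ₗ⁅K⁆ (n2 K).Algebra) := by
  refine nonempty_lieEquiv_of_lieSpan_eq_top (n2 K).basis (E := twistVec K a b Empty ∘ Sum.inl)
    (p := 1) (q := 2) (x := a) (y := b)
    ((F.linearIndependent_twistVec h h5 Empty.elim).comp Sum.inl Sum.inl_injective) rfl rfl
    (n2_lieSpan_eq_top K) F.lieSpan_eq_top ?_ ?_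
  · intro n
    obtain ⟨k, rfl⟩ := exists_eq_succPNat n
    rw [LieConstants.constr_lie, n2_c_one, Finsupp.linearCombination_single, Function.comp_apply,
      Function.comp_apply, twistVec_inl, twistVec_inl, F.lie_left_blockSeq h h5]
  · intro n
    obtain ⟨k, rfl⟩ := exists_eq_succPNat n
    rw [LieConstants.constr_lie, n2_c_two, Finsupp.linearCombination_single, Function.comp_apply,
      Function.comp_apply, twistVec_inl, twistVec_inl]
    obtain rfl | hk := eq_or_ne k 2
    · rw [n2Right_two, zero_smul]
      exact hz.symm
    · rw [F.lie_right_blockSeq h h5 hk]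

theorem nonempty_lieEquiv_n23 (F : IsFrame 𝒜 a b) (h : CentralUpTo a b 2)
    (h5 : chain a b 5 = 0) (hz : ⁅b, ⁅a, b⁆⁆ ≠ 0) : Nonempty (g ≃ₗ⁅K⁆ (n23 K).Algebra) := by
  refine nonempty_lieEquiv_of_lieSpan_eq_top (n23 K).basis (E := twistVec K a b Unit)
    (p := .inl 1) (q := .inl 2) (x := a) (y := b)
    (F.linearIndependent_twistVec h h5 fun _ => hz) rfl rfl (n23_lieSpan_eq_top K)
    F.lieSpan_eq_top ?_ ?_
  · rintro (n | t)
    · obtain ⟨k, rfl⟩ := exists_eq_succPNat n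
      rw [LieConstants.constr_lie, n23_c_one, Finsupp.linearCombination_single, twistVec_inl,
        twistVec_inl, F.lie_left_blockSeq h h5]
    · rw [LieConstants.constr_lie, n23_c_inr, map_zero]
      exact (h 1 one_le_two).1.symm
  · rintro (n | t)
    · obtain ⟨k, rfl⟩ := exists_eq_succPNat n
      obtain rfl | hk := eq_or_ne k 2
      · rw [LieConstants.constr_lie, n23_c_two_three, Finsupp.linearCombination_single, one_smul]
        rfl
      · rw [LieConstants.constr_lie, n23_c_two K hk, Finsupp.linearCombination_single,
          twistVec_inl, twistVec_inl, F.lie_right_blockSeq h h5 hk]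
    · rw [LieConstants.constr_lie, n23_c_inr, map_zero]
      exact (h 1 one_le_two).2.symm

end IsFrame

end TwistedModel

section LoopModel

variable {K : Type*} [Field K]

section Basis

variable (ε : K)

/-- The basis `u, v, w`. -/
def uvwBasis : Module.Basis (Fin 3) K (UVW ε) := Pi.basisFun K (Fin 3)

theorem uvwBasis_zero : uvwBasis ε 0 = UVW.u ε := by
  refine (Pi.basisFun_apply K (Fin 3) 0).trans (funext fun i => ?_)
  fin_cases i <;> rfl

theorem uvwBasis_one : uvwBasis ε 1 = UVW.v ε := by
  refine (Pi.basisFun_apply K (Fin 3) 1).trans (funext fun i => ?_)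
  fin_cases i <;> rfl

theorem uvwBasis_two : uvwBasis ε 2 = UVW.w ε := by
  refine (Pi.basisFun_apply K (Fin 3) 2).trans (funext fun i => ?_)
  fin_cases i <;> rfl

/-- The monomials `u ⊗ t^(2k+1)`, `v ⊗ t^(2k+1)`, `w ⊗ t^(2k+2)`, indexed by `k` and the position
of the vector in the basis `u, v, w`. -/
def n1Mon (p : ℕ × Fin 3) : K[X] ⊗[K] UVW ε :=
  (Polynomial.X ^ (2 * p.1 + 1 + loopOffset p.2) : K[X]) ⊗ₜ[K] uvwBasis ε p.2

theorem range_n1Mon : Set.range (n1Mon ε) = n1Monomials ε := by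
  have h0 (k : ℕ) : n1Mon ε (k, 0) = (Polynomial.X ^ (2 * k + 1) : K[X]) ⊗ₜ[K] UVW.u ε :=
    congrArg _ (uvwBasis_zero ε)
  have h1 (k : ℕ) : n1Mon ε (k, 1) = (Polynomial.X ^ (2 * k + 1) : K[X]) ⊗ₜ[K] UVW.v ε :=
    congrArg _ (uvwBasis_one ε)
  have h2 (k : ℕ) : n1Mon ε (k, 2) = (Polynomial.X ^ (2 * k + 2) : K[X]) ⊗ₜ[K] UVW.w ε :=
    congrArg _ (uvwBasis_two ε)
  apply Set.Subset.antisymm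
  · rintro _ ⟨⟨k, i⟩, rfl⟩
    refine ⟨k, ?_⟩
    fin_cases i
    exacts [Or.inl (h0 k), Or.inr (Or.inl (h1 k)), Or.inr (Or.inr (h2 k))]
  · rintro x ⟨k, rfl | rfl | rfl⟩
    exacts [⟨(k, 0), h0 k⟩, ⟨(k, 1), h1 k⟩, ⟨(k, 2), h2 k⟩]

theorem linearIndependent_n1Mon : LinearIndependent K (n1Mon ε) := by
  set f : ℕ × Fin 3 → ℕ × Fin 3 := fun p => (2 * p.1 + 1 + loopOffset p.2, p.2)
  have inj : Function.Injective f := by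
    rintro ⟨k, i⟩ ⟨l, j⟩ h
    obtain ⟨h, rfl⟩ := Prod.mk.inj h
    exact Prod.ext (by simpa using h) rfl
  have hf : n1Mon ε = (Polynomial.basisMonomials K).tensorProduct (uvwBasis ε) ∘ f := by
    funext p
    rw [Function.comp_apply, Module.Basis.tensorProduct_apply, Polynomial.coe_basisMonomials, n1Mon,
      Polynomial.X_pow_eq_monomial]
  rw [hf]
  exact ((Polynomial.basisMonomials K).tensorProduct (uvwBasis ε)).linearIndependent.comp f inj

/-- The basis of `n_1` consisting of the monomials `n1Mon ε`. -/
def n1Basis : Module.Basis (ℕ × Fin 3) K (n1 ε) :=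
  (Module.Basis.span (linearIndependent_n1Mon ε)).map
    (LinearEquiv.ofEq _ (n1 ε).toSubmodule (congrArg (Submodule.span K) (range_n1Mon ε)))

theorem coe_n1Basis (p : ℕ × Fin 3) : (n1Basis ε p : K[X] ⊗[K] UVW ε) = n1Mon ε p :=
  congrArg Subtype.val (Module.Basis.span_apply (linearIndependent_n1Mon ε) p)

variable {ε} in
theorem n1Basis_lie {k l m : ℕ} {i j h : Fin 3} {t : K}
    (hd : 2 * k + 1 + loopOffset i + (2 * l + 1 + loopOffset j) = 2 * m + 1 + loopOffset h)
    (ht : ⁅uvwBasis ε i, uvwBasis ε j⁆ = t • uvwBasis ε h) :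
    ⁅n1Basis ε (k, i), n1Basis ε (l, j)⁆ = t • n1Basis ε (m, h) := by
  apply Subtype.ext
  rw [LieSubalgebra.coe_bracket, SetLike.val_smul, coe_n1Basis, coe_n1Basis, coe_n1Basis,
    n1Mon, n1Mon, n1Mon, LieAlgebra.ExtendScalars.bracket_tmul, ← pow_add, hd, ht,
    TensorProduct.tmul_smul]

theorem n1Basis_lie_self (k l : ℕ) (i : Fin 3) : ⁅n1Basis ε (k, i), n1Basis ε (l, i)⁆ = 0 := by
  apply Subtype.ext
  rw [LieSubalgebra.coe_bracket, coe_n1Basis, coe_n1Basis, n1Mon, n1Mon,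
    LieAlgebra.ExtendScalars.bracket_tmul, lie_self, TensorProduct.tmul_zero, ZeroMemClass.coe_zero]

theorem n1Basis_lie_zero_one (k l : ℕ) :
    ⁅n1Basis ε (k, 0), n1Basis ε (l, 1)⁆ = n1Basis ε (k + l, 2) := by
  refine (n1Basis_lie (t := 1) ?_ ?_).trans (one_smul K _)
  · change 2 * k + 1 + (2 * l + 1) = 2 * (k + l) + 2
    omega
  · rw [uvwBasis_zero, uvwBasis_one, uvwBasis_two, UVW.lie_u_v, one_smul]

theorem n1Basis_lie_one_two (k l : ℕ) :
    ⁅n1Basis ε (k, 1), n1Basis ε (l, 2)⁆ = ε • n1Basis ε (k + l + 1, 0) := by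
  refine n1Basis_lie ?_ ?_
  · change 2 * k + 1 + (2 * l + 2) = 2 * (k + l + 1) + 1
    omega
  · rw [uvwBasis_zero, uvwBasis_one, uvwBasis_two, UVW.lie_v_w]

theorem n1Basis_lie_two_zero (k l : ℕ) :
    ⁅n1Basis ε (k, 2), n1Basis ε (l, 0)⁆ = n1Basis ε (k + l + 1, 1) := by
  refine (n1Basis_lie (t := 1) ?_ ?_).trans (one_smul K _)
  · change 2 * k + 2 + (2 * l + 1) = 2 * (k + l + 1) + 1
    omega
  · rw [uvwBasis_zero, uvwBasis_one, uvwBasis_two, UVW.lie_w_u, one_smul]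

theorem n1Basis_lie_one_zero (k l : ℕ) :
    ⁅n1Basis ε (k, 1), n1Basis ε (l, 0)⁆ = -n1Basis ε (k + l, 2) := by
  rw [← lie_skew, n1Basis_lie_zero_one, add_comm l k]

theorem n1Basis_lie_zero_two (k l : ℕ) :
    ⁅n1Basis ε (k, 0), n1Basis ε (l, 2)⁆ = -n1Basis ε (k + l + 1, 1) := by
  rw [← lie_skew, n1Basis_lie_two_zero, add_comm l k]

end Basis

variable {ε : K}

theorem n1_lieSpan_eq_top (hε : ε ≠ 0) :
    LieSubalgebra.lieSpan K (n1 ε) {n1Basis ε (0, 0), n1Basis ε (0, 1)} = ⊤ := by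
  set H := LieSubalgebra.lieSpan K (n1 ε) {n1Basis ε (0, 0), n1Basis ε (0, 1)}
  have h0 : n1Basis ε (0, 0) ∈ H := LieSubalgebra.subset_lieSpan (by simp)
  have h1 : n1Basis ε (0, 1) ∈ H := LieSubalgebra.subset_lieSpan (by simp)
  have mem_two {k : ℕ} (hk : n1Basis ε (k, 1) ∈ H) : n1Basis ε (k, 2) ∈ H := by
    simpa only [n1Basis_lie_zero_one, zero_add] using H.lie_mem h0 hk
  have mem (k : ℕ) : n1Basis ε (k, 0) ∈ H ∧ n1Basis ε (k, 1) ∈ H := by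
    induction k with
    | zero => exact ⟨h0, h1⟩
    | succ k ih =>
      have h02 := H.lie_mem h0 (mem_two ih.2)
      have h12 := H.smul_mem ε⁻¹ (H.lie_mem h1 (mem_two ih.2))
      rw [n1Basis_lie_zero_two, zero_add, neg_mem_iff] at h02
      rw [n1Basis_lie_one_two, inv_smul_smul₀ hε, zero_add] at h12
      exact ⟨h12, h02⟩
  refine lieSpan_eq_top_of_basis (n1Basis ε) ?_
  rintro ⟨k, i⟩
  fin_cases i
  exacts [(mem k).1, (mem k).2, mem_two (mem k).2]

variable {g : Type*} [LieRing g] [LieAlgebra K g] {𝒜 : ℕ → Submodule K g} {a b : g}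

theorem constr_n1_lie_left {e : ℕ → Fin 3 → g} (h : ∀ k, IsLoop a b (e k))
    (ha : ∀ k, ⁅a, e k 2⁆ = -e (k + 1) 1) (p : ℕ × Fin 3) :
    (n1Basis ε).constr K (fun p => e p.1 p.2) ⁅n1Basis ε (0, 0), n1Basis ε p⁆ = ⁅a, e p.1 p.2⁆ := by
  obtain ⟨k, i⟩ := p
  match i with
  | 0 => rw [n1Basis_lie_self, map_zero, (h k).a0]
  | 1 => rw [n1Basis_lie_zero_one, zero_add, Module.Basis.constr_basis, (h k).a1]
  | 2 => rw [n1Basis_lie_zero_two, zero_add, map_neg, Module.Basis.constr_basis, ha k]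

theorem constr_n1_lie_right {e : ℕ → Fin 3 → g} (h : ∀ k, IsLoop a b (e k))
    (hb : ∀ k, ⁅b, e k 2⁆ = ε • e (k + 1) 0) (p : ℕ × Fin 3) :
    (n1Basis ε).constr K (fun p => e p.1 p.2) ⁅n1Basis ε (0, 1), n1Basis ε p⁆ = ⁅b, e p.1 p.2⁆ := by
  obtain ⟨k, i⟩ := p
  match i with
  | 0 => rw [n1Basis_lie_one_zero, zero_add, map_neg, Module.Basis.constr_basis, (h k).b0]
  | 1 => rw [n1Basis_lie_self, map_zero, (h k).b1]
  | 2 => rw [n1Basis_lie_one_two, zero_add, map_smul, Module.Basis.constr_basis, hb k]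

theorem nonempty_lieEquiv_n1_of_loops {e : ℕ → Fin 3 → g} (hε : ε ≠ 0)
    (he : LinearIndependent K fun p : ℕ × Fin 3 => e p.1 p.2)
    (hg : LieSubalgebra.lieSpan K g {e 0 0, e 0 1} = ⊤) (h : ∀ k, IsLoop (e 0 0) (e 0 1) (e k))
    (ha : ∀ k, ⁅e 0 0, e k 2⁆ = -e (k + 1) 1) (hb : ∀ k, ⁅e 0 1, e k 2⁆ = ε • e (k + 1) 0) :
    Nonempty (g ≃ₗ⁅K⁆ n1 ε) :=
  nonempty_lieEquiv_of_lieSpan_eq_top (n1Basis ε) he (p := (0, 0)) (q := (0, 1)) rfl rfl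
    (n1_lieSpan_eq_top hε) hg (constr_n1_lie_left h ha) (constr_n1_lie_right h hb)

theorem nonempty_n1_lieEquiv_n1 {ε' β : K} (hε : ε ≠ 0) (h : ε = β ^ 2 * ε') :
    Nonempty (n1 ε' ≃ₗ⁅K⁆ n1 ε) := by
  have hβ : β ≠ 0 := by
    rintro rfl
    exact hε (by rw [h, zero_pow two_ne_zero, zero_mul])
  have hε' : ε' ≠ 0 := by
    rintro rfl
    exact hε (by rw [h, mul_zero])
  let w : Fin 3 → Kˣ := ![1, Units.mk0 β hβ, Units.mk0 β hβ]
  let e (k : ℕ) (i : Fin 3) : n1 ε' := (w i : K) • n1Basis ε' (k, i)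
  have e0 (k : ℕ) : e k 0 = n1Basis ε' (k, 0) := one_smul K _
  have e1 (k : ℕ) : e k 1 = β • n1Basis ε' (k, 1) := rfl
  have e2 (k : ℕ) : e k 2 = β • n1Basis ε' (k, 2) := rfl
  refine nonempty_lieEquiv_n1_of_loops (e := e) hε
    ((n1Basis ε').linearIndependent.units_smul fun p => w p.2) ?_ (fun k => ⟨?_, ?_, ?_, ?_⟩)
    (fun k => ?_) fun k => ?_
  · rw [eq_top_iff, ← n1_lieSpan_eq_top hε', LieSubalgebra.lieSpan_le]
    rintro _ (rfl | rfl)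
    · exact LieSubalgebra.subset_lieSpan (by simp [e0])
    · rw [← inv_smul_smul₀ hβ (n1Basis ε' (0, 1)), ← e1]
      exact LieSubalgebra.smul_mem _ _ (LieSubalgebra.subset_lieSpan (by simp))
  · rw [e0, e0, n1Basis_lie_self]
  · rw [e0, e1, e2, lie_smul, n1Basis_lie_zero_one, zero_add]
  · rw [e1, e0, e2, smul_lie, n1Basis_lie_one_zero, zero_add, smul_neg]
  · rw [e1, e1, smul_lie, lie_smul, n1Basis_lie_self, smul_zero, smul_zero]
  · rw [e0, e2, e1, lie_smul, n1Basis_lie_zero_two, zero_add, smul_neg]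
  · rw [e1, e2, e0, smul_lie, lie_smul, n1Basis_lie_one_two, zero_add, smul_smul, smul_smul, h,
      pow_two]

variable [CharZero K]

namespace IsFrame

theorem loops_two_ne_zero [SetLike.GradedBracket 𝒜] (F : IsFrame 𝒜 a b) (hε : ε ≠ 0)
    (hab : ⁅a, ⁅b, ⁅a, b⁆⁆⁆ = 0) (hbb : ⁅b, ⁅b, ⁅a, b⁆⁆⁆ = ε • ⁅a, ⁅a, ⁅a, b⁆⁆⁆) (k : ℕ) :
    loops ε a b k 2 ≠ 0 := fun h0 => by
  have hs := (F.isLoop_loops_and_span hε hab hbb k).1.2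
  rw [h0, Submodule.span_zero_singleton] at hs
  exact F.ne_bot (2 * k + 2) (by omega) (le_bot_iff.1 hs)

theorem linearIndependent_loops [GradedLieAlgebra 𝒜] (F : IsFrame 𝒜 a b) (hε : ε ≠ 0)
    (hab : ⁅a, ⁅b, ⁅a, b⁆⁆⁆ = 0) (hbb : ⁅b, ⁅b, ⁅a, b⁆⁆⁆ = ε • ⁅a, ⁅a, ⁅a, b⁆⁆⁆) :
    LinearIndependent K fun p : ℕ × Fin 3 => loops ε a b p.1 p.2 := by
  have hL := F.isLoop_loops hε hab hbb
  have hW := F.loops_two_ne_zero hε hab hbb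
  refine linearIndependent_of_homogeneous (fun p => F.loops_mem p.1 p.2) ?_
  have h0 : loopOffset 0 = 0 := rfl
  have h1 : loopOffset 1 = 0 := rfl
  have h2 : loopOffset 2 = 1 := rfl
  rintro ⟨k, i⟩
  match i with
  | 0 =>
    refine ⟨(LieAlgebra.ad K g b).ker, ?_, ?_⟩
    · simpa [(hL k).b0] using hW k
    · rintro ⟨l, j⟩ hn hd
      match j with
      | 0 => grind
      | 1 => exact (hL l).b1
      | 2 => grind
  | 1 =>
    refine ⟨(LieAlgebra.ad K g a).ker, ?_, ?_⟩
    · simpa [(hL k).a1] using hW k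
    · rintro ⟨l, j⟩ hn hd
      match j with
      | 0 => exact (hL l).a0
      | 1 => grind
      | 2 => grind
  | 2 =>
    refine ⟨⊥, by simpa using hW k, ?_⟩
    rintro ⟨l, j⟩ hn hd
    match j with
    | 0 => grind
    | 1 => grind
    | 2 => grind

theorem nonempty_lieEquiv_n1 [GradedLieAlgebra 𝒜] (F : IsFrame 𝒜 a b) (hε : ε ≠ 0)
    (hab : ⁅a, ⁅b, ⁅a, b⁆⁆⁆ = 0) (hbb : ⁅b, ⁅b, ⁅a, b⁆⁆⁆ = ε • ⁅a, ⁅a, ⁅a, b⁆⁆⁆) :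
    Nonempty (g ≃ₗ⁅K⁆ n1 ε) :=
  nonempty_lieEquiv_n1_of_loops hε (F.linearIndependent_loops hε hab hbb) F.lieSpan_eq_top
    (F.isLoop_loops hε hab hbb) (fun _ => lie_left_eq_neg_nextLoop ε a b _)
    fun _ => lie_right_eq_smul_nextLoop hε a b _

end IsFrame

theorem centralUpTo_one (hab : ⁅a, ⁅b, ⁅a, b⁆⁆⁆ = 0) (hbb : ⁅b, ⁅b, ⁅a, b⁆⁆⁆ = 0) :
    CentralUpTo a b 1 := by
  rintro (_ | _ | m) hm
  · simp [chain_zero]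
  · exact ⟨hab, hbb⟩
  · omega

theorem IsNarrow.classification [GradedLieAlgebra 𝒜] (h : IsNarrow 𝒜)
    (hinf : ¬ FiniteDimensional K g) :
    (∃ ε : K, ε ≠ 0 ∧ Nonempty (g ≃ₗ⁅K⁆ n1 ε)) ∨ Nonempty (g ≃ₗ⁅K⁆ (n2 K).Algebra) ∨
      Nonempty (g ≃ₗ⁅K⁆ (n23 K).Algebra) ∨ Nonempty (g ≃ₗ⁅K⁆ (m0 K).Algebra) ∨
      ∃ S : OddSet, S.1.Nonempty ∧ Nonempty (g ≃ₗ⁅K⁆ (m0S K S).Algebra) := by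
  obtain ⟨a, b, F⟩ := h.exists_isFrame hinf
  obtain ⟨a, b, ε, F, hab, hbb⟩ := F.exists_diagonal
  by_cases hε : ε = 0
  · right
    rcases F.centralUpTo_or (centralUpTo_one hab (by rw [hbb, hε, zero_smul])) with
      hall | ⟨a, F, h2, h5⟩
    · right; right
      by_cases hS : (centralDegrees a b).Nonempty
      · obtain ⟨S, hS', e⟩ := F.exists_lieEquiv_m0S hall
        exact Or.inr ⟨S, hS' ▸ hS, e⟩
      · exact Or.inl (F.nonempty_lieEquiv_m0 hall hS)
    · by_cases hz : ⁅b, ⁅a, b⁆⁆ = 0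
      · exact Or.inl (F.nonempty_lieEquiv_n2 h2 h5 hz)
      · exact Or.inr (Or.inl (F.nonempty_lieEquiv_n23 h2 h5 hz))
  · exact Or.inl ⟨ε, hε, F.nonempty_lieEquiv_n1 hε hab hbb⟩

end LoopModel

section Invariants

section Laws

variable (L : Type*) [LieRing L]

/-- The second derived algebra is central. This law singles out `m_0` and the `m_0^S`. -/
def IsMetaCentral : Prop := ∀ x y z u v : L, ⁅x, ⁅⁅y, z⁆, ⁅u, v⁆⁆⁆ = 0

/-- A law of the cross product: both `[x, y]` and `[x, z]` are orthogonal to `x`, so their bracket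
is proportional to `x`. It tells `n_1^±` from `n_2` and `n_2^3`. -/
def IsCrossLike : Prop := ∀ x y z : L, ⁅x, ⁅⁅x, y⁆, ⁅x, z⁆⁆⁆ = 0

/-- No `ad x` has a nontrivial Jordan block for the eigenvalue zero. This law tells `n_1^+` from
`n_1^-`. -/
def IsAnisotropic : Prop := ∀ x y : L, ⁅x, ⁅x, y⁆⁆ = 0 → ⁅x, y⁆ = 0

end Laws

variable {K : Type*} [CommRing K] {L M : Type*} [LieRing L] [LieAlgebra K L]
variable [LieRing M] [LieAlgebra K M]

theorem IsMetaCentral.isCrossLike (h : IsMetaCentral L) : IsCrossLike L :=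
  fun x y z => h x x y x z

theorem IsMetaCentral.of_injective {f : L →ₗ⁅K⁆ M} (hf : Function.Injective f)
    (h : IsMetaCentral M) : IsMetaCentral L := fun x y z u v => hf <| by
  simp only [LieHom.map_lie, map_zero]
  exact h _ _ _ _ _

theorem isMetaCentral_congr (e : L ≃ₗ⁅K⁆ M) : IsMetaCentral L ↔ IsMetaCentral M :=
  ⟨.of_injective (f := e.symm.toLieHom) e.symm.injective, .of_injective e.injective⟩

theorem IsCrossLike.of_homs {ι : Type*} {f : ι → L →ₗ⁅K⁆ M}
    (hf : ∀ x, (∀ i, f i x = 0) → x = 0) (h : IsCrossLike M) : IsCrossLike L :=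
  fun x y z => hf _ fun i => by
    simp only [LieHom.map_lie]
    exact h _ _ _

theorem IsCrossLike.of_surjective {f : L →ₗ⁅K⁆ M} (hf : Function.Surjective f)
    (h : IsCrossLike L) : IsCrossLike M := fun x y z => by
  obtain ⟨x, rfl⟩ := hf x
  obtain ⟨y, rfl⟩ := hf y
  obtain ⟨z, rfl⟩ := hf z
  simp only [← LieHom.map_lie, h x y z, map_zero]

theorem isCrossLike_congr (e : L ≃ₗ⁅K⁆ M) : IsCrossLike L ↔ IsCrossLike M :=
  ⟨.of_surjective (f := e.toLieHom) e.surjective,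
    .of_surjective (f := e.symm.toLieHom) e.symm.surjective⟩

theorem IsAnisotropic.of_homs {ι : Type*} {f : ι → L →ₗ⁅K⁆ M}
    (hf : ∀ x, (∀ i, f i x = 0) → x = 0) (h : IsAnisotropic M) : IsAnisotropic L :=
  fun x y hxy => hf _ fun i => by
    rw [LieHom.map_lie]
    exact h _ _ (by rw [← LieHom.map_lie, ← LieHom.map_lie, hxy, map_zero])

theorem isAnisotropic_congr (e : L ≃ₗ⁅K⁆ M) : IsAnisotropic L ↔ IsAnisotropic M :=
  ⟨.of_homs (f := fun _ : Unit => e.symm.toLieHom) fun x h => by simpa using h (),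
    .of_homs (f := fun _ : Unit => e.toLieHom) fun x h => by simpa using h ()⟩

theorem map_mem_center {f : L →ₗ⁅K⁆ M} (hf : Function.Surjective f) {x : L}
    (hx : x ∈ LieAlgebra.center K L) : f x ∈ LieAlgebra.center K M := fun y => by
  obtain ⟨y, rfl⟩ := hf y
  rw [← LieHom.map_lie, hx y, map_zero]

theorem map_mem_lowerCentralSeries (f : L →ₗ⁅K⁆ M) {n : ℕ} {x : L}
    (hx : x ∈ LieModule.lowerCentralSeries K L L n) :
    f x ∈ LieModule.lowerCentralSeries K M M n :=
  LieIdeal.map_lowerCentralSeries_le n (LieIdeal.mem_map hx)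

theorem center_eq_bot_of_lieEquiv (e : L ≃ₗ⁅K⁆ M) (h : LieAlgebra.center K M = ⊥) :
    LieAlgebra.center K L = ⊥ :=
  (LieSubmodule.eq_bot_iff _).2 fun x hx => by
    have hex : e x ∈ LieAlgebra.center K M := map_mem_center (f := e.toLieHom) e.surjective hx
    rw [h, LieSubmodule.mem_bot] at hex
    exact e.injective (hex.trans (map_zero e.toLieHom).symm)

theorem center_eq_bot_congr (e : L ≃ₗ⁅K⁆ M) :
    LieAlgebra.center K L = ⊥ ↔ LieAlgebra.center K M = ⊥ :=
  ⟨center_eq_bot_of_lieEquiv e.symm, center_eq_bot_of_lieEquiv e⟩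

variable (K L) in
/-- The `r ≥ 1` for which a central element lies in the `r`-th term of the lower central series,
but not in the next one; the terms are counted from one here, but from zero in
`LieModule.lowerCentralSeries`. -/
def centralSteps : Set ℕ :=
  {r | ∃ x ∈ LieAlgebra.center K L, x ∈ LieModule.lowerCentralSeries K L L (r - 1) ∧
    x ∉ LieModule.lowerCentralSeries K L L r}

theorem centralSteps_subset_of_lieEquiv (e : L ≃ₗ⁅K⁆ M) :
    centralSteps K L ⊆ centralSteps K M := by
  rintro r ⟨x, hx, hmem, hnot⟩
  refine ⟨e x, map_mem_center (f := e.toLieHom) e.surjective hx,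
    map_mem_lowerCentralSeries e.toLieHom hmem, fun h => hnot ?_⟩
  simpa using map_mem_lowerCentralSeries e.symm.toLieHom h

theorem centralSteps_congr (e : L ≃ₗ⁅K⁆ M) : centralSteps K L = centralSteps K M :=
  (centralSteps_subset_of_lieEquiv e).antisymm (centralSteps_subset_of_lieEquiv e.symm)

end Invariants

section Loop

variable {K : Type*} [Field K] {ε : K}

/-- Evaluation of polynomial loops at `t`. These homomorphisms transport the laws of `UVW ε` to the
loop algebra. -/
def loopEval (ε t : K) : K[X] ⊗[K] UVW ε →ₗ⁅K⁆ UVW ε where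
  toLinearMap := TensorProduct.lift (LinearMap.lsmul K (UVW ε) ∘ₗ Polynomial.leval t)
  map_lie' {x y} := by
    set f := TensorProduct.lift (LinearMap.lsmul K (UVW ε) ∘ₗ Polynomial.leval t)
    have f_tmul (p : K[X]) (v : UVW ε) : f (p ⊗ₜ[K] v) = p.eval t • v := rfl
    change f ⁅x, y⁆ = ⁅f x, f y⁆
    induction x using TensorProduct.induction_on with
    | zero => exact (congrArg f (zero_lie y)).trans (by simp)
    | add x x' hx hx' =>
      exact (congrArg f (add_lie x x' y)).trans (by rw [map_add, map_add, add_lie, hx, hx'])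
    | tmul p v =>
      induction y using TensorProduct.induction_on with
      | zero => exact (congrArg f (lie_zero (p ⊗ₜ[K] v))).trans (by simp)
      | add y y' hy hy' =>
        exact (congrArg f (lie_add (p ⊗ₜ[K] v) y y')).trans
          (by rw [map_add, map_add, lie_add, hy, hy'])
      | tmul q w =>
        rw [LieAlgebra.ExtendScalars.bracket_tmul, f_tmul, f_tmul, f_tmul, smul_lie, lie_smul,
          smul_smul, Polynomial.eval_mul]

theorem loopEval_tmul (t : K) (p : K[X]) (v : UVW ε) :
    loopEval ε t (p ⊗ₜ[K] v) = p.eval t • v := rfl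

theorem repr_loopEval (t : K) (x : K[X] ⊗[K] UVW ε) (i : Fin 3) :
    (uvwBasis ε).repr (loopEval ε t x) i =
      ((Algebra.TensorProduct.basis K[X] (uvwBasis ε)).repr x i).eval t := by
  induction x using TensorProduct.induction_on with
  | zero => simp
  | add x y hx hy => simp [hx, hy]
  | tmul p v => simp [loopEval_tmul]

theorem eq_zero_of_loopEval [Infinite K] {x : K[X] ⊗[K] UVW ε} (h : ∀ t, loopEval ε t x = 0) :
    x = 0 :=
  (Algebra.TensorProduct.basis K[X] (uvwBasis ε)).ext_elem fun i => Polynomial.funext fun t => by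
    rw [← repr_loopEval, h, map_zero, map_zero, Finsupp.zero_apply, Finsupp.zero_apply,
      Polynomial.eval_zero]

theorem eq_zero_of_loopEval_coe [Infinite K] (x : n1 ε)
    (h : ∀ t, (loopEval ε t).comp (n1 ε).incl x = 0) : x = 0 :=
  Subtype.ext (eq_zero_of_loopEval h)

theorem cross_cross_cross (ε : K) (x y z : Fin 3 → K) :
    cross ε x (cross ε (cross ε x y) (cross ε x z)) = 0 := by
  ext i
  fin_cases i <;> simp only [cross, Fin.zero_eta, Fin.mk_one, Fin.reduceFinMk, Matrix.cons_val,
    Pi.zero_apply] <;> ring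

theorem isCrossLike_n1 [Infinite K] (ε : K) : IsCrossLike (n1 ε) :=
  .of_homs eq_zero_of_loopEval_coe fun x y z => cross_cross_cross ε x y z

theorem cross_dotProduct_self (x y : Fin 3 → K) :
    cross 1 x y ⬝ᵥ cross 1 x y = -(y ⬝ᵥ cross 1 x (cross 1 x y)) := by
  simp [cross, Fin.sum_univ_three, dotProduct]
  ring

theorem eq_zero_of_cross_cross [LinearOrder K] [IsStrictOrderedRing K] (x y : Fin 3 → K)
    (h : cross 1 x (cross 1 x y) = 0) : cross 1 x y = 0 :=
  dotProduct_self_eq_zero.1 <| by rw [cross_dotProduct_self, h, dotProduct_zero, neg_zero]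

theorem isAnisotropic_n1 [LinearOrder K] [IsStrictOrderedRing K] : IsAnisotropic (n1 (1 : K)) :=
  have := IsStrictOrderedRing.toCharZero (R := K)
  .of_homs eq_zero_of_loopEval_coe fun x y => eq_zero_of_cross_cross x y

theorem not_isAnisotropic_n1 : ¬ IsAnisotropic (n1 (-1 : K)) := by
  let u (k : ℕ) := n1Basis (-1 : K) (k, 0)
  let v (k : ℕ) := n1Basis (-1 : K) (k, 1)
  let w (k : ℕ) := n1Basis (-1 : K) (k, 2)
  intro h
  have lie_w : ⁅u 0 + v 0, w 0⁆ = -(u 1 + v 1) := by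
    rw [add_lie, n1Basis_lie_zero_two, n1Basis_lie_one_two]
    module
  have lie_lie_w : ⁅u 0 + v 0, ⁅u 0 + v 0, w 0⁆⁆ = 0 := by
    rw [lie_w, lie_neg, lie_add, add_lie, add_lie, n1Basis_lie_self, n1Basis_lie_self,
      n1Basis_lie_zero_one, n1Basis_lie_one_zero]
    module
  have huv : u 1 + v 1 = 0 := by rw [← neg_eq_zero, ← lie_w, h _ _ lie_lie_w]
  have hw : ⁅u 0, u 1 + v 1⁆ = w 1 := by
    rw [lie_add, n1Basis_lie_self, n1Basis_lie_zero_one, zero_add, zero_add]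
  exact (n1Basis (-1 : K)).ne_zero (1, 2) (hw.symm.trans (by rw [huv, lie_zero]))

theorem not_isMetaCentral_n1 (hε : ε ≠ 0) : ¬ IsMetaCentral (n1 ε) := by
  intro h
  have h' := h (n1Basis ε (0, 1)) (n1Basis ε (0, 2)) (n1Basis ε (0, 0)) (n1Basis ε (0, 0))
    (n1Basis ε (0, 1))
  rw [n1Basis_lie_two_zero, n1Basis_lie_zero_one, n1Basis_lie_one_two, lie_smul,
    n1Basis_lie_one_zero, smul_neg, neg_eq_zero] at h'
  exact smul_ne_zero hε ((n1Basis ε).ne_zero _) h'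

end Loop

section CentralExtension

variable {K : Type*} [Field K] {ι : Type*}

theorem map_lie_of_basis {L M : Type*} [LieRing L] [LieAlgebra K L] [LieRing M] [LieAlgebra K M]
    (B : Module.Basis ι K L) {f : L →ₗ[K] M} (h : ∀ i j, f ⁅B i, B j⁆ = ⁅f (B i), f (B j)⁆)
    (x y : L) : f ⁅x, y⁆ = ⁅f x, f y⁆ :=
  LinearMap.congr_fun₂ (LinearMap.ext_basis B B h :
    (LieModule.toEnd K L L : L →ₗ[K] L →ₗ[K] L).compr₂ f =
      (LieModule.toEnd K M M : M →ₗ[K] M →ₗ[K] M).compl₁₂ f f) x y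

theorem mem_center_of_lie_basis {L : Type*} [LieRing L] [LieAlgebra K L] (B : Module.Basis ι K L)
    {x : L} (h : ∀ i, ⁅B i, x⁆ = 0) : x ∈ LieAlgebra.center K L := fun y =>
  LinearMap.congr_fun (B.ext h : (LieModule.toEnd K L L : L →ₗ[K] L →ₗ[K] L).flip x = 0) y

namespace LieConstants

variable {κ : Type*} {s : LieConstants K ι} {ω : ι → ι → (κ →₀ K)} {ω_self : ∀ i, ω i i = 0}
  {ω_skew : ∀ i j, ω i j = -ω j i}
  {cocycle : ∀ i j k, bilin ω (s.c i j) (Finsupp.single k 1)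
    + bilin ω (s.c j k) (Finsupp.single i 1) + bilin ω (s.c k i) (Finsupp.single j 1) = 0}

theorem basis_inr_mem_center (k : κ) :
    (s.centralExt ω ω_self ω_skew cocycle).basis (.inr k) ∈
      LieAlgebra.center K (s.centralExt ω ω_self ω_skew cocycle).Algebra :=
  mem_center_of_lie_basis (s.centralExt ω ω_self ω_skew cocycle).basis fun i => by
    cases i <;> exact lie_e_eq_of _ _ _

variable (s ω ω_self ω_skew cocycle) in
/-- The projection of a central extension onto the algebra that it extends. -/
def centralExtProj : (s.centralExt ω ω_self ω_skew cocycle).Algebra →ₗ⁅K⁆ s.Algebra where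
  toLinearMap := (s.centralExt ω ω_self ω_skew cocycle).basis.constr K (Sum.elim s.basis 0)
  map_lie' {x y} := by
    refine map_lie_of_basis (s.centralExt ω ω_self ω_skew cocycle).basis (fun i j => ?_) x y
    rw [constr_lie, Module.Basis.constr_basis, Module.Basis.constr_basis]
    rcases i with i | i <;> rcases j with j | j
    · change Finsupp.linearCombination K _
        ((s.c i j).mapDomain Sum.inl + (ω i j).mapDomain Sum.inr) = ⁅s.basis i, s.basis j⁆
      rw [map_add, Finsupp.linearCombination_mapDomain, Finsupp.linearCombination_mapDomain,
        Sum.elim_comp_inl, Sum.elim_comp_inr, Finsupp.linearCombination_zero, LinearMap.zero_apply,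
        add_zero, ← constr_lie]
      exact LinearMap.congr_fun (s.basis.constr_self K LinearMap.id) _
    · exact (map_zero _).trans (lie_zero _).symm
    · exact (map_zero _).trans (zero_lie _).symm
    · exact (map_zero _).trans (zero_lie _).symm

theorem centralExtProj_basis (i : ι ⊕ κ) :
    centralExtProj s ω ω_self ω_skew cocycle
      ((s.centralExt ω ω_self ω_skew cocycle).basis i) = Sum.elim s.basis 0 i :=
  Module.Basis.constr_basis _ _ _ _

theorem centralExtProj_surjective :
    Function.Surjective (centralExtProj s ω ω_self ω_skew cocycle) := by
  rw [← LieHom.range_eq_top, ← LieSubalgebra.toSubmodule_inj, LieSubalgebra.top_toSubmodule,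
    eq_top_iff, ← s.basis.span_eq, Submodule.span_le]
  rintro _ ⟨i, rfl⟩
  exact ⟨_, centralExtProj_basis (.inl i)⟩

theorem repr_centralExtProj (x : (s.centralExt ω ω_self ω_skew cocycle).Algebra) (i : ι) :
    s.basis.repr (centralExtProj s ω ω_self ω_skew cocycle x) i =
      (s.centralExt ω ω_self ω_skew cocycle).basis.repr x (.inl i) := by
  refine LinearMap.congr_fun ((s.centralExt ω ω_self ω_skew cocycle).basis.ext fun j => ?_ :
    s.basis.coord i ∘ₗ (centralExtProj s ω ω_self ω_skew cocycle).toLinearMap =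
      (s.centralExt ω ω_self ω_skew cocycle).basis.coord (.inl i)) x
  rw [LinearMap.comp_apply, LieHom.coe_toLinearMap, centralExtProj_basis]
  rcases j with j | j
  · simp [Finsupp.single_apply_left Sum.inl_injective]
  · simp

theorem mem_center_of_centralExtProj_eq_zero
    {x : (s.centralExt ω ω_self ω_skew cocycle).Algebra}
    (hx : centralExtProj s ω ω_self ω_skew cocycle x = 0) :
    x ∈ LieAlgebra.center K (s.centralExt ω ω_self ω_skew cocycle).Algebra := by
  rw [← (s.centralExt ω ω_self ω_skew cocycle).basis.linearCombination_repr x,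
    Finsupp.linearCombination_apply]
  refine sum_mem fun i hi => Submodule.smul_mem _ _ ?_
  rcases i with i | k
  · refine absurd ?_ (Finsupp.mem_support_iff.1 hi)
    rw [← repr_centralExtProj, hx, map_zero, Finsupp.zero_apply]
  · exact basis_inr_mem_center k

theorem isMetaCentral_centralExt (hs : ∀ x y z u : s.Algebra, ⁅⁅x, y⁆, ⁅z, u⁆⁆ = 0) :
    IsMetaCentral (s.centralExt ω ω_self ω_skew cocycle).Algebra := fun x y z u v =>
  mem_center_of_centralExtProj_eq_zero (by simp only [LieHom.map_lie, hs]) x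

theorem center_centralExt_ne_bot [Nonempty κ] :
    LieAlgebra.center K (s.centralExt ω ω_self ω_skew cocycle).Algebra ≠ ⊥ := fun h =>
  (s.centralExt ω ω_self ω_skew cocycle).basis.ne_zero (.inr (Classical.arbitrary κ))
    ((LieSubmodule.mem_bot _).1 (h ▸ basis_inr_mem_center _))

theorem repr_inl_eq_zero_of_mem_center (hs : LieAlgebra.center K s.Algebra = ⊥)
    {x : (s.centralExt ω ω_self ω_skew cocycle).Algebra}
    (hx : x ∈ LieAlgebra.center K (s.centralExt ω ω_self ω_skew cocycle).Algebra) (i : ι) :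
    (s.centralExt ω ω_self ω_skew cocycle).basis.repr x (.inl i) = 0 := by
  have hπ := map_mem_center (f := centralExtProj s ω ω_self ω_skew cocycle)
    centralExtProj_surjective hx
  rw [hs, LieSubmodule.mem_bot] at hπ
  rw [← repr_centralExtProj, hπ, map_zero, Finsupp.zero_apply]

theorem centralExt_c_inl_inl_apply_inl (i j k : ι) :
    (s.centralExt ω ω_self ω_skew cocycle).c (.inl i) (.inl j) (.inl k) = s.c i j k := by
  simp [centralExt, Finsupp.mapDomain_apply Sum.inl_injective,
    Finsupp.mapDomain_of_notMem_range]

theorem centralExt_c_inl_inl_apply_inr (i j : ι) (k : κ) :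
    (s.centralExt ω ω_self ω_skew cocycle).c (.inl i) (.inl j) (.inr k) = ω i j k := by
  simp [centralExt, Finsupp.mapDomain_apply Sum.inr_injective,
    Finsupp.mapDomain_of_notMem_range]

end LieConstants

end CentralExtension

section WidthOne

variable {K : Type*} [Field K] {s : LieConstants K ℕ+} {a : ℕ+ → ℕ+ → K}

theorem LieConstants.lie_basis_of_widthOne (hs : ∀ i j, s.c i j = Finsupp.single (i + j) (a i j))
    (i j : ℕ+) : ⁅s.basis i, s.basis j⁆ = a i j • s.basis (i + j) :=
  (s.lie_e_eq_of i j).trans (by rw [hs]; exact s.of_single _ _)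

theorem LieConstants.repr_lie_of_widthOne (hs : ∀ i j, s.c i j = Finsupp.single (i + j) (a i j))
    (i j : ℕ+) (x : s.Algebra) :
    s.basis.repr ⁅s.basis i, x⁆ (i + j) = a i j * s.basis.repr x j := by
  refine LinearMap.congr_fun (s.basis.ext fun k => ?_ : s.basis.coord (i + j) ∘ₗ
    LieModule.toEnd K s.Algebra s.Algebra (s.basis i) = a i j • s.basis.coord j) x
  by_cases hk : k = j
  · simp [lie_basis_of_widthOne hs, hk]
  · simp [lie_basis_of_widthOne hs, hk]

theorem LieConstants.center_eq_bot_of_widthOne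
    (hs : ∀ i j, s.c i j = Finsupp.single (i + j) (a i j)) (ha : ∀ j, ∃ i, a i j ≠ 0) :
    LieAlgebra.center K s.Algebra = ⊥ := by
  refine (LieSubmodule.eq_bot_iff _).2 fun x hx => s.basis.ext_elem fun j => ?_
  obtain ⟨i, hi⟩ := ha j
  have hij := repr_lie_of_widthOne hs i j x
  rw [hx, map_zero, Finsupp.zero_apply] at hij
  rw [map_zero, Finsupp.zero_apply]
  exact (mul_eq_zero.1 hij.symm).resolve_left hi

end WidthOne

section FiliformInvariants

variable (K : Type*) [Field K]

theorem m0_lie_basis (i j : ℕ+) :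
    ⁅(m0 K).basis i, (m0 K).basis j⁆ = m0Coeff K i j • (m0 K).basis (i + j) :=
  LieConstants.lie_basis_of_widthOne (fun _ _ => rfl) i j

theorem m0_repr_lie_one (x y : (m0 K).Algebra) : (m0 K).basis.repr ⁅x, y⁆ 1 = 0 := by
  refine LinearMap.congr_fun₂ (LinearMap.ext_basis (m0 K).basis (m0 K).basis fun i j => ?_ :
    (LieModule.toEnd K (m0 K).Algebra (m0 K).Algebra :
      (m0 K).Algebra →ₗ[K] (m0 K).Algebra →ₗ[K] (m0 K).Algebra).compr₂ ((m0 K).basis.coord 1) = 0)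
    x y
  simp [m0_lie_basis, add_ne_one]

theorem m0_lie_eq (x y : (m0 K).Algebra) :
    ⁅x, y⁆ = (m0 K).basis.repr x 1 • ⁅(m0 K).basis 1, y⁆ -
      (m0 K).basis.repr y 1 • ⁅(m0 K).basis 1, x⁆ := by
  set f : (m0 K).Algebra →ₗ[K] (m0 K).Algebra →ₗ[K] (m0 K).Algebra :=
    ((m0 K).basis.coord 1).smulRight (LieModule.toEnd K (m0 K).Algebra (m0 K).Algebra
      ((m0 K).basis 1))
  refine LinearMap.congr_fun₂ (LinearMap.ext_basis (m0 K).basis (m0 K).basis fun i j => ?_ :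
    (LieModule.toEnd K (m0 K).Algebra (m0 K).Algebra :
      (m0 K).Algebra →ₗ[K] (m0 K).Algebra →ₗ[K] (m0 K).Algebra) = f - f.flip) x y
  by_cases hi : i = 1 <;> by_cases hj : j = 1 <;>
    simp [f, hi, hj, m0_lie_basis, m0Coeff_eq, add_comm]

theorem m0_lie_lie_lie (x y z u : (m0 K).Algebra) : ⁅⁅x, y⁆, ⁅z, u⁆⁆ = 0 := by
  rw [m0_lie_eq, m0_repr_lie_one, m0_repr_lie_one, zero_smul, zero_smul, sub_zero]

theorem isMetaCentral_m0 : IsMetaCentral (m0 K).Algebra := fun x y z u v => by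
  rw [m0_lie_lie_lie, lie_zero]

theorem center_m0_eq_bot : LieAlgebra.center K (m0 K).Algebra = ⊥ := by
  refine LieConstants.center_eq_bot_of_widthOne (fun _ _ => rfl) fun j => ?_
  by_cases hj : j = 1
  · exact ⟨2, by simp [hj, m0Coeff_eq]⟩
  · exact ⟨1, by simp [hj, m0Coeff_eq]⟩

variable (S : OddSet)

theorem isMetaCentral_m0S : IsMetaCentral (m0S K S).Algebra :=
  LieConstants.isMetaCentral_centralExt (m0_lie_lie_lie K)

theorem center_m0S_ne_bot (hS : S.1.Nonempty) : LieAlgebra.center K (m0S K S).Algebra ≠ ⊥ :=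
  have := hS.to_subtype
  LieConstants.center_centralExt_ne_bot

end FiliformInvariants

section PeriodicInvariants

variable (K : Type*) [Field K]

theorem n2_lie_basis (i j : ℕ+) : ⁅(n2 K).basis i, (n2 K).basis j⁆ =
    (n2Table (res8 i) (res8 j) : K) • (n2 K).basis (i + j) :=
  LieConstants.lie_basis_of_widthOne (s := n2 K) (a := fun i j => (n2Table (res8 i) (res8 j) : K))
    (fun _ _ => rfl) i j

variable [CharZero K]

theorem center_n2_eq_bot : LieAlgebra.center K (n2 K).Algebra = ⊥ := by
  refine LieConstants.center_eq_bot_of_widthOne (fun _ _ => rfl) fun j => ?_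
  have column (r : Fin 8) : n2Table 1 r ≠ 0 ∨ n2Table 2 r ≠ 0 := by decide +revert
  rcases column (res8 j) with h | h
  exacts [⟨1, Int.cast_ne_zero.2 h⟩, ⟨2, Int.cast_ne_zero.2 h⟩]

theorem not_isCrossLike_n2 : ¬ IsCrossLike (n2 K).Algebra := by
  intro h
  have lie {i j k : ℕ+} {t : ℤ} (hk : i + j = k) (ht : n2Table (res8 i) (res8 j) = t) :
      ⁅(n2 K).basis i, (n2 K).basis j⁆ = (t : K) • (n2 K).basis k := by
    rw [n2_lie_basis, hk, ht]
  have h9 := h ((n2 K).basis 1) ((n2 K).basis 2) ((n2 K).basis 4)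
  rw [lie (k := 3) (t := 1) (by decide) (by decide), lie (k := 5) (t := -3) (by decide) (by decide),
    Int.cast_one, one_smul, lie_smul, lie (k := 8) (t := -1) (by decide) (by decide), lie_smul,
    lie_smul, lie (k := 9) (t := -1) (by decide) (by decide)] at h9
  exact (n2 K).basis.ne_zero 9 (by simpa using h9)

theorem not_isCrossLike_n23 : ¬ IsCrossLike (n23 K).Algebra := fun h =>
  not_isCrossLike_n2 K (h.of_surjective LieConstants.centralExtProj_surjective)

end PeriodicInvariants

theorem center_n23_ne_bot (K : Type*) [Field K] : LieAlgebra.center K (n23 K).Algebra ≠ ⊥ :=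
  LieConstants.center_centralExt_ne_bot

section CentralSteps

variable {K : Type*} [Field K]

namespace LieConstants

variable {ι : Type*} {s : LieConstants K ι} {deg : ι → ℕ}

theorem lie_basis_mem_span_image {P : Set ι} {i j : ι} (h : ∀ k, s.c i j k ≠ 0 → k ∈ P) :
    ⁅s.basis i, s.basis j⁆ ∈ Submodule.span K (s.basis '' P) := by
  rw [Module.Basis.mem_span_image]
  intro k hk
  have hrepr : s.basis.repr ⁅s.basis i, s.basis j⁆ = s.c i j :=
    s.of.symm_apply_eq.2 (s.lie_e_eq_of i j)
  rw [hrepr] at hk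
  exact h k (Finsupp.mem_support_iff.1 hk)

theorem lowerCentralSeries_le_span_image (hpos : ∀ i, 0 < deg i)
    (hdeg : ∀ i j k, s.c i j k ≠ 0 → deg k = deg i + deg j) (n : ℕ) :
    (LieModule.lowerCentralSeries K s.Algebra s.Algebra n).toSubmodule ≤
      Submodule.span K (s.basis '' {i | n < deg i}) := by
  induction n with
  | zero =>
    have hall : {i | 0 < deg i} = Set.univ := Set.eq_univ_of_forall hpos
    rw [hall, Set.image_univ, s.basis.span_eq]
    exact le_top
  | succ n ih =>
    rw [LieModule.lowerCentralSeries_succ, LieSubmodule.lieIdeal_oper_eq_linear_span',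
      Submodule.span_le]
    rintro _ ⟨x, -, y, hy, rfl⟩
    refine LinearMap.BilinMap.apply_apply_mem_of_mem_span _ (Set.range s.basis) _
      (LieModule.toEnd K s.Algebra s.Algebra : s.Algebra →ₗ[K] s.Algebra →ₗ[K] s.Algebra) ?_ x y
      (s.basis.mem_span x) (ih hy)
    rintro _ ⟨i, rfl⟩ _ ⟨j, hj, rfl⟩
    refine lie_basis_mem_span_image fun k hk => ?_
    have hi := hpos i
    have hj : n < deg j := hj
    have hk := hdeg i j k hk
    exact Set.mem_ofPred.2 (by omega)

end LieConstants

theorem two_le_of_m0Cocycle_apply_ne_zero {S : OddSet} {i j : ℕ+} {r : S.1}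
    (h : m0Cocycle K S i j r ≠ 0) : 2 ≤ (i : ℕ) ∧ 2 ≤ (j : ℕ) ∧ (r : ℕ) + 2 = i + j := by
  unfold m0Cocycle at h
  split_ifs at h with hmem
  · obtain ⟨rfl, -⟩ := Finsupp.single_apply_ne_zero.1 h
    have hi : 2 ≤ (i : ℕ) := hmem.1
    have hj : 2 ≤ (j : ℕ) := hmem.2.1
    exact ⟨hi, hj, Nat.sub_add_cancel (by omega)⟩
  · exact absurd rfl h

variable (S : OddSet)

theorem filDegree_pos (i : ℕ+ ⊕ S.1) : 0 < filDegree S.1 i := by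
  rcases i with i | r
  · exact Nat.le_max_left _ _
  · have h3 := (S.2 r r.2).2
    rw [filDegree_inr]
    omega

theorem filDegree_eq_add_of_c_ne_zero {i j k : ℕ+ ⊕ S.1} (h : (m0S K S).c i j k ≠ 0) :
    filDegree S.1 k = filDegree S.1 i + filDegree S.1 j := by
  rcases i with i | i <;> rcases j with j | j
  · obtain ⟨m, rfl⟩ := exists_eq_succPNat i
    obtain ⟨n, rfl⟩ := exists_eq_succPNat j
    rcases k with k | r
    · replace h : (m0 K).c m.succPNat n.succPNat k ≠ 0 := by
        rwa [m0S, LieConstants.centralExt_c_inl_inl_apply_inl] at h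
      obtain ⟨rfl, hc⟩ := Finsupp.single_apply_ne_zero.1 h
      simp only [m0Coeff_eq, succPNat_eq_one_iff] at hc
      simp only [succPNat_add, filDegree_inl]
      split_ifs at hc <;> first | omega | exact absurd rfl hc
    · replace h : m0Cocycle K S m.succPNat n.succPNat r ≠ 0 := by
        rwa [m0S, LieConstants.centralExt_c_inl_inl_apply_inr] at h
      have hr := two_le_of_m0Cocycle_apply_ne_zero h
      simp only [Nat.succPNat_coe] at hr
      rw [filDegree_inl, filDegree_inl, filDegree_inr]
      omega
  all_goals exact absurd rfl h

theorem m0S_basis_inl_mem_lowerCentralSeries (n : ℕ) : (m0S K S).basis (.inl (n + 1).succPNat) ∈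
    LieModule.lowerCentralSeries K (m0S K S).Algebra (m0S K S).Algebra n := by
  induction n with
  | zero => exact LieSubmodule.mem_top _
  | succ n ih =>
    rw [LieModule.lowerCentralSeries_succ, LieConstants.basis_apply, ← m0S_lie_one]
    exact LieSubmodule.lie_mem_lie (LieSubmodule.mem_top _) ih

theorem m0S_basis_inr_mem_lowerCentralSeries (r : S.1) : (m0S K S).basis (.inr r) ∈
    LieModule.lowerCentralSeries K (m0S K S).Algebra (m0S K S).Algebra (r - 1) := by
  obtain ⟨r, hr⟩ := r
  obtain ⟨n, rfl⟩ : ∃ n, r = n + 2 := ⟨r - 2, by have := (S.2 r hr).2; omega⟩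
  have hlie := LieSubmodule.lie_mem_lie (LieSubmodule.mem_top ((m0S K S).e (.inl 2)))
    (m0S_basis_inl_mem_lowerCentralSeries (K := K) S n)
  rwa [LieConstants.basis_apply, m0S_lie_two K S hr, neg_mem_iff,
    ← LieModule.lowerCentralSeries_succ] at hlie

theorem centralSteps_m0S : centralSteps K (m0S K S).Algebra = S.1 := by
  have hle := LieConstants.lowerCentralSeries_le_span_image (s := m0S K S) (filDegree_pos S)
    fun _ _ _ => filDegree_eq_add_of_c_ne_zero S
  refine Set.Subset.antisymm ?_ fun r hr => ?_
  · rintro r ⟨x, hx, hmem, hnot⟩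
    by_contra hr
    refine hnot ?_
    have hsupp := (m0S K S).basis.mem_span_image.1 (hle _ hmem)
    rw [← (m0S K S).basis.linearCombination_repr x, Finsupp.linearCombination_apply]
    refine sum_mem fun i hi => Submodule.smul_mem _ _ ?_
    rcases i with i | q
    · exact absurd (LieConstants.repr_inl_eq_zero_of_mem_center (center_m0_eq_bot K) hx i)
        (Finsupp.mem_support_iff.1 hi)
    · have hrq : r - 1 < q := hsupp hi
      have hne : (q : ℕ) ≠ r := fun h => hr (h ▸ q.2)
      exact LieModule.antitone_lowerCentralSeries K _ _ (show r ≤ q - 1 by omega)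
        (m0S_basis_inr_mem_lowerCentralSeries S q)
  · refine ⟨(m0S K S).basis (.inr ⟨r, hr⟩), LieConstants.basis_inr_mem_center _,
      m0S_basis_inr_mem_lowerCentralSeries S ⟨r, hr⟩, fun h => ?_⟩
    have hsupp := (m0S K S).basis.mem_span_image.1 (hle _ h)
    rw [Module.Basis.repr_self] at hsupp
    have hlt : r < filDegree S.1 (.inr ⟨r, hr⟩) := hsupp (by simp)
    exact hlt.false

end CentralSteps

section Uniqueness

variable {K : Type*} [Field K] {g : Type*} [LieRing g] [LieAlgebra K g]

variable (K g) in
/-- The isomorphism invariants by which the algebras on the list are told apart, up to the sign in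
`n_1^±`, which they do not see. -/
def Profile : Name → Prop
  | .n1Plus => ¬ IsMetaCentral g ∧ IsCrossLike g
  | .n1Minus => ¬ IsMetaCentral g ∧ IsCrossLike g
  | .n2 => ¬ IsCrossLike g ∧ LieAlgebra.center K g = ⊥
  | .n23 => ¬ IsCrossLike g ∧ LieAlgebra.center K g ≠ ⊥
  | .m0 => IsMetaCentral g ∧ LieAlgebra.center K g = ⊥
  | .m0S S _ => IsMetaCentral g ∧ LieAlgebra.center K g ≠ ⊥ ∧ centralSteps K g = S.1

theorem profile_congr {L : Type*} [LieRing L] [LieAlgebra K L] (e : g ≃ₗ⁅K⁆ L) (N : Name) :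
    Profile K g N ↔ Profile K L N := by
  cases N <;> simp only [Profile, Ne, isMetaCentral_congr e, isCrossLike_congr e,
    center_eq_bot_congr e, centralSteps_congr e]

theorem IsoTo.profile [CharZero K] {N : Name} (h : IsoTo K g N) : Profile K g N := by
  rcases N with _ | _ | _ | _ | _ | ⟨S, hS⟩ <;> obtain ⟨e⟩ := h <;> rw [profile_congr e]
  · exact ⟨not_isMetaCentral_n1 one_ne_zero, isCrossLike_n1 1⟩
  · exact ⟨not_isMetaCentral_n1 (neg_ne_zero.2 one_ne_zero), isCrossLike_n1 (-1)⟩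
  · exact ⟨not_isCrossLike_n2 K, center_n2_eq_bot K⟩
  · exact ⟨not_isCrossLike_n23 K, center_n23_ne_bot K⟩
  · exact ⟨isMetaCentral_m0 K, center_m0_eq_bot K⟩
  · exact ⟨isMetaCentral_m0S K S, center_m0S_ne_bot K S hS, centralSteps_m0S S⟩

theorem Profile.eq {N N' : Name} (h : Profile K g N) (h' : Profile K g N') :
    N = N' ∨ N = .n1Plus ∧ N' = .n1Minus ∨ N = .n1Minus ∧ N' = .n1Plus := by
  have meta_cross : IsMetaCentral g → IsCrossLike g := IsMetaCentral.isCrossLike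
  rcases N with _ | _ | _ | _ | _ | ⟨S, hS⟩ <;> rcases N' with _ | _ | _ | _ | _ | ⟨S', hS'⟩ <;>
    simp only [Profile] at h h' <;> try tauto
  obtain rfl : S = S' := Subtype.ext (h.2.2.symm.trans h'.2.2)
  exact Or.inl rfl

theorem not_isoTo_n1Plus_and_n1Minus [LinearOrder K] [IsStrictOrderedRing K] :
    ¬ (IsoTo K g .n1Plus ∧ IsoTo K g .n1Minus) := by
  rintro ⟨⟨e⟩, ⟨e'⟩⟩
  exact not_isAnisotropic_n1 <|
    (isAnisotropic_congr e').1 ((isAnisotropic_congr e).2 isAnisotropic_n1)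

theorem IsoTo.eq_of_isStrictOrderedRing [LinearOrder K] [IsStrictOrderedRing K] {N N' : Name}
    (h : IsoTo K g N) (h' : IsoTo K g N') : N = N' := by
  have := IsStrictOrderedRing.toCharZero (R := K)
  rcases h.profile.eq h'.profile with hN | ⟨rfl, rfl⟩ | ⟨rfl, rfl⟩
  · exact hN
  · exact (not_isoTo_n1Plus_and_n1Minus ⟨h, h'⟩).elim
  · exact (not_isoTo_n1Plus_and_n1Minus ⟨h', h⟩).elim

theorem IsoTo.eq_of_ne_n1Minus [CharZero K] {N N' : Name} (h : IsoTo K g N) (h' : IsoTo K g N')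
    (hN : N ≠ .n1Minus) (hN' : N' ≠ .n1Minus) : N = N' := by
  rcases h.profile.eq h'.profile with hNN' | ⟨-, h0⟩ | ⟨h0, -⟩
  exacts [hNN', absurd h0 hN', absurd h0 hN]

end Uniqueness

section Existence

variable {K : Type*} [Field K] {g : Type*} [LieRing g] [LieAlgebra K g] {ε : K}

theorem isoTo_n1Plus_of_isSquare (hε : ε ≠ 0) (hsq : IsSquare ε) (e : g ≃ₗ⁅K⁆ n1 ε) :
    IsoTo K g .n1Plus := by
  obtain ⟨β, hβ⟩ := hsq
  obtain ⟨f⟩ := nonempty_n1_lieEquiv_n1 (ε' := 1) (β := β) hε (by rw [hβ, mul_one, sq])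
  exact ⟨e.trans f.symm⟩

theorem isoTo_n1Minus_of_isSquare_neg (hε : ε ≠ 0) (hsq : IsSquare (-ε)) (e : g ≃ₗ⁅K⁆ n1 ε) :
    IsoTo K g .n1Minus := by
  obtain ⟨β, hβ⟩ := hsq
  obtain ⟨f⟩ := nonempty_n1_lieEquiv_n1 (ε' := -1) (β := β) hε
    (by rw [mul_neg_one, sq, ← hβ, neg_neg])
  exact ⟨e.trans f.symm⟩

variable {𝒜 : ℕ → Submodule K g} [CharZero K] [GradedLieAlgebra 𝒜]

theorem IsNarrow.n1_or_isoTo (h : IsNarrow 𝒜) (hinf : ¬ FiniteDimensional K g) :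
    (∃ ε : K, ε ≠ 0 ∧ Nonempty (g ≃ₗ⁅K⁆ n1 ε)) ∨ ∃ N : Name, N ≠ .n1Minus ∧ IsoTo K g N := by
  rcases h.classification hinf with hn1 | e | e | e | ⟨S, hS, e⟩
  exacts [.inl hn1, .inr ⟨.n2, nofun, e⟩, .inr ⟨.n23, nofun, e⟩, .inr ⟨.m0, nofun, e⟩,
    .inr ⟨.m0S S hS, nofun, e⟩]

theorem IsNarrow.exists_isoTo (hsq : ∀ x : K, IsSquare x ∨ IsSquare (-x)) (h : IsNarrow 𝒜)
    (hinf : ¬ FiniteDimensional K g) : ∃ N : Name, IsoTo K g N := by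
  rcases h.n1_or_isoTo hinf with ⟨ε, hε, ⟨e⟩⟩ | ⟨N, -, hN⟩
  · rcases hsq ε with hpos | hneg
    exacts [⟨_, isoTo_n1Plus_of_isSquare hε hpos e⟩, ⟨_, isoTo_n1Minus_of_isSquare_neg hε hneg e⟩]
  · exact ⟨N, hN⟩

theorem IsNarrow.exists_isoTo_ne_n1Minus (hsq : ∀ x : K, IsSquare x) (h : IsNarrow 𝒜)
    (hinf : ¬ FiniteDimensional K g) : ∃ N : Name, N ≠ .n1Minus ∧ IsoTo K g N := by
  rcases h.n1_or_isoTo hinf with ⟨ε, hε, ⟨e⟩⟩ | hN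
  exacts [⟨.n1Plus, nofun, isoTo_n1Plus_of_isSquare hε (hsq ε) e⟩, hN]

end Existence

end NarrowLie

end

theorem theorem1_general :
    (∀ (K : Type*) [Field K] [LinearOrder K] [IsStrictOrderedRing K],
      (∀ x : K, 0 ≤ x → IsSquare x) →
      ∀ (g : Type*) [LieRing g] [LieAlgebra K g] (𝒜 : ℕ → Submodule K g) [GradedLieAlgebra 𝒜],
        ¬ FiniteDimensional K g → NarrowLie.IsNarrow 𝒜 →
          ∃! N : NarrowLie.Name, NarrowLie.IsoTo K g N) ∧
    (∀ (K : Type*) [Field K] [CharZero K], (∀ x : K, IsSquare x) →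
      (∀ (g : Type*) [LieRing g] [LieAlgebra K g] (𝒜 : ℕ → Submodule K g) [GradedLieAlgebra 𝒜],
        ¬ FiniteDimensional K g → NarrowLie.IsNarrow 𝒜 →
          ∃! N : NarrowLie.Name, N ≠ .n1Minus ∧ NarrowLie.IsoTo K g N) ∧
      Nonempty (NarrowLie.n1 (1 : K) ≃ₗ⁅K⁆ NarrowLie.n1 (-1 : K))) := by
  refine ⟨fun K _ _ _ hsq g _ _ 𝒜 _ hinf h => ?_, fun K _ _ hsq => ⟨fun g _ _ 𝒜 _ hinf h => ?_, ?_⟩⟩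
  · have := IsStrictOrderedRing.toCharZero (R := K)
    have square_or (x : K) : IsSquare x ∨ IsSquare (-x) :=
      (le_total 0 x).imp (hsq x) fun hx => hsq (-x) (neg_nonneg.2 hx)
    obtain ⟨N, hN⟩ := h.exists_isoTo square_or hinf
    exact ⟨N, hN, fun N' hN' => hN'.eq_of_isStrictOrderedRing hN⟩
  · obtain ⟨N, hm, hN⟩ := h.exists_isoTo_ne_n1Minus hsq hinf
    exact ⟨N, ⟨hm, hN⟩, fun N' ⟨hm', hN'⟩ => hN'.eq_of_ne_n1Minus hN hm' hm⟩
  · obtain ⟨e⟩ := NarrowLie.isoTo_n1Plus_of_isSquare (neg_ne_zero.2 one_ne_zero) (hsq (-1))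
      (LieEquiv.refl : NarrowLie.n1 (-1 : K) ≃ₗ⁅K⁆ NarrowLie.n1 (-1 : K))
    exact ⟨e.symm⟩

theorem theorem1 :
    (∀ (g : Type*) [LieRing g] [LieAlgebra ℝ g] (𝒜 : ℕ → Submodule ℝ g) [GradedLieAlgebra 𝒜],
      ¬ FiniteDimensional ℝ g → NarrowLie.IsNarrow 𝒜 →
        ∃! N : NarrowLie.Name, NarrowLie.IsoTo ℝ g N) ∧
    (∀ (g : Type*) [LieRing g] [LieAlgebra ℂ g] (𝒜 : ℕ → Submodule ℂ g) [GradedLieAlgebra 𝒜],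
      ¬ FiniteDimensional ℂ g → NarrowLie.IsNarrow 𝒜 →
        ∃! N : NarrowLie.Name, N ≠ .n1Minus ∧ NarrowLie.IsoTo ℂ g N) ∧
    Nonempty (NarrowLie.n1 (1 : ℂ) ≃ₗ⁅ℂ⁆ NarrowLie.n1 (-1 : ℂ)) :=
  ⟨theorem1_general.{0, _, 0, 0}.1 ℝ fun _ => Real.isSquare_iff.2,
    theorem1_general.{0, 0, 0, _}.2 ℂ IsAlgClosed.exists_eq_mul_self⟩
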